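/- Theorem 3.1. Let $X\subset\mathbb R^d$ be compact and let $\{S_i:X\to X\}_{i=1}^{\ell}$ be a $C^1$-conformal IFS on $X$: there is an open set $U\supset X$ such that each $S_i$ extends to an injective $C^1$ map $S_i:U\to U$ which is contracting ($|S_i(x)-S_i(y)|\le c|x-y|$ on $U$ for some $0<c<1$) and conformal ($|S_i'(x)y|=|S_i'(x)|\,|y|\ne0$ for $x\in U$, $y\neq0$). Let $K\subset X$ be its attractor, i.e. the unique non-empty compact set with $K=\bigcup_i S_i(K)$. For a word $u=u_1\cdots u_j$ put $S_u=S_{u_1}\circ\cdots\circ S_{u_j}$ (the identity for the empty word), and let $W_n$ be the set of non-empty words $u$ with $\operatorname{diam}S_u(K)\le 2^{-n}<\operatorname{diam}S_{\tilde u}(K)$, where $\tilde u$ is $u$ without its last letter. Assume that the IFS satisfies the asymptotically weak separation condition (AWSC): there are positive integers $t_n$ with $\frac1n\log t_n\to0$ such that, for all $n\ge1$ and $v\in\mathbb Z^d$, $$\#\{S_u:\ u\in W_n,\ S_u(K)\cap([0,2^{-n})^d+2^{-n}v)\ne\emptyset\}\le t_n,$$ where the $S_u$ are counted as maps on $X$.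 Let $(p_1,\dots,p_\ell)$ be a probability vector and let $\nu$ be the associated self-conformal measure, i.e. the unique Borel probability measure on $X$ with $\nu=\sum_{i=1}^\ell p_i\,\nu\circ S_i^{-1}$. Let $B_r(x)$ denote the closed ball, and let $\tau(q)=\liminf_{r\to0+}\frac{\log\Theta(q;r)}{\log r}$ be the $L^q$ spectrum of $\nu$, where $\Theta(q;r)=\sup\sum_i\nu(B_r(x_i))^q$, the supremum being over all families of disjoint balls $B_r(x_i)$ with $x_i\in\operatorname{supp}\nu$. Then $\nu$ has an asymptotically good multifractal structure over $\mathbb R_+$; more precisely, $\tau(q)$ is finite for every $q\in\mathbb R$, and the following local box-counting principle holds at every $q>0$ at which $\tau'(q)$ exists (in particular, at all $q$ of a dense subset of the set of such $q$). For each integer $k\ge1$ there are positive numbers $a(q,k)$, $b(q,k)$, $f_n(q,k)$ $(n=0,1,2,\dots)$ with $$\lim_{k\to\infty}b(q,k)=0,\qquad \lim_{n\to\infty}\frac{f_n(q,k)}{n}=0\ \text{ for each }k,$$ such that for all $k\ge1$, $n\ge0$, all $x\in\mathbb R^d$ with $\nu(B_{2^{-n-1}}(x))>0$, and all integers $$m\ge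 f_n(q,k)+a(q,k)\log\frac{\nu(B_{2^{-n}}(x))}{\nu(B_{2^{-n-1}}(x))},$$ there are pairwise disjoint balls $B_{2^{-n-m}}(x_i)\subset B_{2^{-n}}(x)$, $i=1,\dots,N$, with $N\ge 2^{m(\tau'(q)q-\tau(q)-b(q,k))}$ and, for every $i$, $$2^{-m(\tau'(q)+1/k)}\le\frac{\nu(B_{2^{-n-m}}(x_i))}{\nu(B_{2^{-n}}(x))}\le 2^{-m(\tau'(q)-1/k)},$$ $$\nu(B_{2^{-n-m-1}}(x_i))>0,\qquad \frac{\nu(B_{2^{-n-m+1}}(x_i))}{\nu(B_{2^{-n-m-1}}(x_i))}\le f_{n+m}(q,k).$$ -/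

import Mathlib

open Set Filter Topology MeasureTheory
open scoped ENNReal NNReal

noncomputable section

namespace SelfConformal

/-- A `C¹` map `S` on the open set `U ⊆ ℝ^d` is conformal if its differential satisfies
`|S'(x) y| = |S'(x)| |y| ≠ 0` for all `x ∈ U` and `y ≠ 0`. -/
def IsC1ConformalOn {d : ℕ} (S : EuclideanSpace ℝ (Fin d) → EuclideanSpace ℝ (Fin d))
    (U : Set (EuclideanSpace ℝ (Fin d))) : Prop :=
  ContDiffOn ℝ 1 S U ∧
    ∀ x ∈ U, ∀ y : EuclideanSpace ℝ (Fin d), y ≠ 0 →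
      ‖fderiv ℝ S x y‖ = ‖fderiv ℝ S x‖ * ‖y‖ ∧ ‖fderiv ℝ S x y‖ ≠ 0

/-- `S` is contracting on `U`: `|S x - S y| ≤ c |x - y|` on `U` for some `0 < c < 1`. -/
def IsContractingOn {d : ℕ} (S : EuclideanSpace ℝ (Fin d) → EuclideanSpace ℝ (Fin d))
    (U : Set (EuclideanSpace ℝ (Fin d))) : Prop :=
  ∃ c : ℝ, 0 < c ∧ c < 1 ∧ ∀ x ∈ U, ∀ y ∈ U, ‖S x - S y‖ ≤ c * ‖x - y‖

/-- `{S i : X → X}` is a `C¹`-conformal iterated function system on the compact set `X`: there is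
an open set `U ⊇ X` such that each `S i` extends to an injective contracting `C¹`-conformal map
`T i : U → U`.  (Only the values of `S i` on `X` matter.) -/
def IsC1ConformalIFS {d ℓ : ℕ}
    (S : Fin ℓ → EuclideanSpace ℝ (Fin d) → EuclideanSpace ℝ (Fin d))
    (X : Set (EuclideanSpace ℝ (Fin d))) : Prop :=
  IsCompact X ∧ (∀ i, MapsTo (S i) X X) ∧
    ∃ U : Set (EuclideanSpace ℝ (Fin d)), IsOpen U ∧ X ⊆ U ∧
      ∃ T : Fin ℓ → EuclideanSpace ℝ (Fin d) → EuclideanSpace ℝ (Fin d),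
        ∀ i, EqOn (T i) (S i) X ∧ MapsTo (T i) U U ∧ InjOn (T i) U ∧
          IsContractingOn (T i) U ∧ IsC1ConformalOn (T i) U

/-- `K` is the attractor of the IFS on `X`: the (unique) non-empty compact subset of `X` with
`K = ⋃ i, S i (K)`. -/
def IsAttractor {d ℓ : ℕ}
    (S : Fin ℓ → EuclideanSpace ℝ (Fin d) → EuclideanSpace ℝ (Fin d))
    (X K : Set (EuclideanSpace ℝ (Fin d))) : Prop :=
  K.Nonempty ∧ IsCompact K ∧ K ⊆ X ∧ K = ⋃ i, S i '' K

/-- `ν` is the self-conformal measure on `X` for the IFS `S` and the probability vector `p`: the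
(unique) Borel probability measure on `X` with `ν = ∑ i, p i • (ν ∘ (S i)⁻¹)`.  Each `S i` is
continuous on `X` and `ν` lives on `X`, so `ν.map (S i)` is the genuine push-forward. -/
def IsSelfConformalMeasure {d ℓ : ℕ}
    (S : Fin ℓ → EuclideanSpace ℝ (Fin d) → EuclideanSpace ℝ (Fin d))
    (X : Set (EuclideanSpace ℝ (Fin d))) (p : Fin ℓ → ℝ≥0)
    (ν : Measure (EuclideanSpace ℝ (Fin d))) : Prop :=
  IsProbabilityMeasure ν ∧ ν Xᶜ = 0 ∧ ν = ∑ i, p i • ν.map (S i)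

/-- `S_u = S_{u₁} ∘ ⋯ ∘ S_{uₙ}` for a word `u = u₁ ⋯ uₙ` (the identity for the empty word). -/
def wordMap {d ℓ : ℕ} (S : Fin ℓ → EuclideanSpace ℝ (Fin d) → EuclideanSpace ℝ (Fin d)) :
    List (Fin ℓ) → EuclideanSpace ℝ (Fin d) → EuclideanSpace ℝ (Fin d)
  | [] => id
  | i :: u => S i ∘ wordMap S u

/-- `W_n`: the non-empty words `u` with `diam S_u(K) ≤ 2⁻ⁿ < diam S_ũ(K)`, where `ũ` is `u`
without its last letter. -/
def cutWords {d ℓ : ℕ} (S : Fin ℓ → EuclideanSpace ℝ (Fin d) → EuclideanSpace ℝ (Fin d))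
    (K : Set (EuclideanSpace ℝ (Fin d))) (n : ℕ) : Set (List (Fin ℓ)) :=
  {u | u ≠ [] ∧ Metric.diam (wordMap S u '' K) ≤ (2 : ℝ) ^ (-(n : ℤ)) ∧
    (2 : ℝ) ^ (-(n : ℤ)) < Metric.diam (wordMap S u.dropLast '' K)}

/-- The dyadic cube `[0, 2⁻ⁿ)^d + 2⁻ⁿ v`, `v ∈ ℤ^d`. -/
def dyadicCube {d : ℕ} (n : ℕ) (v : Fin d → ℤ) : Set (EuclideanSpace ℝ (Fin d)) :=
  {x | ∀ j, (v j : ℝ) * (2 : ℝ) ^ (-(n : ℤ)) ≤ x j ∧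
    x j < ((v j : ℝ) + 1) * (2 : ℝ) ^ (-(n : ℤ))}

/-- The asymptotically weak separation condition: there are natural numbers `t n` with
`(log t n) / n → 0` such that, for every `n ≥ 1`, each dyadic cube of side `2⁻ⁿ` meets `S_u(K)` for
at most `t n` distinct maps `S_u : X → X`, `u ∈ W_n`. -/
def AWSC {d ℓ : ℕ} (S : Fin ℓ → EuclideanSpace ℝ (Fin d) → EuclideanSpace ℝ (Fin d))
    (X K : Set (EuclideanSpace ℝ (Fin d))) : Prop :=
  ∃ t : ℕ → ℕ, (∀ n, 0 < t n) ∧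
    Tendsto (fun n : ℕ => Real.log (t n) / (n : ℝ)) atTop (𝓝 0) ∧
    ∀ n : ℕ, 1 ≤ n → ∀ v : Fin d → ℤ,
      ((fun u => X.domRestrict (wordMap S u)) ''
        {u | u ∈ cutWords S K n ∧ (wordMap S u '' K ∩ dyadicCube n v).Nonempty}).encard
        ≤ (t n : ℕ∞)

/-- `Θ_μ(q; r) = sup ∑ᵢ μ(B_r(xᵢ))^q` over families of disjoint closed balls with centres in the
support of `μ`.  The terms are non-negative, so finite families give the same supremum. -/
def packingSum {d : ℕ} (μ : Measure (EuclideanSpace ℝ (Fin d))) (q r : ℝ) : ℝ≥0∞ :=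
  ⨆ (s : Finset (EuclideanSpace ℝ (Fin d)))
    (_ : (s : Set (EuclideanSpace ℝ (Fin d))) ⊆ μ.support ∧
      (s : Set (EuclideanSpace ℝ (Fin d))).PairwiseDisjoint (fun x => Metric.closedBall x r)),
    ∑ x ∈ s, μ (Metric.closedBall x r) ^ q

/-- The `L^q` spectrum `liminf_{r → 0+} log Θ_μ(q; r) / log r`, as an extended real. -/
def lqSpectrumE {d : ℕ} (μ : Measure (EuclideanSpace ℝ (Fin d))) (q : ℝ) : EReal :=
  liminf (fun r : ℝ => ENNReal.log (packingSum μ q r) / ((Real.log r : ℝ) : EReal)) (𝓝[>] 0)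

/-- The `L^q` spectrum is finite at every real `q`. -/
def FiniteLqSpectrum {d : ℕ} (μ : Measure (EuclideanSpace ℝ (Fin d))) : Prop :=
  ∀ q : ℝ, lqSpectrumE μ q ≠ ⊥ ∧ lqSpectrumE μ q ≠ ⊤

/-- The `L^q` spectrum `τ(q)` as a real function; meant for `μ` with finite `L^q` spectrum. -/
def lqSpectrum {d : ℕ} (μ : Measure (EuclideanSpace ℝ (Fin d))) (q : ℝ) : ℝ :=
  (lqSpectrumE μ q).toReal

/-- `Ω`: the set of `q` at which the derivative `τ'(q)` exists. -/
def diffSet {d : ℕ} (μ : Measure (EuclideanSpace ℝ (Fin d))) : Set ℝ :=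
  {q | DifferentiableAt ℝ (lqSpectrum μ) q}

/-- The conclusion of the local box-counting principle at fixed `q`, `k`, `n`, `m`, `x`, with
`b = b(q,k)` and `F = f_{n+m}(q,k)`: there are disjoint balls `B_{2^{-n-m}}(x_i) ⊆ B_{2^{-n}}(x)`,
`1 ≤ i ≤ N`, with the stated bounds on `N` and on the measures. -/
def HasGoodBalls {d : ℕ} (μ : Measure (EuclideanSpace ℝ (Fin d))) (q : ℝ) (k n m : ℕ)
    (x : EuclideanSpace ℝ (Fin d)) (b F : ℝ) : Prop :=
  ∃ (N : ℕ) (y : Fin N → EuclideanSpace ℝ (Fin d)),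
    Pairwise (fun i j => Disjoint (Metric.closedBall (y i) ((2 : ℝ) ^ (-(n : ℤ) - m)))
      (Metric.closedBall (y j) ((2 : ℝ) ^ (-(n : ℤ) - m)))) ∧
    (2 : ℝ) ^ ((m : ℝ) * (deriv (lqSpectrum μ) q * q - lqSpectrum μ q - b)) ≤ (N : ℝ) ∧
    ∀ i : Fin N,
      Metric.closedBall (y i) ((2 : ℝ) ^ (-(n : ℤ) - m)) ⊆
        Metric.closedBall x ((2 : ℝ) ^ (-(n : ℤ))) ∧
      (2 : ℝ) ^ (-(m : ℝ) * (deriv (lqSpectrum μ) q + 1 / (k : ℝ))) ≤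
        μ.real (Metric.closedBall (y i) ((2 : ℝ) ^ (-(n : ℤ) - m))) /
          μ.real (Metric.closedBall x ((2 : ℝ) ^ (-(n : ℤ)))) ∧
      μ.real (Metric.closedBall (y i) ((2 : ℝ) ^ (-(n : ℤ) - m))) /
          μ.real (Metric.closedBall x ((2 : ℝ) ^ (-(n : ℤ)))) ≤
        (2 : ℝ) ^ (-(m : ℝ) * (deriv (lqSpectrum μ) q - 1 / (k : ℝ))) ∧
      0 < μ.real (Metric.closedBall (y i) ((2 : ℝ) ^ (-(n : ℤ) - m - 1))) ∧
      μ.real (Metric.closedBall (y i) ((2 : ℝ) ^ (-(n : ℤ) - m + 1))) /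
          μ.real (Metric.closedBall (y i) ((2 : ℝ) ^ (-(n : ℤ) - m - 1))) ≤ F

/-- The local box-counting principle for `μ` at `q`: there are positive numbers `a(q,k)`, `b(q,k)`,
`f_n(q,k)` (`k ≥ 1`, `n ≥ 0`) with `b(q,k) → 0` as `k → ∞` and `f_n(q,k)/n → 0` as `n → ∞`, such
that `HasGoodBalls` holds for all `n ≥ 0`, all `x` with `μ(B_{2^{-n-1}}(x)) > 0` and all integers
`m ≥ f_n(q,k) + a(q,k) log (μ(B_{2^{-n}}(x)) / μ(B_{2^{-n-1}}(x)))`. -/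
def LocalBoxCountingPrinciple {d : ℕ} (μ : Measure (EuclideanSpace ℝ (Fin d))) (q : ℝ) : Prop :=
  ∃ (a b : ℕ → ℝ) (f : ℕ → ℕ → ℝ),
    (∀ k, 1 ≤ k → 0 < a k ∧ 0 < b k ∧ ∀ n, 0 < f k n) ∧
    Tendsto b atTop (𝓝 0) ∧
    (∀ k, 1 ≤ k → Tendsto (fun n : ℕ => f k n / (n : ℝ)) atTop (𝓝 0)) ∧
    ∀ k, 1 ≤ k → ∀ (n : ℕ) (x : EuclideanSpace ℝ (Fin d)),
      0 < μ.real (Metric.closedBall x ((2 : ℝ) ^ (-(n : ℤ) - 1))) →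
      ∀ m : ℕ,
        f k n + a k * Real.log (μ.real (Metric.closedBall x ((2 : ℝ) ^ (-(n : ℤ)))) /
          μ.real (Metric.closedBall x ((2 : ℝ) ^ (-(n : ℤ) - 1)))) ≤ (m : ℝ) →
        HasGoodBalls μ q k n m x (b k) (f k (n + m))

/-- `μ` has an asymptotically good multifractal structure over `I` (`I = ℝ` or `I = (0, ∞)`):
`τ(q)` is finite for every real `q`, and the local box-counting principle holds at every `q` in some
dense subset `Λ` of `Ω ∩ I`. -/
def HasAsymptoticallyGoodMultifractalStructure {d : ℕ}
    (μ : Measure (EuclideanSpace ℝ (Fin d))) (I : Set ℝ) : Prop :=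
  FiniteLqSpectrum μ ∧
    ∃ Λ : Set ℝ, Λ ⊆ diffSet μ ∩ I ∧ diffSet μ ∩ I ⊆ closure Λ ∧
      ∀ q ∈ Λ, LocalBoxCountingPrinciple μ q

end SelfConformal

end

/-!
The proof separates the geometry of the iterated function system from the multifractal argument.
The interface between the two is `HasSubexpDecomposition`: at every scale `2⁻ⁿ`, `ν` is a combination
of images of itself under finitely many maps which act on `K` like similarities of ratio `2⁻ⁿ`, and of
which only few have images meeting a given ball of radius `2⁻ⁿ`, all errors being subexponential
in `n`.

For a self-conformal measure the maps are the `S_u`, `u ∈ W_{n+k}` with `k` fixed.  They are almost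
similarities by bounded distortion (`MetricIFS.exists_distortion_bound`): a conformal `C¹` map
multiplies all small distances near a point by almost the same factor, uniformly on `X`, so each
letter of `u` except boundedly many costs a factor `2^ε`.  The separation condition bounds the number
of maps near a ball.

Such a decomposition gives a local `L^q` estimate (`HasSubexpDecomposition.sum_rpow_le`): for `q > 0`,
the `q`-sum of `ν` over disjoint balls of radius `2^{-n-m}` inside the ball of radius `2⁻ⁿ` about `x`
is at most `ν(B_{2⁻ⁿ}(x))^q Θ(q; 2⁻ᵐ)`, up to a subexponential factor.  It has two consequences.
The packing sums are almost submultiplicative, so that for `q > 0` the lower limit defining `τ(q)` is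
a limit; then differentiability at `q` yields, at every small scale `2⁻ᵐ`, about
`2^{m(q τ'(q) - τ(q))}` disjoint balls of measure at least about `2^{-m τ'(q)}`
(`HasSubexpDecomposition.eventually_exists_typical_balls`).  And, used with the exponent `q + h`, it
shows that inside any ball only comparatively few balls are much heavier than `2^{-m τ'(q)}` times the
measure of the ball.

To produce good balls inside `B_{2⁻ⁿ}(x)`, choose a piece of the decomposition which meets
`B_{2⁻ⁿ⁻¹}(x)` and carries a large part of its measure, transport typical balls of `ν` by the
corresponding map, and discard the few images that are too heavy.  The doubling condition, with a
constant depending only on the dimension, is obtained by moving each ball a little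
(`exists_doubling_ball`): if no doubling ball of comparable measure were nearby, the measure of
concentric balls would grow exponentially in the number of steps of size `2 * 2^{-n-m}`, and a number
of steps linear in `m` contradicts the lower bound on the measure.  The loss is only polynomial in `m`.
-/

namespace SelfConformal

/-! ### Packing and covering in finite-dimensional normed spaces -/

section Packing

variable {E : Type*} [NormedAddCommGroup E] [NormedSpace ℝ E] [FiniteDimensional ℝ E]

/-- Volume bound: an `r`-separated family in a ball of radius `R` has at most `(1 + 2R/r)^d`
members. -/
lemma card_le_of_separated {ι : Type*} (s : Finset ι) (z : ι → E) (x : E) {R r : ℝ}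
    (hr : 0 < r) (hR : 0 ≤ R) (hz : ∀ i ∈ s, dist (z i) x ≤ R)
    (hsep : ∀ i ∈ s, ∀ j ∈ s, i ≠ j → r ≤ dist (z i) (z j)) :
    (s.card : ℝ) ≤ (1 + 2 * R / r) ^ Module.finrank ℝ E := by
  let : MeasurableSpace E := borel E
  have : BorelSpace E := ⟨rfl⟩
  let μ : Measure E := Measure.addHaar
  have hball : ∀ (a : E) {ρ : ℝ}, 0 < ρ →
      μ.real (Metric.ball a ρ) = ρ ^ Module.finrank ℝ E * μ.real (Metric.ball 0 1) := by
    intro a ρ hρ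
    rw [Measure.real, Measure.addHaar_ball_of_pos μ a hρ, ENNReal.toReal_mul,
      ENNReal.toReal_ofReal (by positivity), Measure.real]
  have hdisj : (s : Set ι).PairwiseDisjoint (fun i => Metric.ball (z i) (r / 2)) := by
    intro i hi j hj hij
    apply Metric.ball_disjoint_ball
    linarith [hsep i hi j hj hij]
  have hsub : (⋃ i ∈ s, Metric.ball (z i) (r / 2)) ⊆ Metric.ball x (R + r / 2) := by
    refine iUnion₂_subset fun i hi => Metric.ball_subset_ball' ?_
    linarith [hz i hi]
  have h1 : ∑ i ∈ s, μ.real (Metric.ball (z i) (r / 2)) ≤ μ.real (Metric.ball x (R + r / 2)) := by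
    rw [← measureReal_biUnion_finset hdisj (fun i _ => measurableSet_ball)
      (fun i _ => measure_ball_lt_top.ne)]
    exact measureReal_mono hsub measure_ball_lt_top.ne
  have h2 : ∀ i ∈ s, μ.real (Metric.ball (z i) (r / 2)) =
      (r / 2) ^ Module.finrank ℝ E * μ.real (Metric.ball 0 1) := fun i _ => hball _ (by positivity)
  rw [Finset.sum_congr rfl h2, hball x (by positivity), Finset.sum_const, nsmul_eq_mul] at h1
  have hpos : 0 < μ.real (Metric.ball (0 : E) 1) :=
    ENNReal.toReal_pos (Metric.measure_ball_pos μ 0 one_pos).ne' measure_ball_lt_top.ne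
  have h3 : (s.card : ℝ) * (r / 2) ^ Module.finrank ℝ E ≤ (R + r / 2) ^ Module.finrank ℝ E := by
    refine le_of_mul_le_mul_right ?_ hpos
    linarith
  have h4 : (R + r / 2) = (1 + 2 * R / r) * (r / 2) := by field_simp; ring
  rw [h4, mul_pow] at h3
  exact le_of_mul_le_mul_right h3 (by positivity)

/-- A bounded set contains a finite `r`-separated subset whose closed `r`-balls cover it. -/
lemma exists_separated_cover {A : Set E} {x : E} {R r : ℝ} (hr : 0 < r) (hR : 0 ≤ R)
    (hA : A ⊆ Metric.closedBall x R) :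
    ∃ t : Finset E, (t : Set E) ⊆ A ∧ (∀ a ∈ t, ∀ b ∈ t, a ≠ b → r < dist a b) ∧
      ∀ a ∈ A, ∃ b ∈ t, dist a b ≤ r := by
  classical
  by_contra! hcon
  have key : ∀ n : ℕ, ∃ t : Finset E, (t : Set E) ⊆ A ∧
      (∀ a ∈ t, ∀ b ∈ t, a ≠ b → r < dist a b) ∧ t.card = n := by
    intro n
    induction n with
    | zero => exact ⟨∅, by simp, by simp, rfl⟩
    | succ n ih =>
      obtain ⟨t, htA, hts, htn⟩ := ih
      obtain ⟨a, haA, ha⟩ := hcon t htA hts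
      have hat : a ∉ t := fun h => absurd (ha a h) (by simp [hr.le])
      refine ⟨insert a t, ?_, ?_, by rw [Finset.card_insert_of_notMem hat, htn]⟩
      · rw [Finset.coe_insert]
        exact insert_subset haA htA
      · intro b hb c hc hbc
        rcases Finset.mem_insert.1 hb with rfl | hb'
        · rcases Finset.mem_insert.1 hc with rfl | hc'
          · exact absurd rfl hbc
          · exact ha c hc'
        · rcases Finset.mem_insert.1 hc with rfl | hc'
          · rw [dist_comm]; exact ha b hb'
          · exact hts b hb' c hc' hbc
  obtain ⟨n, hn⟩ := exists_nat_gt ((1 + 2 * R / r) ^ Module.finrank ℝ E)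
  obtain ⟨t, htA, hts, htn⟩ := key n
  have := card_le_of_separated t (fun a => a) x hr hR (fun i hi => hA (htA hi))
    (fun i hi j hj hij => (hts i hi j hj hij).le)
  rw [htn] at this
  linarith

end Packing

/-- Greedy selection: if every index is related to at most `M` indices (itself included), then some
unrelated subfamily carries at least the proportion `1/M` of the total weight. -/
lemma exists_unrelated_subset {ι : Type*} (r : ι → ι → Prop) (hsymm : ∀ i j, r i j → r j i)
    (hrefl : ∀ i, r i i) (g : ι → ℝ) (hg : ∀ i, 0 ≤ g i) {M : ℝ} (s : Finset ι)
    (hM : ∀ i ∈ s, ∀ t ⊆ s, (∀ j ∈ t, r i j) → (t.card : ℝ) ≤ M) :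
    ∃ t ⊆ s, (∀ i ∈ t, ∀ j ∈ t, i ≠ j → ¬ r i j) ∧ ∑ i ∈ s, g i ≤ M * ∑ i ∈ t, g i := by
  classical
  induction s using Finset.strongInduction with
  | H s ih =>
    rcases s.eq_empty_or_nonempty with rfl | hne
    · exact ⟨∅, by simp, by simp, by simp⟩
    obtain ⟨a, has, hamax⟩ := s.exists_max_image g hne
    let s' := s.filter (fun j => ¬ r a j)
    let n := s.filter (fun j => r a j)
    have hss : s' ⊂ s := by
      refine Finset.filter_ssubset.2 ⟨a, has, ?_⟩
      simpa using hrefl a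
    obtain ⟨t, hts, htun, htsum⟩ := ih s' hss fun i hi u hu => hM i (hss.1 hi) u (hu.trans hss.1)
    have hat : a ∉ t := fun h => (Finset.mem_filter.1 (hts h)).2 (hrefl a)
    refine ⟨insert a t, ?_, ?_, ?_⟩
    · exact Finset.insert_subset has (hts.trans hss.1)
    · intro i hi j hj hij
      rcases Finset.mem_insert.1 hi with rfl | hi'
      · rcases Finset.mem_insert.1 hj with rfl | hj'
        · exact absurd rfl hij
        · exact (Finset.mem_filter.1 (hts hj')).2
      · rcases Finset.mem_insert.1 hj with rfl | hj'
        · exact fun h => (Finset.mem_filter.1 (hts hi')).2 (hsymm _ _ h)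
        · exact htun i hi' j hj' hij
    · have h1 : ∑ i ∈ n, g i ≤ M * g a := by
        calc ∑ i ∈ n, g i ≤ n.card • g a :=
              Finset.sum_le_card_nsmul _ _ _ fun i hi => hamax i (Finset.mem_filter.1 hi).1
          _ = (n.card : ℝ) * g a := nsmul_eq_mul _ _
          _ ≤ M * g a := mul_le_mul_of_nonneg_right
              (hM a has n (Finset.filter_subset _ _) fun j hj => (Finset.mem_filter.1 hj).2) (hg a)
      rw [Finset.sum_insert hat, mul_add,
        ← Finset.sum_filter_add_sum_filter_not s (fun j => r a j)]
      exact add_le_add h1 htsum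

/-- A family of subsets of `A` covering each point at most `M` times has total measure at most
`M μ(A)`. -/
lemma sum_measureReal_le_of_multiplicity {α ι : Type*} [MeasurableSpace α] (μ : Measure α)
    [IsFiniteMeasure μ] (s : Finset ι) (B : ι → Set α) (hB : ∀ i ∈ s, MeasurableSet (B i))
    {A : Set α} (hA : MeasurableSet A) (hBA : ∀ i ∈ s, B i ⊆ A) {M : ℝ}
    (hM : ∀ a ∈ A, ∀ t ⊆ s, (∀ i ∈ t, a ∈ B i) → (t.card : ℝ) ≤ M) :
    ∑ i ∈ s, μ.real (B i) ≤ M * μ.real A := by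
  classical
  have hint : ∀ i ∈ s, Integrable ((B i).indicator (1 : α → ℝ)) μ := fun i hi =>
    (integrable_const (1 : ℝ)).indicator (hB i hi)
  have h1 : ∑ i ∈ s, μ.real (B i) = ∫ a, ∑ i ∈ s, (B i).indicator (1 : α → ℝ) a ∂μ := by
    rw [integral_finsetSum s hint]
    exact Finset.sum_congr rfl fun i hi => (integral_indicator_one (hB i hi)).symm
  have h2 : M * μ.real A = ∫ a, M * A.indicator (1 : α → ℝ) a ∂μ := by
    rw [integral_const_mul, integral_indicator_one hA]
  rw [h1, h2]
  refine integral_mono (integrable_finsetSum s hint)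
    (((integrable_const (1 : ℝ)).indicator hA).const_mul M) fun a => ?_
  by_cases ha : a ∈ A
  · have h3 : ∑ i ∈ s, (B i).indicator (1 : α → ℝ) a = ((s.filter fun i => a ∈ B i).card : ℝ) := by
      rw [Finset.card_filter]
      push_cast
      exact Finset.sum_congr rfl fun i _ => by simp [indicator_apply]
    simp only [h3, indicator_of_mem ha, Pi.one_apply, mul_one]
    exact hM a ha _ (Finset.filter_subset _ _) fun i hi => (Finset.mem_filter.1 hi).2
  · have h3 : ∑ i ∈ s, (B i).indicator (1 : α → ℝ) a = 0 :=
      Finset.sum_eq_zero fun i hi => indicator_of_notMem (fun h => ha (hBA i hi h)) _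
    simp [h3, indicator_of_notMem ha]

/-! ### Doubling balls -/

section Doubling

variable {E : Type*} [NormedAddCommGroup E] [NormedSpace ℝ E] [FiniteDimensional ℝ E]
  [MeasurableSpace E] [BorelSpace E]

/-- One growth step: if no point of `B(y, R)` is the centre of an `r/2`-ball that is both doubling and
of measure at least `w / (2N)`, then passing from `R` to `R + 2r` at least doubles the measure. -/
lemma two_mul_measureReal_le_of_not_doubling (μ : Measure E) [IsFiniteMeasure μ] (y : E)
    {r R N w : ℝ} (hr : 0 < r) (hR : 0 ≤ R)
    (hN : (1 + 2 * R / (r / 2)) ^ Module.finrank ℝ E ≤ N) (hw : 0 ≤ w)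
    (hwR : w ≤ μ.real (Metric.closedBall y R))
    (hbad : ∀ z ∈ Metric.closedBall y R, w ≤ 2 * N * μ.real (Metric.closedBall z (r / 2)) →
      4 * 9 ^ Module.finrank ℝ E * μ.real (Metric.closedBall z (r / 2)) ≤
        μ.real (Metric.closedBall z (2 * r))) :
    2 * μ.real (Metric.closedBall y R) ≤ μ.real (Metric.closedBall y (R + 2 * r)) := by
  classical
  set D := Module.finrank ℝ E
  have hr2 : 0 < r / 2 := by positivity
  obtain ⟨t, htA, hts, htc⟩ := exists_separated_cover hr2 hR (Subset.refl (Metric.closedBall y R))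
  have hcard : (t.card : ℝ) ≤ N := (card_le_of_separated t (fun a => a) y hr2 hR
    (fun i hi => htA hi) fun i hi j hj hij => (hts i hi j hj hij).le).trans hN
  have hNpos : 0 < N := lt_of_lt_of_le (by positivity) hN
  have hcover : Metric.closedBall y R ⊆ ⋃ z ∈ t, Metric.closedBall z (r / 2) := by
    intro a ha
    obtain ⟨b, hb, hab⟩ := htc a ha
    exact mem_iUnion₂.2 ⟨b, hb, hab⟩
  have h1 : μ.real (Metric.closedBall y R) ≤ ∑ z ∈ t, μ.real (Metric.closedBall z (r / 2)) :=
    (measureReal_mono hcover (measure_ne_top _ _)).trans (measureReal_biUnion_finset_le _ _)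
  have h9 : (1 + 2 * (2 * r) / (r / 2)) ^ D = (9 : ℝ) ^ D := by
    congr 1; field_simp; norm_num
  have h2 : ∑ z ∈ t, μ.real (Metric.closedBall z (2 * r)) ≤
      9 ^ D * μ.real (Metric.closedBall y (R + 2 * r)) := by
    refine sum_measureReal_le_of_multiplicity μ t _ (fun _ _ => measurableSet_closedBall)
      measurableSet_closedBall (fun z hz => ?_) fun a _ u hu hau => ?_
    · refine Metric.closedBall_subset_closedBall' ?_
      have : dist z y ≤ R := htA hz
      linarith
    · rw [← h9]
      exact card_le_of_separated u (fun a => a) a hr2 (by positivity)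
        (fun i hi => by rw [dist_comm]; exact hau i hi)
        fun i hi j hj hij => (hts i (hu hi) j (hu hj) hij).le
  have h3 : ∀ z ∈ t, μ.real (Metric.closedBall z (r / 2)) ≤
      w / (2 * N) + μ.real (Metric.closedBall z (2 * r)) / (4 * 9 ^ D) := by
    intro z hz
    by_cases hlight : w ≤ 2 * N * μ.real (Metric.closedBall z (r / 2))
    · have := hbad z (htA hz) hlight
      have h4 : μ.real (Metric.closedBall z (r / 2)) ≤
          μ.real (Metric.closedBall z (2 * r)) / (4 * 9 ^ D) := by
        rw [le_div_iff₀ (by positivity)]; linarith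
      have : 0 ≤ w / (2 * N) := by positivity
      linarith
    · have h4 : μ.real (Metric.closedBall z (r / 2)) ≤ w / (2 * N) := by
        rw [le_div_iff₀ (by positivity)]; linarith
      have : 0 ≤ μ.real (Metric.closedBall z (2 * r)) / (4 * 9 ^ D) := by positivity
      linarith
  have h4 := h1.trans (Finset.sum_le_sum h3)
  rw [Finset.sum_add_distrib, Finset.sum_const, nsmul_eq_mul, ← Finset.sum_div] at h4
  have h5 : (t.card : ℝ) * (w / (2 * N)) ≤ w / 2 := by
    calc (t.card : ℝ) * (w / (2 * N)) ≤ N * (w / (2 * N)) := by gcongr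
      _ = w / 2 := by field_simp
  have h6 : (∑ z ∈ t, μ.real (Metric.closedBall z (2 * r))) / (4 * 9 ^ D) ≤
      μ.real (Metric.closedBall y (R + 2 * r)) / 4 := by
    rw [div_le_div_iff₀ (by positivity) (by positivity)]
    nlinarith
  linarith

/-- If the measure of `B(y, ·)` grows by less than `2^J` between the radii `r` and `r + 2rJ`, then
the larger ball contains a point `z` which is doubling at scale `r`, and whose `r/2`-ball has at
least a proportion of order `J^{-d}` of the measure of `B(y, r)`.  Otherwise each of the `J` steps
`R ↦ R + 2r` would double the measure. -/
lemma exists_doubling_ball (μ : Measure E) [IsFiniteMeasure μ] (y : E) {r : ℝ} (hr : 0 < r) (J : ℕ)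
    (h : μ.real (Metric.closedBall y (r + 2 * r * J)) < 2 ^ J * μ.real (Metric.closedBall y r)) :
    ∃ z ∈ Metric.closedBall y (r + 2 * r * J),
      μ.real (Metric.closedBall z (2 * r)) ≤
        4 * 9 ^ Module.finrank ℝ E * μ.real (Metric.closedBall z (r / 2)) ∧
      μ.real (Metric.closedBall y r) ≤
        2 * (5 + 8 * (J : ℝ)) ^ Module.finrank ℝ E * μ.real (Metric.closedBall z (r / 2)) := by
  by_contra! hcon
  have key : ∀ j : ℕ, j ≤ J →
      2 ^ j * μ.real (Metric.closedBall y r) ≤ μ.real (Metric.closedBall y (r + 2 * r * j)) := by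
    intro j
    induction j with
    | zero => simp
    | succ j ih =>
      intro hj
      have hjJ : (j : ℝ) ≤ J := by exact_mod_cast (Nat.le_succ j).trans hj
      have h1 := two_mul_measureReal_le_of_not_doubling μ y (r := r) (R := r + 2 * r * j)
        (N := (5 + 8 * (J : ℝ)) ^ Module.finrank ℝ E) (w := μ.real (Metric.closedBall y r)) hr
        (by positivity) ?_ measureReal_nonneg ?_ ?_
      · have h2 := ih ((Nat.le_succ j).trans hj)
        have h3 : r + 2 * r * ((j + 1 : ℕ) : ℝ) = r + 2 * r * j + 2 * r := by push_cast; ring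
        rw [h3, pow_succ]
        linarith
      · refine pow_le_pow_left₀ (by positivity) ?_ _
        have : 1 + 2 * (r + 2 * r * j) / (r / 2) = 5 + 8 * (j : ℝ) := by field_simp; ring
        rw [this]
        linarith
      · exact measureReal_mono (Metric.closedBall_subset_closedBall
          (le_add_of_nonneg_right (by positivity))) (measure_ne_top _ _)
      · intro z hz hzw
        by_contra! hlt
        refine absurd hzw (not_le.2 (hcon z ?_ hlt.le))
        refine Metric.closedBall_subset_closedBall ?_ hz
        gcongr
  exact absurd (key J le_rfl) (not_le.2 h)

end Doubling

/-! ### Packing sums -/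

section PackSum

variable {d : ℕ} {ν : Measure (EuclideanSpace ℝ (Fin d))}

/-- The packing sum `Θ_ν(q; r)` as a real number; meant for `ν` with bounded support. -/
noncomputable def packSum {d : ℕ} (ν : Measure (EuclideanSpace ℝ (Fin d))) (q r : ℝ) : ℝ :=
  (packingSum ν q r).toReal

lemma support_nonempty (ν : Measure (EuclideanSpace ℝ (Fin d))) [IsProbabilityMeasure ν] :
    ν.support.Nonempty :=
  Measure.nonempty_support (IsProbabilityMeasure.ne_zero ν)

lemma lt_dist_of_pairwiseDisjoint {s : Finset (EuclideanSpace ℝ (Fin d))} {r : ℝ} (hr : 0 < r)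
    (hs : (s : Set (EuclideanSpace ℝ (Fin d))).PairwiseDisjoint fun x => Metric.closedBall x r) :
    ∀ x ∈ s, ∀ y ∈ s, x ≠ y → r < dist x y := by
  intro x hx y hy hxy
  by_contra! hle
  exact Set.disjoint_left.1 (hs hx hy hxy) (Metric.mem_closedBall_self hr.le) hle

lemma exists_card_bound (hb : Bornology.IsBounded ν.support) {r : ℝ} (hr : 0 < r) :
    ∃ N : ℝ, 0 ≤ N ∧ ∀ s : Finset (EuclideanSpace ℝ (Fin d)),
      (s : Set (EuclideanSpace ℝ (Fin d))) ⊆ ν.support →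
      (s : Set (EuclideanSpace ℝ (Fin d))).PairwiseDisjoint (fun x => Metric.closedBall x r) →
      (s.card : ℝ) ≤ N := by
  obtain ⟨R, hR⟩ := hb.subset_closedBall 0
  refine ⟨(1 + 2 * |R| / r) ^ Module.finrank ℝ (EuclideanSpace ℝ (Fin d)), by positivity,
    fun s hs hd => ?_⟩
  exact card_le_of_separated s (fun a => a) 0 hr (abs_nonneg R)
    (fun i hi => (Metric.mem_closedBall.1 (hR (hs hi))).trans (le_abs_self R))
    fun i hi j hj hij => (lt_dist_of_pairwiseDisjoint hr hd i hi j hj hij).le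

variable [IsProbabilityMeasure ν]

lemma measureReal_closedBall_pos {x : EuclideanSpace ℝ (Fin d)} (hx : x ∈ ν.support) {r : ℝ}
    (hr : 0 < r) : 0 < ν.real (Metric.closedBall x r) :=
  ENNReal.toReal_pos
    (((Measure.mem_support_iff_forall x).1 hx _ (Metric.closedBall_mem_nhds x hr)).ne')
    (measure_ne_top _ _)

lemma packingSum_ne_top (hb : Bornology.IsBounded ν.support) {q r : ℝ} (hq : 0 ≤ q) (hr : 0 < r) :
    packingSum ν q r ≠ ⊤ := by
  obtain ⟨N, hN0, hN⟩ := exists_card_bound hb hr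
  refine ne_top_of_le_ne_top (ENNReal.ofReal_ne_top (r := N)) (iSup₂_le fun s hs => ?_)
  calc ∑ x ∈ s, ν (Metric.closedBall x r) ^ q ≤ ∑ _x ∈ s, (1 : ℝ≥0∞) :=
        Finset.sum_le_sum fun x _ => ENNReal.rpow_le_one prob_le_one hq
    _ = ENNReal.ofReal s.card := by simp
    _ ≤ ENNReal.ofReal N := ENNReal.ofReal_le_ofReal (hN s hs.1 hs.2)

lemma sum_ennreal_eq_ofReal {q r : ℝ} (hr : 0 < r) (s : Finset (EuclideanSpace ℝ (Fin d)))
    (hs : (s : Set (EuclideanSpace ℝ (Fin d))) ⊆ ν.support) :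
    ∑ x ∈ s, ν (Metric.closedBall x r) ^ q =
      ENNReal.ofReal (∑ x ∈ s, ν.real (Metric.closedBall x r) ^ q) := by
  rw [ENNReal.ofReal_sum_of_nonneg fun x _ => by positivity]
  refine Finset.sum_congr rfl fun x hx => ?_
  rw [← ENNReal.ofReal_rpow_of_pos (measureReal_closedBall_pos (hs hx) hr),
    ofReal_measureReal (measure_ne_top _ _)]

lemma sum_le_packSum (hb : Bornology.IsBounded ν.support) {q r : ℝ} (hq : 0 ≤ q) (hr : 0 < r)
    (s : Finset (EuclideanSpace ℝ (Fin d)))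
    (hs : (s : Set (EuclideanSpace ℝ (Fin d))) ⊆ ν.support)
    (hd : (s : Set (EuclideanSpace ℝ (Fin d))).PairwiseDisjoint fun x => Metric.closedBall x r) :
    ∑ x ∈ s, ν.real (Metric.closedBall x r) ^ q ≤ packSum ν q r := by
  have h1 : ENNReal.ofReal (∑ x ∈ s, ν.real (Metric.closedBall x r) ^ q) ≤ packingSum ν q r := by
    rw [← sum_ennreal_eq_ofReal hr s hs]
    exact le_iSup₂_of_le s ⟨hs, hd⟩ le_rfl
  exact (ENNReal.ofReal_le_iff_le_toReal (packingSum_ne_top hb hq hr)).1 h1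

lemma packSum_le {q r T : ℝ} (hr : 0 < r) (hT : 0 ≤ T)
    (h : ∀ s : Finset (EuclideanSpace ℝ (Fin d)),
      (s : Set (EuclideanSpace ℝ (Fin d))) ⊆ ν.support →
      (s : Set (EuclideanSpace ℝ (Fin d))).PairwiseDisjoint (fun x => Metric.closedBall x r) →
      ∑ x ∈ s, ν.real (Metric.closedBall x r) ^ q ≤ T) :
    packSum ν q r ≤ T := by
  refine ENNReal.toReal_le_of_le_ofReal hT (iSup₂_le fun s hs => ?_)
  rw [sum_ennreal_eq_ofReal hr s hs.1]
  exact ENNReal.ofReal_le_ofReal (h s hs.1 hs.2)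

lemma packSum_pos (hb : Bornology.IsBounded ν.support) {q r : ℝ} (hq : 0 ≤ q) (hr : 0 < r) :
    0 < packSum ν q r := by
  obtain ⟨x, hx⟩ := support_nonempty ν
  refine lt_of_lt_of_le ?_ (sum_le_packSum hb hq hr {x} (by simpa using hx) (by simp))
  rw [Finset.sum_singleton]
  exact Real.rpow_pos_of_pos (measureReal_closedBall_pos hx hr) q

lemma exists_packing_of_lt {q r T : ℝ} (hr : 0 < r) (hT : 0 ≤ T) (h : T < packSum ν q r) :
    ∃ s : Finset (EuclideanSpace ℝ (Fin d)),
      (s : Set (EuclideanSpace ℝ (Fin d))) ⊆ ν.support ∧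
      (s : Set (EuclideanSpace ℝ (Fin d))).PairwiseDisjoint (fun x => Metric.closedBall x r) ∧
      T < ∑ x ∈ s, ν.real (Metric.closedBall x r) ^ q := by
  by_contra! hcon
  exact absurd (packSum_le hr hT hcon) (not_le.2 h)

/-- A family of balls centred in the support, not necessarily disjoint, is controlled by the packing
sum and the multiplicity of the family. -/
lemma sum_rpow_closedBall_le (hb : Bornology.IsBounded ν.support) {q ρ M : ℝ} (hq : 0 ≤ q)
    (hρ : 0 < ρ) {ι : Type*} (s : Finset ι) (z : ι → EuclideanSpace ℝ (Fin d))
    (hz : ∀ i ∈ s, z i ∈ ν.support)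
    (hM0 : 0 ≤ M)
    (hM : ∀ i ∈ s, ∀ t ⊆ s, (∀ j ∈ t, dist (z j) (z i) ≤ 2 * ρ) → (t.card : ℝ) ≤ M) :
    ∑ i ∈ s, ν.real (Metric.closedBall (z i) ρ) ^ q ≤ M * packSum ν q ρ := by
  classical
  obtain ⟨t, hts, htun, hsum⟩ := exists_unrelated_subset
    (fun i j => dist (z j) (z i) ≤ 2 * ρ) (fun i j h => by rwa [dist_comm])
    (fun i => by simp [hρ.le]) (fun i => ν.real (Metric.closedBall (z i) ρ) ^ q)
    (fun i => by positivity) s hM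
  refine hsum.trans (mul_le_mul_of_nonneg_left ?_ hM0)
  have hinj : Set.InjOn z t := by
    intro i hi j hj hij
    by_contra hne
    exact htun i hi j hj hne (by simp [hij, hρ.le])
  rw [← Finset.sum_image (f := fun x => ν.real (Metric.closedBall x ρ) ^ q) hinj]
  refine sum_le_packSum hb hq hρ _ ?_ ?_
  · intro x hx
    obtain ⟨i, hi, rfl⟩ := Finset.mem_image.1 hx
    exact hz i (hts hi)
  · intro x hx y hy hxy
    obtain ⟨i, hi, rfl⟩ := Finset.mem_image.1 hx
    obtain ⟨j, hj, rfl⟩ := Finset.mem_image.1 hy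
    refine Metric.closedBall_disjoint_closedBall ?_
    have h1 := htun i hi j hj (fun h => hxy (by rw [h]))
    rw [not_le, dist_comm] at h1
    linarith

/-- A set of positive measure and of size `R` contains a point of the support whose `ρ`-ball carries
a proportion of its measure that depends only on `R / ρ`. -/
lemma exists_heavy_ball {A : Set (EuclideanSpace ℝ (Fin d))} {x : EuclideanSpace ℝ (Fin d)}
    {R ρ : ℝ} (hρ : 0 < ρ) (hR : 0 ≤ R) (hA : A ⊆ Metric.closedBall x R) (hpos : 0 < ν.real A) :
    ∃ w ∈ A ∩ ν.support, ν.real A ≤ (1 + 2 * R / ρ) ^ d * ν.real (Metric.closedBall w ρ) := by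
  classical
  obtain ⟨t, htA, hts, htc⟩ := exists_separated_cover (A := A ∩ ν.support) hρ hR
    (inter_subset_left.trans hA)
  have hcard : (t.card : ℝ) ≤ (1 + 2 * R / ρ) ^ d := by
    have := card_le_of_separated t (fun a => a) x hρ hR (fun i hi => hA (htA hi).1)
      fun i hi j hj hij => (hts i hi j hj hij).le
    rwa [finrank_euclideanSpace_fin] at this
  have h0 : ν.real A = ν.real (A ∩ ν.support) := by
    rw [Measure.real, Measure.real, measure_inter_conull Measure.measure_compl_support]
  have h1 : ν.real A ≤ ∑ z ∈ t, ν.real (Metric.closedBall z ρ) := by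
    rw [h0]
    refine (measureReal_mono (fun a ha => ?_) (measure_ne_top _ _)).trans
      (measureReal_biUnion_finset_le _ _)
    obtain ⟨b, hb, hab⟩ := htc a ha
    exact mem_iUnion₂.2 ⟨b, hb, hab⟩
  have hne : t.Nonempty := by
    by_contra hemp
    rw [Finset.not_nonempty_iff_eq_empty.1 hemp, Finset.sum_empty] at h1
    linarith
  obtain ⟨w, hw, hmax⟩ := t.exists_max_image (fun z => ν.real (Metric.closedBall z ρ)) hne
  refine ⟨w, htA hw, h1.trans ?_⟩
  calc ∑ z ∈ t, ν.real (Metric.closedBall z ρ)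
      ≤ t.card • ν.real (Metric.closedBall w ρ) := Finset.sum_le_card_nsmul _ _ _ hmax
    _ = (t.card : ℝ) * ν.real (Metric.closedBall w ρ) := nsmul_eq_mul _ _
    _ ≤ _ := mul_le_mul_of_nonneg_right hcard measureReal_nonneg

/-- The `q`-sum of a family of sets of size `D` is controlled by the packing sum at scale `ρ`, with a
constant depending on `D / ρ` and on the multiplicity `M` of the family at scale `ρ`. -/
lemma sum_rpow_measureReal_le (hb : Bornology.IsBounded ν.support) {q ρ D M : ℝ} (hq : 0 < q)
    (hρ : 0 < ρ) (hD : 0 ≤ D) {ι : Type*} (s : Finset ι)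
    (A : ι → Set (EuclideanSpace ℝ (Fin d))) (a : ι → EuclideanSpace ℝ (Fin d))
    (hA : ∀ i ∈ s, A i ⊆ Metric.closedBall (a i) D) (hM0 : 0 ≤ M)
    (hM : ∀ w ∈ ν.support, ∀ t ⊆ s,
      (∀ j ∈ t, (A j ∩ Metric.closedBall w (2 * ρ)).Nonempty) → (t.card : ℝ) ≤ M) :
    ∑ i ∈ s, ν.real (A i) ^ q ≤ ((1 + 2 * D / ρ) ^ d) ^ q * (M * packSum ν q ρ) := by
  classical
  let s' := s.filter fun i => 0 < ν.real (A i)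
  have hchoose : ∀ i, ∃ w, i ∈ s' → w ∈ A i ∩ ν.support ∧
      ν.real (A i) ≤ (1 + 2 * D / ρ) ^ d * ν.real (Metric.closedBall w ρ) := by
    intro i
    by_cases hi : i ∈ s'
    · obtain ⟨w, hw, h⟩ := exists_heavy_ball hρ hD (hA i (Finset.mem_filter.1 hi).1)
        (Finset.mem_filter.1 hi).2
      exact ⟨w, fun _ => ⟨hw, h⟩⟩
    · exact ⟨0, fun h => absurd h hi⟩
  choose w hw using hchoose
  have h1 : ∑ i ∈ s, ν.real (A i) ^ q = ∑ i ∈ s', ν.real (A i) ^ q := by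
    symm
    refine Finset.sum_subset (Finset.filter_subset _ _) fun i hi hi' => ?_
    have : ν.real (A i) = 0 := by
      refine le_antisymm ?_ measureReal_nonneg
      by_contra! h
      exact hi' (Finset.mem_filter.2 ⟨hi, h⟩)
    rw [this, Real.zero_rpow hq.ne']
  have h2 : ∀ i ∈ s', ν.real (A i) ^ q ≤
      ((1 + 2 * D / ρ) ^ d) ^ q * ν.real (Metric.closedBall (w i) ρ) ^ q := by
    intro i hi
    rw [← Real.mul_rpow (by positivity) measureReal_nonneg]
    exact Real.rpow_le_rpow measureReal_nonneg (hw i hi).2 hq.le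
  rw [h1]
  refine (Finset.sum_le_sum h2).trans ?_
  rw [← Finset.mul_sum]
  refine mul_le_mul_of_nonneg_left ?_ (by positivity)
  refine sum_rpow_closedBall_le hb hq.le hρ s' w (fun i hi => (hw i hi).1.2) hM0 ?_
  intro i hi t ht hti
  refine hM (w i) (hw i hi).1.2 t (ht.trans (Finset.filter_subset _ _)) fun j hj => ?_
  exact ⟨w j, (hw j (ht hj)).1.1, hti j hj⟩

lemma packSum_le_mul_packSum (hb : Bornology.IsBounded ν.support) {q r r' : ℝ} (hq : 0 < q)
    (hr' : 0 < r') (h1 : r' ≤ r) (h2 : r ≤ 2 * r') :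
    packSum ν q r ≤ (5 ^ d) ^ q * (7 ^ d * packSum ν q r') := by
  have hr : 0 < r := hr'.trans_le h1
  have hpos := packSum_pos hb hq.le hr'
  refine packSum_le hr (by positivity) fun s hs hd => ?_
  have h := sum_rpow_measureReal_le hb hq hr' hr.le s (fun z => Metric.closedBall z r) (fun z => z)
    (fun _ _ => Subset.rfl) (M := 7 ^ d) (by positivity) ?_
  · refine h.trans ?_
    refine mul_le_mul_of_nonneg_right ?_ (by positivity)
    refine Real.rpow_le_rpow (by positivity) (pow_le_pow_left₀ (by positivity) ?_ _) hq.le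
    have : 2 * r / r' ≤ 4 := by rw [div_le_iff₀ hr']; linarith
    linarith
  · intro w _ t ht htw
    have h3 := card_le_of_separated t (fun a => a) w hr (R := 3 * r) (by positivity) (fun j hj => ?_)
      fun i hi j hj hij => (lt_dist_of_pairwiseDisjoint hr hd i (ht hi) j (ht hj) hij).le
    · rw [finrank_euclideanSpace_fin] at h3
      refine h3.trans (le_of_eq ?_)
      congr 1; field_simp; norm_num
    · obtain ⟨v, hv1, hv2⟩ := htw j hj
      have := dist_triangle_left j w v
      rw [Metric.mem_closedBall] at hv1 hv2
      linarith

end PackSum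

/-! ### Local `L^q` estimates -/

section LocalLq

variable {d : ℕ} {ν : Measure (EuclideanSpace ℝ (Fin d))} [IsProbabilityMeasure ν]

/-- `ν` is a combination of images of itself under finitely many maps `s` which, up to the factor
`Λ`, act on `K` as similarities of ratio `2⁻ⁿ`, have images `s(K)` of small diameter, and of which
at most `Λ` have images meeting any given ball of radius `2⁻ⁿ`. -/
def HasDecomposition (ν : Measure (EuclideanSpace ℝ (Fin d))) (K : Set (EuclideanSpace ℝ (Fin d)))
    (n : ℕ) (Λ : ℝ) : Prop :=
  ∃ (F : Finset (EuclideanSpace ℝ (Fin d) → EuclideanSpace ℝ (Fin d)))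
    (P : (EuclideanSpace ℝ (Fin d) → EuclideanSpace ℝ (Fin d)) → ℝ),
    (∀ s, 0 ≤ P s) ∧
    (∀ B, IsClosed B → ν.real B = ∑ s ∈ F, P s * ν.real (K ∩ s ⁻¹' B)) ∧
    (∀ s ∈ F, ∀ x ∈ K, ∀ y ∈ K, dist x y ≤ Λ * 2 ^ n * dist (s x) (s y) ∧
      dist (s x) (s y) ≤ Λ * (1 / 2) ^ n * dist x y ∧ dist (s x) (s y) ≤ (1 / 2) ^ n / 8) ∧
    ∀ (x : EuclideanSpace ℝ (Fin d)) (F' : Finset _), F' ⊆ F →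
      (∀ s ∈ F', ∃ y ∈ K, dist (s y) x ≤ (1 / 2) ^ n) → (F'.card : ℝ) ≤ Λ

lemma rpow_sum_le_mul_sum_rpow {ι : Type*} (s : Finset ι) (a : ι → ℝ) (ha : ∀ i, 0 ≤ a i)
    {q Λ : ℝ} (hq : 0 < q) (hΛ : 0 ≤ Λ) (hs : (s.card : ℝ) ≤ Λ) :
    (∑ i ∈ s, a i) ^ q ≤ Λ ^ q * ∑ i ∈ s, a i ^ q := by
  rcases s.eq_empty_or_nonempty with rfl | hne
  · simp [Real.zero_rpow hq.ne']
  obtain ⟨b, hb, hmax⟩ := s.exists_max_image a hne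
  have h1 : ∑ i ∈ s, a i ≤ Λ * a b := by
    calc ∑ i ∈ s, a i ≤ s.card • a b := Finset.sum_le_card_nsmul _ _ _ hmax
      _ = (s.card : ℝ) * a b := nsmul_eq_mul _ _
      _ ≤ Λ * a b := mul_le_mul_of_nonneg_right hs (ha b)
  calc (∑ i ∈ s, a i) ^ q ≤ (Λ * a b) ^ q :=
        Real.rpow_le_rpow (Finset.sum_nonneg fun i _ => ha i) h1 hq.le
    _ = Λ ^ q * a b ^ q := Real.mul_rpow hΛ (ha b)
    _ ≤ _ := by
        gcongr
        exact Finset.single_le_sum (f := fun i => a i ^ q)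
          (fun i _ => Real.rpow_nonneg (ha i) q) hb

/-- Local `L^q` estimate: inside a ball of radius `2⁻ⁿ` the `q`-sum of `ν` at scale `2^{-n-m}` is at
most the packing sum at scale `2⁻ᵐ`, scaled by the measure of the ball.  Each piece `s(K)` of the
decomposition that meets the concentric ball of radius `3/4 * 2⁻ⁿ` is contained in the ball, so its
weight is at most the measure of the ball, and pulling back by `s` turns scale `2^{-n-m}` into
`2⁻ᵐ`. -/
lemma HasDecomposition.sum_rpow_le {K : Set (EuclideanSpace ℝ (Fin d))} {n : ℕ} {Λ : ℝ}
    (h : HasDecomposition ν K n Λ) (hΛ : 1 ≤ Λ) (hb : Bornology.IsBounded ν.support)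
    (hsK : ν.support ⊆ K) {q : ℝ} (hq : 0 < q) (m : ℕ) (x : EuclideanSpace ℝ (Fin d))
    {ι : Type*} (I : Finset ι) (z : ι → EuclideanSpace ℝ (Fin d))
    (hz : ∀ i ∈ I, dist (z i) x + (1 / 2) ^ (n + m) ≤ 3 / 4 * (1 / 2) ^ n)
    (hsep : ∀ i ∈ I, ∀ j ∈ I, i ≠ j → (1 / 2) ^ (n + m) ≤ dist (z i) (z j)) :
    ∑ i ∈ I, ν.real (Metric.closedBall (z i) ((1 / 2) ^ (n + m))) ^ q ≤
      (7 * Λ) ^ ((d + 1) * (q + 1)) * (ν.real (Metric.closedBall x ((1 / 2) ^ n)) ^ q *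
        packSum ν q ((1 / 2) ^ m)) := by
  classical
  obtain ⟨F, P, hP, hdec, hlip, hcount⟩ := h
  set r : ℝ := (1 / 2) ^ (n + m) with hr
  set V := ν.real (Metric.closedBall x ((1 / 2) ^ n)) with hV
  have hr0 : 0 < r := by positivity
  have hρ0 : (0 : ℝ) < (1 / 2) ^ m := by positivity
  have hn0 : (0 : ℝ) < (1 / 2) ^ n := by positivity
  have hrm : r = (1 / 2) ^ n * (1 / 2) ^ m := pow_add _ _ _
  have h2r : (2 : ℝ) ^ n * r = (1 / 2) ^ m := by
    rw [hrm, ← mul_assoc, ← mul_pow]; norm_num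
  have hνK : ν.real K = 1 := by
    have h1 : ν Kᶜ = 0 :=
      measure_mono_null (compl_subset_compl.2 hsK) Measure.measure_compl_support
    rw [Measure.real, ← univ_inter K, measure_inter_conull h1, measure_univ, ENNReal.toReal_one]
  let F' := F.filter fun s => ∃ y ∈ K, dist (s y) x ≤ 3 / 4 * (1 / 2) ^ n
  have hF'card : (F'.card : ℝ) ≤ Λ := hcount x F' (Finset.filter_subset _ _) fun s hs => by
    obtain ⟨y, hy, hyx⟩ := (Finset.mem_filter.1 hs).2
    exact ⟨y, hy, by linarith⟩
  have hPV : ∀ s ∈ F', P s ≤ V := by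
    intro s hs
    obtain ⟨hsF, y, hy, hyx⟩ := Finset.mem_filter.1 hs
    have hsub : K ⊆ K ∩ s ⁻¹' Metric.closedBall x ((1 / 2) ^ n) := by
      refine fun v hv => ⟨hv, ?_⟩
      have h1 := (hlip s hsF v hv y hy).2.2
      have h2 := dist_triangle (s v) (s y) x
      rw [mem_preimage, Metric.mem_closedBall]
      linarith
    have h1 : P s * ν.real (K ∩ s ⁻¹' Metric.closedBall x ((1 / 2) ^ n)) ≤ V := by
      rw [hV, hdec _ Metric.isClosed_closedBall]
      exact Finset.single_le_sum
        (f := fun s => P s * ν.real (K ∩ s ⁻¹' Metric.closedBall x ((1 / 2) ^ n)))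
        (fun s _ => mul_nonneg (hP s) measureReal_nonneg) hsF
    have h2 : 1 ≤ ν.real (K ∩ s ⁻¹' Metric.closedBall x ((1 / 2) ^ n)) :=
      hνK.symm.le.trans (measureReal_mono hsub (measure_ne_top _ _))
    nlinarith [hP s]
  have hball : ∀ i ∈ I, ν.real (Metric.closedBall (z i) r) ^ q ≤
      Λ ^ q * (V ^ q * ∑ s ∈ F', ν.real (K ∩ s ⁻¹' Metric.closedBall (z i) r) ^ q) := by
    intro i hi
    have h1 : ν.real (Metric.closedBall (z i) r) ≤
        ∑ s ∈ F', V * ν.real (K ∩ s ⁻¹' Metric.closedBall (z i) r) := by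
      rw [hdec _ Metric.isClosed_closedBall]
      have h2 : ∑ s ∈ F, P s * ν.real (K ∩ s ⁻¹' Metric.closedBall (z i) r) =
          ∑ s ∈ F', P s * ν.real (K ∩ s ⁻¹' Metric.closedBall (z i) r) := by
        symm
        refine Finset.sum_subset (Finset.filter_subset _ _) fun s hs hs' => ?_
        have : K ∩ s ⁻¹' Metric.closedBall (z i) r = ∅ := by
          rw [Set.eq_empty_iff_forall_notMem]
          rintro v ⟨hvK, hv⟩
          refine hs' (Finset.mem_filter.2 ⟨hs, v, hvK, ?_⟩)
          rw [mem_preimage, Metric.mem_closedBall] at hv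
          have := dist_triangle (s v) (z i) x
          linarith [hz i hi]
        rw [this, measureReal_empty, mul_zero]
      rw [h2]
      exact Finset.sum_le_sum fun s hs =>
        mul_le_mul_of_nonneg_right (hPV s hs) measureReal_nonneg
    refine (Real.rpow_le_rpow measureReal_nonneg h1 hq.le).trans ?_
    refine (rpow_sum_le_mul_sum_rpow F' _ (fun s => by positivity) hq (by linarith)
      hF'card).trans (le_of_eq ?_)
    rw [Finset.mul_sum F' _ (V ^ q)]
    congr 1
    exact Finset.sum_congr rfl fun s _ => Real.mul_rpow measureReal_nonneg measureReal_nonneg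
  have hpull : ∀ s ∈ F', ∑ i ∈ I, ν.real (K ∩ s ⁻¹' Metric.closedBall (z i) r) ^ q ≤
      ((1 + 4 * Λ) ^ d) ^ q * ((3 + 4 * Λ) ^ d * packSum ν q ((1 / 2) ^ m)) := by
    intro s hs
    have hsF := (Finset.mem_filter.1 hs).1
    have hchoose : ∀ i, ∃ a, K ∩ s ⁻¹' Metric.closedBall (z i) r ⊆
        Metric.closedBall a (2 * Λ * (1 / 2) ^ m) := by
      intro i
      rcases (K ∩ s ⁻¹' Metric.closedBall (z i) r).eq_empty_or_nonempty with he | ⟨a, haK, ha⟩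
      · exact ⟨0, by simp [he]⟩
      · refine ⟨a, fun v ⟨hvK, hv⟩ => ?_⟩
        rw [mem_preimage, Metric.mem_closedBall] at hv ha
        have h1 := (hlip s hsF v hvK a haK).1
        have h2 := dist_triangle_right (s v) (s a) (z i)
        rw [Metric.mem_closedBall]
        calc dist v a ≤ Λ * 2 ^ n * dist (s v) (s a) := h1
          _ ≤ Λ * 2 ^ n * (2 * r) := by gcongr; linarith
          _ = 2 * Λ * (1 / 2) ^ m := by rw [← h2r]; ring
    choose a ha using hchoose
    have h1 := sum_rpow_measureReal_le hb hq hρ0 (D := 2 * Λ * (1 / 2) ^ m) (by positivity) I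
      (fun i => K ∩ s ⁻¹' Metric.closedBall (z i) r) a (fun i _ => ha i)
      (M := (3 + 4 * Λ) ^ d) (by positivity) ?_
    · have : 2 * (2 * Λ * (1 / 2) ^ m) / (1 / 2) ^ m = 4 * Λ := by field_simp; norm_num
      rwa [this] at h1
    · intro w hw t ht htw
      have h2 := card_le_of_separated t z (s w) hr0 (R := r + 2 * Λ * r) (by positivity)
        (fun j hj => ?_) fun i hi j hj hij => hsep i (ht hi) j (ht hj) hij
      · rw [finrank_euclideanSpace_fin] at h2
        refine h2.trans (le_of_eq ?_)
        congr 1; field_simp; ring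
      · obtain ⟨v, ⟨hvK, hv⟩, hvw⟩ := htw j hj
        rw [mem_preimage, Metric.mem_closedBall] at hv
        rw [Metric.mem_closedBall] at hvw
        have h3 := (hlip s hsF v hvK w (hsK hw)).2.1
        have h4 : Λ * (1 / 2) ^ n * dist v w ≤ 2 * Λ * r := by
          calc Λ * (1 / 2) ^ n * dist v w ≤ Λ * (1 / 2) ^ n * (2 * (1 / 2) ^ m) := by gcongr
            _ = 2 * Λ * r := by rw [hrm]; ring
        have h5 := dist_triangle_left (z j) (s w) (s v)
        linarith
  have hΘ := packSum_pos hb hq.le hρ0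
  have hconst : Λ ^ q * (Λ * (((1 + 4 * Λ) ^ d) ^ q * (3 + 4 * Λ) ^ d)) ≤
      (7 * Λ) ^ ((d + 1) * (q + 1)) := by
    have h7 : 0 < 7 * Λ := by positivity
    have e : (7 * Λ) ^ ((d + 1) * (q + 1)) =
        (7 * Λ) ^ q * ((7 * Λ) * (((7 * Λ) ^ d) ^ q * (7 * Λ) ^ d)) := by
      have : ((d : ℝ) + 1) * (q + 1) = q + (1 + (d * q + d)) := by ring
      rw [this, Real.rpow_add h7, Real.rpow_add h7, Real.rpow_one, Real.rpow_add h7,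
        Real.rpow_mul h7.le, Real.rpow_natCast]
    rw [e]
    gcongr <;> linarith
  calc ∑ i ∈ I, ν.real (Metric.closedBall (z i) r) ^ q
      ≤ ∑ i ∈ I, Λ ^ q * (V ^ q * ∑ s ∈ F', ν.real (K ∩ s ⁻¹' Metric.closedBall (z i) r) ^ q) :=
        Finset.sum_le_sum hball
    _ = Λ ^ q * (V ^ q * ∑ s ∈ F', ∑ i ∈ I,
          ν.real (K ∩ s ⁻¹' Metric.closedBall (z i) r) ^ q) := by
        rw [← Finset.mul_sum, ← Finset.mul_sum, Finset.sum_comm]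
    _ ≤ Λ ^ q * (V ^ q * (Λ *
          (((1 + 4 * Λ) ^ d) ^ q * ((3 + 4 * Λ) ^ d * packSum ν q ((1 / 2) ^ m))))) := by
        gcongr
        refine (Finset.sum_le_card_nsmul _ _ _ hpull).trans ?_
        rw [nsmul_eq_mul]
        gcongr
    _ = Λ ^ q * (Λ * (((1 + 4 * Λ) ^ d) ^ q * (3 + 4 * Λ) ^ d)) *
          (V ^ q * packSum ν q ((1 / 2) ^ m)) := by ring
    _ ≤ _ := by gcongr

/-- `ν` is carried by `K` and decomposes at all scales `2⁻ⁿ`, with an error factor `Λ` which is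
subexponential in `n`. -/
def HasSubexpDecomposition (ν : Measure (EuclideanSpace ℝ (Fin d)))
    (K : Set (EuclideanSpace ℝ (Fin d))) : Prop :=
  Bornology.IsBounded K ∧ ν.support ⊆ K ∧
    ∀ ε : ℝ, 0 < ε → ∃ C : ℝ, 1 ≤ C ∧ ∀ n : ℕ, HasDecomposition ν K n (C * 2 ^ (ε * n))

lemma HasSubexpDecomposition.sum_rpow_le {K : Set (EuclideanSpace ℝ (Fin d))}
    (h : HasSubexpDecomposition ν K) {q : ℝ} (hq : 0 < q) {ε : ℝ} (hε : 0 < ε) :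
    ∃ C : ℝ, 1 ≤ C ∧ ∀ (n m : ℕ) (x : EuclideanSpace ℝ (Fin d)) (ι : Type) (I : Finset ι)
      (z : ι → EuclideanSpace ℝ (Fin d)),
      (∀ i ∈ I, dist (z i) x + (1 / 2) ^ (n + m) ≤ 3 / 4 * (1 / 2) ^ n) →
      (∀ i ∈ I, ∀ j ∈ I, i ≠ j → (1 / 2) ^ (n + m) ≤ dist (z i) (z j)) →
      ∑ i ∈ I, ν.real (Metric.closedBall (z i) ((1 / 2) ^ (n + m))) ^ q ≤
        C * 2 ^ (ε * n) * (ν.real (Metric.closedBall x ((1 / 2) ^ n)) ^ q *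
          packSum ν q ((1 / 2) ^ m)) := by
  obtain ⟨hb, hsK, h⟩ := h
  set κ : ℝ := (d + 1) * (q + 1) with hκ
  have hκ0 : 0 < κ := by positivity
  obtain ⟨C, hC, hdec⟩ := h (ε / κ) (by positivity)
  refine ⟨(7 * C) ^ κ, Real.one_le_rpow (by linarith) hκ0.le, fun n m x ι I z hz hsep => ?_⟩
  have h2 : (1 : ℝ) ≤ 2 ^ (ε / κ * n) := Real.one_le_rpow (by norm_num) (by positivity)
  have h1 := (hdec n).sum_rpow_le (one_le_mul_of_one_le_of_one_le hC h2) (hb.subset hsK) hsK hq m x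
    I z hz hsep
  have e : (7 * (C * 2 ^ (ε / κ * n))) ^ κ = (7 * C) ^ κ * 2 ^ (ε * n) := by
    rw [← mul_assoc, Real.mul_rpow (by positivity) (by positivity), ← Real.rpow_mul (by norm_num)]
    congr 2
    field_simp
  rwa [← hκ, e] at h1

/-- Submultiplicativity of the packing sums, up to subexponential factors. -/
lemma HasSubexpDecomposition.packSum_add_le {K : Set (EuclideanSpace ℝ (Fin d))}
    (h : HasSubexpDecomposition ν K) {q : ℝ} (hq : 0 < q) {ε : ℝ} (hε : 0 < ε) :
    ∃ C : ℝ, 1 ≤ C ∧ ∀ n m : ℕ, 2 ≤ m → packSum ν q ((1 / 2) ^ (n + m)) ≤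
      C * 2 ^ (ε * n) * (packSum ν q ((1 / 2) ^ n) * packSum ν q ((1 / 2) ^ m)) := by
  classical
  obtain ⟨C, hC, hloc⟩ := h.sum_rpow_le hq hε
  have hb : Bornology.IsBounded ν.support := h.1.subset h.2.1
  refine ⟨9 ^ d * C, one_le_mul_of_one_le_of_one_le (one_le_pow₀ (by norm_num)) hC,
    fun n m hm => ?_⟩
  have hn0 : (0 : ℝ) < (1 / 2) ^ n := by positivity
  have hΘn := packSum_pos hb hq.le hn0
  have hΘm := packSum_pos hb hq.le (r := (1 / 2) ^ m) (by positivity)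
  have hr0 : (0 : ℝ) < (1 / 2) ^ (n + m) := by positivity
  have hr4 : (1 / 2 : ℝ) ^ (n + m) ≤ (1 / 2) ^ n / 4 := by
    have h4 : (1 / 2 : ℝ) ^ m ≤ (1 / 2) ^ 2 := pow_le_pow_of_le_one (by norm_num) (by norm_num) hm
    rw [pow_add]
    nlinarith
  refine packSum_le (by positivity) (by positivity) fun s hs hd => ?_
  obtain ⟨R, hR⟩ := hb.subset_closedBall 0
  obtain ⟨t, htA, hts, htc⟩ := exists_separated_cover (A := ν.support) (x := 0) (R := |R|)
    (r := (1 / 2) ^ n / 2) (by positivity) (abs_nonneg R)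
    (hR.trans (Metric.closedBall_subset_closedBall (le_abs_self R)))
  have h1 : ∑ z ∈ s, ν.real (Metric.closedBall z ((1 / 2) ^ (n + m))) ^ q ≤
      ∑ b ∈ t, ∑ z ∈ s.filter (fun z => dist z b ≤ (1 / 2) ^ n / 2),
        ν.real (Metric.closedBall z ((1 / 2) ^ (n + m))) ^ q := by
    simp_rw [Finset.sum_filter]
    rw [Finset.sum_comm]
    refine Finset.sum_le_sum fun z hz => ?_
    obtain ⟨b, hbt, hzb⟩ := htc z (hs hz)
    refine le_trans ?_ (Finset.single_le_sum (fun b _ => ?_) hbt)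
    · rw [if_pos hzb]
    · split_ifs <;> positivity
  have h2 : ∀ b ∈ t, ∑ z ∈ s.filter (fun z => dist z b ≤ (1 / 2) ^ n / 2),
      ν.real (Metric.closedBall z ((1 / 2) ^ (n + m))) ^ q ≤
      C * 2 ^ (ε * n) * (ν.real (Metric.closedBall b ((1 / 2) ^ n)) ^ q *
          packSum ν q ((1 / 2) ^ m)) := by
    intro b _
    refine hloc n m b _ _ (fun z => z) (fun z hz => ?_) fun z hz z' hz' hzz' => ?_
    · have := (Finset.mem_filter.1 hz).2
      linarith
    · exact (lt_dist_of_pairwiseDisjoint hr0 hd z (Finset.mem_filter.1 hz).1 z'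
        (Finset.mem_filter.1 hz').1 hzz').le
  have h3 : ∑ b ∈ t, ν.real (Metric.closedBall b ((1 / 2) ^ n)) ^ q ≤
      9 ^ d * packSum ν q ((1 / 2) ^ n) := by
    refine sum_rpow_closedBall_le hb hq.le hn0 t (fun b => b) (fun b hb => htA hb) (by positivity) ?_
    intro b _ u hu hub
    have h4 := card_le_of_separated u (fun a => a) b (r := (1 / 2) ^ n / 2) (R := 2 * (1 / 2) ^ n)
      (by positivity) (by positivity) hub fun i hi j hj hij => (hts i (hu hi) j (hu hj) hij).le
    rw [finrank_euclideanSpace_fin] at h4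
    refine h4.trans (le_of_eq ?_)
    congr 1; field_simp; norm_num
  calc _ ≤ _ := h1
    _ ≤ ∑ b ∈ t, C * 2 ^ (ε * n) * (ν.real (Metric.closedBall b ((1 / 2) ^ n)) ^ q *
          packSum ν q ((1 / 2) ^ m)) := Finset.sum_le_sum h2
    _ = C * 2 ^ (ε * n) * ((∑ b ∈ t, ν.real (Metric.closedBall b ((1 / 2) ^ n)) ^ q) *
          packSum ν q ((1 / 2) ^ m)) := by rw [← Finset.mul_sum, ← Finset.sum_mul]
    _ ≤ C * 2 ^ (ε * n) * ((9 ^ d * packSum ν q ((1 / 2) ^ n)) *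
          packSum ν q ((1 / 2) ^ m)) := by gcongr
    _ = _ := by ring

end LocalLq

/-! ### The `L^q` spectrum as a limit -/

section Spectrum

variable {d : ℕ} {ν : Measure (EuclideanSpace ℝ (Fin d))}

lemma log_packingSum_div_log {q r : ℝ} (h0 : packingSum ν q r ≠ 0) (h1 : packingSum ν q r ≠ ⊤) :
    ENNReal.log (packingSum ν q r) / ((Real.log r : ℝ) : EReal) =
      ((Real.log (packSum ν q r) / Real.log r : ℝ) : EReal) := by
  rw [ENNReal.log_pos_real h0 h1, EReal.coe_div, packSum]

lemma coe_lqSpectrum (hfin : FiniteLqSpectrum ν) (q : ℝ) :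
    ((lqSpectrum ν q : ℝ) : EReal) = lqSpectrumE ν q :=
  EReal.coe_toReal (hfin q).2 (hfin q).1

lemma eventually_lt_one_nhdsGT_zero : ∀ᶠ r : ℝ in 𝓝[>] 0, 0 < r ∧ r < 1 := by
  filter_upwards [Ioo_mem_nhdsGT (zero_lt_one' ℝ)] with r hr using hr

lemma eventually_const_le_two_rpow {δ : ℝ} (hδ : 0 < δ) (A : ℝ) :
    ∀ᶠ m : ℕ in atTop, A ≤ 2 ^ (δ * m) := by
  have : Tendsto (fun n : ℕ => (2 : ℝ) ^ (δ * n)) atTop atTop :=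
    (tendsto_rpow_atTop_of_base_gt_one 2 (by norm_num)).comp
      (tendsto_natCast_atTop_atTop.const_mul_atTop hδ)
  exact this.eventually_ge_atTop A

variable [IsProbabilityMeasure ν]

lemma log_packingSum_div_log_of_isBounded (hb : Bornology.IsBounded ν.support) {q r : ℝ}
    (hq : 0 ≤ q) (hr : 0 < r) :
    ENNReal.log (packingSum ν q r) / ((Real.log r : ℝ) : EReal) =
      ((Real.log (packSum ν q r) / Real.log r : ℝ) : EReal) := by
  refine log_packingSum_div_log (fun h => ?_) (packingSum_ne_top hb hq hr)
  have := packSum_pos hb hq hr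
  rw [packSum, h, ENNReal.toReal_zero] at this
  exact lt_irrefl _ this

lemma eventually_packSum_lt (hb : Bornology.IsBounded ν.support) (hfin : FiniteLqSpectrum ν)
    {q t : ℝ} (hq : 0 ≤ q) (ht : t < lqSpectrum ν q) :
    ∀ᶠ r : ℝ in 𝓝[>] 0, packSum ν q r < r ^ t := by
  have h1 : (t : EReal) < lqSpectrumE ν q := by
    rw [← coe_lqSpectrum hfin]; exact_mod_cast ht
  filter_upwards [eventually_lt_of_lt_liminf h1, eventually_lt_one_nhdsGT_zero] with r hr hr1
  rw [log_packingSum_div_log_of_isBounded hb hq hr1.1, EReal.coe_lt_coe_iff,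
    lt_div_iff_of_neg (Real.log_neg hr1.1 hr1.2)] at hr
  rwa [← Real.log_lt_log_iff (packSum_pos hb hq hr1.1) (Real.rpow_pos_of_pos hr1.1 t),
    Real.log_rpow hr1.1]

lemma frequently_lt_packSum (hb : Bornology.IsBounded ν.support) (hfin : FiniteLqSpectrum ν)
    {q t : ℝ} (hq : 0 ≤ q) (ht : lqSpectrum ν q < t) :
    ∃ᶠ r : ℝ in 𝓝[>] 0, r ^ t < packSum ν q r := by
  have h1 : lqSpectrumE ν q < (t : EReal) := by
    rw [← coe_lqSpectrum hfin]; exact_mod_cast ht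
  refine ((frequently_lt_of_liminf_lt (by isBoundedDefault) h1).and_eventually
    eventually_lt_one_nhdsGT_zero).mono fun r ⟨hr, hr1⟩ => ?_
  rw [log_packingSum_div_log_of_isBounded hb hq hr1.1, EReal.coe_lt_coe_iff,
    div_lt_iff_of_neg (Real.log_neg hr1.1 hr1.2)] at hr
  rwa [← Real.log_lt_log_iff (Real.rpow_pos_of_pos hr1.1 t) (packSum_pos hb hq hr1.1),
    Real.log_rpow hr1.1]

lemma half_pow_rpow (m : ℕ) (t : ℝ) : ((1 / 2 : ℝ) ^ m) ^ t = 2 ^ (-(t * m)) := by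
  rw [one_div, inv_pow, ← Real.rpow_natCast, ← Real.rpow_neg (by norm_num),
    ← Real.rpow_mul (by norm_num)]
  congr 1; ring

lemma eventually_packSum_le (hb : Bornology.IsBounded ν.support) (hfin : FiniteLqSpectrum ν)
    {q t : ℝ} (hq : 0 ≤ q) (ht : t < lqSpectrum ν q) :
    ∀ᶠ m : ℕ in atTop, packSum ν q ((1 / 2) ^ m) ≤ 2 ^ (-(t * m)) := by
  have h : Tendsto (fun m : ℕ => (1 / 2 : ℝ) ^ m) atTop (𝓝[>] 0) :=
    tendsto_pow_atTop_nhdsWithin_zero_of_lt_one (by norm_num) (by norm_num)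
  filter_upwards [h.eventually (eventually_packSum_lt hb hfin hq ht)] with m hm
  rw [← half_pow_rpow]
  exact hm.le

/-- For `q > 0` the `L^q` spectrum is a genuine limit along the scales `2⁻ᵐ`: a single scale at which
the packing sum is too small would, by submultiplicativity, force it to be small at all scales. -/
lemma HasSubexpDecomposition.eventually_le_packSum {K : Set (EuclideanSpace ℝ (Fin d))}
    (h : HasSubexpDecomposition ν K) (hfin : FiniteLqSpectrum ν) {q t : ℝ} (hq : 0 < q)
    (ht : lqSpectrum ν q < t) :
    ∀ᶠ m : ℕ in atTop, 2 ^ (-(t * m)) ≤ packSum ν q ((1 / 2) ^ m) := by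
  have hb : Bornology.IsBounded ν.support := h.1.subset h.2.1
  by_contra hcon
  rw [not_eventually] at hcon
  set τ := lqSpectrum ν q
  set ε := (t - τ) / 4 with hε
  have hε0 : 0 < ε := by rw [hε]; linarith
  obtain ⟨C, hC, hsub⟩ := h.packSum_add_le hq hε0
  obtain ⟨n, hn, hnC, hn1⟩ := (hcon.and_eventually
    ((eventually_const_le_two_rpow hε0 C).and (eventually_ge_atTop 1))).exists
  rw [not_le] at hn
  set σ := t - 2 * ε with hσ
  have hΘ : ∀ m : ℕ, 0 < packSum ν q ((1 / 2) ^ m) := fun m => packSum_pos hb hq.le (by positivity)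
  have hstep : ∀ m : ℕ, 2 ≤ m →
      packSum ν q ((1 / 2) ^ (n + m)) ≤ 2 ^ (-(σ * n)) * packSum ν q ((1 / 2) ^ m) := by
    intro m hm
    calc packSum ν q ((1 / 2) ^ (n + m))
        ≤ C * 2 ^ (ε * n) * (packSum ν q ((1 / 2) ^ n) * packSum ν q ((1 / 2) ^ m)) := hsub n m hm
      _ ≤ 2 ^ (ε * n) * 2 ^ (ε * n) * (2 ^ (-(t * n)) * packSum ν q ((1 / 2) ^ m)) := by
          have hm0 := (hΘ m).le
          have hnm := mul_nonneg (hΘ n).le hm0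
          gcongr
      _ = 2 ^ (-(σ * n)) * packSum ν q ((1 / 2) ^ m) := by
          rw [← mul_assoc, ← Real.rpow_add (by norm_num), ← Real.rpow_add (by norm_num)]
          congr 2
          rw [hσ]; ring
  set B := ∑ m ∈ Finset.range (n + 2), packSum ν q ((1 / 2) ^ m) * 2 ^ (σ * m) with hB
  have hB0 : 0 ≤ B := Finset.sum_nonneg fun m _ => mul_nonneg (hΘ m).le (by positivity)
  have hall : ∀ m : ℕ, 2 ≤ m → packSum ν q ((1 / 2) ^ m) ≤ B * 2 ^ (-(σ * m)) := by
    intro m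
    induction m using Nat.strong_induction_on with
    | _ m ih =>
      intro hm
      rcases lt_or_ge m (n + 2) with hlt | hge
      · have h1 : packSum ν q ((1 / 2) ^ m) * 2 ^ (σ * m) ≤ B :=
          Finset.single_le_sum (f := fun m : ℕ => packSum ν q ((1 / 2) ^ m) * 2 ^ (σ * m))
            (fun m _ => mul_nonneg (hΘ m).le (by positivity)) (Finset.mem_range.2 hlt)
        rw [Real.rpow_neg (by norm_num), ← div_eq_mul_inv, le_div_iff₀ (by positivity)]
        exact h1
      · obtain ⟨j, rfl⟩ : ∃ j, m = n + j := ⟨m - n, by omega⟩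
        have hj : 2 ≤ j := by omega
        calc packSum ν q ((1 / 2) ^ (n + j))
            ≤ 2 ^ (-(σ * n)) * packSum ν q ((1 / 2) ^ j) := hstep j hj
          _ ≤ 2 ^ (-(σ * n)) * (B * 2 ^ (-(σ * j))) := by
              gcongr; exact ih j (by omega) hj
          _ = B * 2 ^ (-(σ * ((n + j : ℕ) : ℝ))) := by
              rw [mul_left_comm, ← Real.rpow_add (by norm_num)]
              congr 2; push_cast; ring
  set C' := (5 ^ d) ^ q * (7 ^ d * (B * 2 ^ |σ|)) with hC'
  have hC'0 : 0 ≤ C' := by positivity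
  have hcont : ∀ r : ℝ, 0 < r → r ≤ 1 / 4 → packSum ν q r ≤ C' * r ^ σ := by
    intro r hr hr4
    obtain ⟨j, hj1, hj2⟩ := exists_nat_pow_near_of_lt_one (x := r) (y := 1 / 2) hr (by linarith)
      (by norm_num) (by norm_num)
    have hj : 2 ≤ j + 1 := by
      by_contra hlt
      have : j = 0 := by omega
      subst this
      norm_num at hj1
      linarith
    have hr2 : r ≤ 2 * (1 / 2) ^ (j + 1) := by rw [pow_succ]; linarith
    have hpow : ((1 / 2 : ℝ) ^ (j + 1)) ^ σ ≤ 2 ^ |σ| * r ^ σ := by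
      have hp : (0 : ℝ) < (1 / 2) ^ (j + 1) := by positivity
      rcases le_total 0 σ with h0 | h0
      · calc ((1 / 2 : ℝ) ^ (j + 1)) ^ σ ≤ r ^ σ := Real.rpow_le_rpow hp.le hj1.le h0
          _ ≤ 2 ^ |σ| * r ^ σ := by
            refine le_mul_of_one_le_left (by positivity) ?_
            exact Real.one_le_rpow (by norm_num) (abs_nonneg σ)
      · have h2 : (r / 2) ^ σ = 2 ^ |σ| * r ^ σ := by
          rw [Real.div_rpow hr.le (by norm_num), abs_of_nonpos h0, Real.rpow_neg (by norm_num)]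
          ring
        rw [← h2]
        exact Real.rpow_le_rpow_of_nonpos (by positivity) (by linarith) h0
    calc packSum ν q r ≤ (5 ^ d) ^ q * (7 ^ d * packSum ν q ((1 / 2) ^ (j + 1))) :=
          packSum_le_mul_packSum hb hq (by positivity) hj1.le hr2
      _ ≤ (5 ^ d) ^ q * (7 ^ d * (B * (2 ^ |σ| * r ^ σ))) := by
          gcongr
          refine (hall (j + 1) hj).trans ?_
          rw [← half_pow_rpow]
          gcongr
      _ = C' * r ^ σ := by rw [hC']; ring
  have hsmall : ∀ᶠ r : ℝ in 𝓝[>] 0, C' * r ^ ε < 1 := by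
    have h1 : Tendsto (fun r : ℝ => C' * r ^ ε) (𝓝[>] 0) (𝓝 (C' * 0)) := by
      refine Tendsto.const_mul C' ?_
      have := (Real.continuousAt_rpow_const 0 ε (Or.inr hε0.le)).tendsto
      rw [Real.zero_rpow hε0.ne'] at this
      exact this.mono_left nhdsWithin_le_nhds
    rw [mul_zero] at h1
    exact h1.eventually_lt_const zero_lt_one
  have h4 : ∀ᶠ r : ℝ in 𝓝[>] 0, 0 < r ∧ r < 1 / 4 := by
    filter_upwards [Ioo_mem_nhdsGT (show (0 : ℝ) < 1 / 4 by norm_num)] with r hr using hr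
  obtain ⟨r, hr, hr1, hr0, hr4⟩ := ((frequently_lt_packSum hb hfin hq.le
    (show τ < τ + ε by linarith)).and_eventually (hsmall.and h4)).exists
  have h5 := hr.trans_le (hcont r hr0 hr4.le)
  have h6 : σ = (τ + ε) + ε := by rw [hσ, hε]; ring
  rw [h6, Real.rpow_add hr0 (τ + ε)] at h5
  have h7 : 0 < r ^ (τ + ε) := Real.rpow_pos_of_pos hr0 _
  nlinarith

/-! ### Balls of typical measure -/

lemma sum_rpow_filter_lt_le (hb : Bornology.IsBounded ν.support) {q h r β : ℝ} (hq : 0 ≤ q)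
    (hh : 0 ≤ h) (hr : 0 < r) (hβ : 0 < β) (s : Finset (EuclideanSpace ℝ (Fin d)))
    (hs : (s : Set (EuclideanSpace ℝ (Fin d))) ⊆ ν.support)
    (hd : (s : Set (EuclideanSpace ℝ (Fin d))).PairwiseDisjoint fun x => Metric.closedBall x r) :
    ∑ x ∈ s with β < ν.real (Metric.closedBall x r), ν.real (Metric.closedBall x r) ^ q ≤
      β ^ (-h) * packSum ν (q + h) r := by
  classical
  calc _ ≤ ∑ x ∈ s with β < ν.real (Metric.closedBall x r),
        β ^ (-h) * ν.real (Metric.closedBall x r) ^ (q + h) := by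
        refine Finset.sum_le_sum fun x hx => ?_
        have hx := (Finset.mem_filter.1 hx).2
        have h0 := hβ.trans hx
        rw [Real.rpow_add h0, mul_left_comm]
        refine le_mul_of_one_le_right (by positivity) ?_
        rw [Real.rpow_neg hβ.le, inv_mul_eq_div, one_le_div (by positivity)]
        exact Real.rpow_le_rpow hβ.le hx.le hh
    _ = β ^ (-h) * ∑ x ∈ s with β < ν.real (Metric.closedBall x r),
        ν.real (Metric.closedBall x r) ^ (q + h) := by rw [Finset.mul_sum]
    _ ≤ _ := by
        gcongr
        refine sum_le_packSum hb (by positivity) hr _ ?_ ?_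
        · exact fun x hx => hs (Finset.mem_filter.1 hx).1
        · exact hd.subset fun x hx => (Finset.mem_filter.1 hx).1

lemma sum_rpow_filter_gt_le (hb : Bornology.IsBounded ν.support) {q h r β : ℝ} (hhq : h ≤ q)
    (hh : 0 ≤ h) (hr : 0 < r) (hβ : 0 < β) (s : Finset (EuclideanSpace ℝ (Fin d)))
    (hs : (s : Set (EuclideanSpace ℝ (Fin d))) ⊆ ν.support)
    (hd : (s : Set (EuclideanSpace ℝ (Fin d))).PairwiseDisjoint fun x => Metric.closedBall x r) :
    ∑ x ∈ s with ν.real (Metric.closedBall x r) < β, ν.real (Metric.closedBall x r) ^ q ≤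
      β ^ h * packSum ν (q - h) r := by
  classical
  calc _ ≤ ∑ x ∈ s with ν.real (Metric.closedBall x r) < β,
        β ^ h * ν.real (Metric.closedBall x r) ^ (q - h) := by
        refine Finset.sum_le_sum fun x hx => ?_
        have hx' := (Finset.mem_filter.1 hx).2
        have h0 : 0 < ν.real (Metric.closedBall x r) :=
          measureReal_closedBall_pos (hs (Finset.mem_filter.1 hx).1) hr
        have e : ν.real (Metric.closedBall x r) ^ q =
          ν.real (Metric.closedBall x r) ^ h * ν.real (Metric.closedBall x r) ^ (q - h) := by
          rw [← Real.rpow_add h0]; congr 1; ring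
        rw [e]
        gcongr
    _ = β ^ h * ∑ x ∈ s with ν.real (Metric.closedBall x r) < β,
        ν.real (Metric.closedBall x r) ^ (q - h) := by rw [Finset.mul_sum]
    _ ≤ _ := by
        gcongr
        refine sum_le_packSum hb (by linarith) hr _ ?_ ?_
        · exact fun x hx => hs (Finset.mem_filter.1 hx).1
        · exact hd.subset fun x hx => (Finset.mem_filter.1 hx).1

lemma exists_slope_bound {τ : ℝ → ℝ} {q α : ℝ} (hτ : HasDerivAt τ α q) {κ δ : ℝ} (hκ : 0 < κ)
    (hδ : 0 < δ) : ∃ h : ℝ, 0 < h ∧ h < δ ∧ τ q + α * h - κ * h ≤ τ (q + h) ∧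
      τ q - α * h - κ * h ≤ τ (q - h) := by
  have h1 := (hasDerivAt_iff_isLittleO_nhds_zero.1 hτ).def hκ
  obtain ⟨r, hr, hball⟩ := Metric.eventually_nhds_iff.1 h1
  have hm : 0 < min r δ := lt_min hr hδ
  have h2 : min r δ / 2 < r := by linarith [min_le_left r δ]
  refine ⟨min r δ / 2, by positivity, by linarith [min_le_right r δ], ?_, ?_⟩
  · have := hball (y := min r δ / 2) (by simpa [abs_of_pos hm] using h2)
    rw [Real.norm_eq_abs, Real.norm_eq_abs, abs_of_pos (by positivity : 0 < min r δ / 2),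
      smul_eq_mul] at this
    have := (abs_le.1 this).1
    linarith
  · have := hball (y := -(min r δ / 2)) (by simpa [abs_of_pos hm] using h2)
    rw [Real.norm_eq_abs, Real.norm_eq_abs, abs_neg, abs_of_pos (by positivity : 0 < min r δ / 2),
      smul_eq_mul, ← sub_eq_add_neg] at this
    have := (abs_le.1 this).1
    linarith

/-- At every small scale `2⁻ᴹ` there are about `2^{M (q τ'(q) - τ(q))}` disjoint balls whose
measures are at least about `2^{-M τ'(q)}`.  The balls of other sizes are negligible in the packing
sum for `q`, by comparison with the packing sums for `q + h` and `q - h`. -/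
lemma HasSubexpDecomposition.eventually_exists_typical_balls
    {K : Set (EuclideanSpace ℝ (Fin d))}
    (hdec : HasSubexpDecomposition ν K) (hfin : FiniteLqSpectrum ν) {q α η : ℝ} (hq : 0 < q)
    (hα : HasDerivAt (lqSpectrum ν) α q) (hη : 0 < η) :
    ∀ᶠ M : ℕ in atTop, ∃ s : Finset (EuclideanSpace ℝ (Fin d)),
      (s : Set (EuclideanSpace ℝ (Fin d))) ⊆ ν.support ∧
      (s : Set (EuclideanSpace ℝ (Fin d))).PairwiseDisjoint
        (fun x => Metric.closedBall x ((1 / 2) ^ M)) ∧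
      2 ^ ((M : ℝ) * (α * q - lqSpectrum ν q - η)) ≤ (s.card : ℝ) ∧
      ∀ w ∈ s, 2 ^ (-((M : ℝ) * (α + η))) ≤ ν.real (Metric.closedBall w ((1 / 2) ^ M)) := by
  classical
  have hb : Bornology.IsBounded ν.support := hdec.1.subset hdec.2.1
  set τ := lqSpectrum ν q with hτ
  set η' := η / (2 * (q + 1)) with hη'
  have hη'0 : 0 < η' := by positivity
  have e1 : 2 * (q * η') + 2 * η' = η := by rw [hη']; field_simp
  have hqη' : 0 < q * η' := by positivity
  obtain ⟨h, hh0, hhq, hplus, hminus⟩ := exists_slope_bound hα (κ := η' / 4) (by positivity) hq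
  set ε := min (η' * h / 8) (η / 8) with hε
  have hε0 : 0 < ε := lt_min (by positivity) (by positivity)
  have hε1 : ε ≤ η' * h / 8 := min_le_left _ _
  have hε2 : ε ≤ η / 8 := min_le_right _ _
  have hη'h : 0 < η' * h := by positivity
  filter_upwards [hdec.eventually_le_packSum hfin hq (show τ < τ + ε by linarith),
    eventually_packSum_le hb hfin (q := q + h) (by linarith)
      (show lqSpectrum ν (q + h) - ε < lqSpectrum ν (q + h) by linarith),
    eventually_packSum_le hb hfin (q := q - h) (by linarith)
      (show lqSpectrum ν (q - h) - ε < lqSpectrum ν (q - h) by linarith),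
    eventually_const_le_two_rpow (show 0 < η' * h / 2 by positivity) 8,
    eventually_const_le_two_rpow (show 0 < η / 8 by positivity) 4] with M hlow hup hum h8 h4
  set r : ℝ := (1 / 2) ^ M with hr
  have hr0 : 0 < r := by positivity
  have hM : (0 : ℝ) ≤ M := Nat.cast_nonneg M
  set T : ℝ := 2 ^ (-((τ + ε) * M)) with hT
  have hT0 : 0 < T := by positivity
  obtain ⟨s, hs, hsd, hsum⟩ := exists_packing_of_lt hr0 (T := T / 2) (by positivity)
    (lt_of_lt_of_le (by linarith) hlow)
  set f : EuclideanSpace ℝ (Fin d) → ℝ := fun x => ν.real (Metric.closedBall x r) with hf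
  set βu : ℝ := 2 ^ (-((M : ℝ) * (α - η'))) with hβu
  set βl : ℝ := 2 ^ (-((M : ℝ) * (α + η'))) with hβl
  have key : ∀ y : ℝ, y + η' * h / 2 * M ≤ -((τ + ε) * M) → (2 : ℝ) ^ y ≤ T / 8 := by
    intro y hy
    rw [le_div_iff₀ (by norm_num)]
    calc (2 : ℝ) ^ y * 8 ≤ 2 ^ y * 2 ^ (η' * h / 2 * M) := by gcongr
      _ = 2 ^ (y + η' * h / 2 * M) := by rw [Real.rpow_add (by norm_num)]
      _ ≤ T := Real.rpow_le_rpow_of_exponent_le (by norm_num) hy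
  have hhi : ∑ x ∈ s with βu < f x, f x ^ q ≤ T / 8 := by
    refine (sum_rpow_filter_lt_le hb hq.le hh0.le hr0 (by positivity) s hs hsd).trans ?_
    refine (mul_le_mul_of_nonneg_left hup (by positivity)).trans ?_
    rw [hβu, ← Real.rpow_mul (by norm_num), ← Real.rpow_add (by norm_num)]
    apply key
    have : (M : ℝ) * (τ + α * h - η' / 4 * h) ≤ M * lqSpectrum ν (q + h) := by gcongr
    have : (M : ℝ) * ε ≤ M * (η' * h / 8) := by gcongr
    nlinarith
  have hlo : ∑ x ∈ s with f x < βl, f x ^ q ≤ T / 8 := by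
    refine (sum_rpow_filter_gt_le hb hhq.le hh0.le hr0 (by positivity) s hs hsd).trans ?_
    refine (mul_le_mul_of_nonneg_left hum (by positivity)).trans ?_
    rw [hβl, ← Real.rpow_mul (by norm_num), ← Real.rpow_add (by norm_num)]
    apply key
    have : (M : ℝ) * (τ - α * h - η' / 4 * h) ≤ M * lqSpectrum ν (q - h) := by gcongr
    have : (M : ℝ) * ε ≤ M * (η' * h / 8) := by gcongr
    nlinarith
  set G := s.filter fun x => βl ≤ f x ∧ f x ≤ βu with hG
  have hsplit : ∑ x ∈ s, f x ^ q ≤ ∑ x ∈ G, f x ^ q + ∑ x ∈ s with βu < f x, f x ^ q +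
      ∑ x ∈ s with f x < βl, f x ^ q := by
    rw [hG, Finset.sum_filter, Finset.sum_filter, Finset.sum_filter, ← Finset.sum_add_distrib,
      ← Finset.sum_add_distrib]
    refine Finset.sum_le_sum fun x _ => ?_
    have h0 : 0 ≤ f x ^ q := Real.rpow_nonneg measureReal_nonneg q
    by_cases h1 : βu < f x
    · rw [if_pos h1]
      have : (0 : ℝ) ≤ if βl ≤ f x ∧ f x ≤ βu then f x ^ q else 0 := by split_ifs <;> simp [h0]
      have : (0 : ℝ) ≤ if f x < βl then f x ^ q else 0 := by split_ifs <;> simp [h0]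
      linarith
    · by_cases h2 : f x < βl
      · rw [if_neg h1, if_pos h2]
        have : (0 : ℝ) ≤ if βl ≤ f x ∧ f x ≤ βu then f x ^ q else 0 := by split_ifs <;> simp [h0]
        linarith
      · rw [if_neg h1, if_neg h2, if_pos ⟨not_lt.1 h2, not_lt.1 h1⟩]
        linarith
  have hGsum : T / 4 ≤ ∑ x ∈ G, f x ^ q := by linarith
  have hGcard : ∑ x ∈ G, f x ^ q ≤ G.card * βu ^ q := by
    refine (Finset.sum_le_card_nsmul _ _ (βu ^ q) fun x hx => ?_).trans (nsmul_eq_mul _ _).le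
    exact Real.rpow_le_rpow measureReal_nonneg (Finset.mem_filter.1 hx).2.2 hq.le
  refine ⟨G, fun x hx => hs (Finset.mem_filter.1 hx).1,
    hsd.subset fun x hx => (Finset.mem_filter.1 hx).1, ?_, fun w hw => ?_⟩
  · have h5 : 2 ^ ((M : ℝ) * (α * q - τ - η)) * βu ^ q ≤ T / 4 := by
      rw [le_div_iff₀ (by norm_num), hβu, ← Real.rpow_mul (by norm_num),
        ← Real.rpow_add (by norm_num)]
      refine (mul_le_mul_of_nonneg_left h4 (by positivity)).trans ?_
      rw [← Real.rpow_add (by norm_num)]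
      refine Real.rpow_le_rpow_of_exponent_le (by norm_num) ?_
      have : (M : ℝ) * ε ≤ M * (η / 8) := by gcongr
      have : (M : ℝ) * (q * η') ≤ M * (η / 2) := by
        refine mul_le_mul_of_nonneg_left ?_ hM
        linarith
      nlinarith
    exact le_of_mul_le_mul_right (h5.trans (hGsum.trans hGcard)) (by positivity)
  · refine le_trans ?_ (Finset.mem_filter.1 hw).2.1
    refine Real.rpow_le_rpow_of_exponent_le (by norm_num) ?_
    have : η' ≤ η := by linarith
    have : (M : ℝ) * (α + η') ≤ M * (α + η) := by gcongr
    linarith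

end Spectrum

/-! ### Transporting typical balls into a given ball -/

section LocalBoxCounting

variable {d : ℕ} {ν : Measure (EuclideanSpace ℝ (Fin d))}

lemma two_zpow_neg_sub (n m : ℕ) : (2 : ℝ) ^ (-(n : ℤ) - m) = (1 / 2) ^ (n + m) := by
  rw [one_div, inv_pow, ← zpow_natCast, ← zpow_neg]
  congr 1; push_cast; ring

lemma two_zpow_neg (n : ℕ) : (2 : ℝ) ^ (-(n : ℤ)) = (1 / 2) ^ n := by
  rw [one_div, inv_pow, ← zpow_natCast, ← zpow_neg]

lemma two_zpow_neg_sub_one (n : ℕ) : (2 : ℝ) ^ (-(n : ℤ) - 1) = (1 / 2) ^ n / 2 := by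
  rw [zpow_sub₀ (by norm_num), two_zpow_neg, zpow_one]

lemma hasGoodBalls_of_finset {q b F : ℝ} {k n m : ℕ} {x : EuclideanSpace ℝ (Fin d)}
    (G : Finset (EuclideanSpace ℝ (Fin d)))
    (z : EuclideanSpace ℝ (Fin d) → EuclideanSpace ℝ (Fin d))
    (hV : 0 < ν.real (Metric.closedBall x ((1 / 2) ^ n)))
    (hsep : ∀ w ∈ G, ∀ w' ∈ G, w ≠ w' → 2 * (1 / 2) ^ (n + m) < dist (z w) (z w'))
    (hcard : 2 ^ ((m : ℝ) * (deriv (lqSpectrum ν) q * q - lqSpectrum ν q - b)) ≤ (G.card : ℝ))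
    (hG : ∀ w ∈ G, dist (z w) x + (1 / 2) ^ (n + m) ≤ (1 / 2) ^ n ∧
      2 ^ (-(m : ℝ) * (deriv (lqSpectrum ν) q + 1 / (k : ℝ))) *
          ν.real (Metric.closedBall x ((1 / 2) ^ n)) ≤
        ν.real (Metric.closedBall (z w) ((1 / 2) ^ (n + m))) ∧
      ν.real (Metric.closedBall (z w) ((1 / 2) ^ (n + m))) ≤
        2 ^ (-(m : ℝ) * (deriv (lqSpectrum ν) q - 1 / (k : ℝ))) *
          ν.real (Metric.closedBall x ((1 / 2) ^ n)) ∧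
      0 < ν.real (Metric.closedBall (z w) ((1 / 2) ^ (n + m) / 2)) ∧
      ν.real (Metric.closedBall (z w) (2 * (1 / 2) ^ (n + m))) ≤
        F * ν.real (Metric.closedBall (z w) ((1 / 2) ^ (n + m) / 2))) :
    HasGoodBalls ν q k n m x b F := by
  have e1 : (2 : ℝ) ^ (-(n : ℤ) - m - 1) = (1 / 2) ^ (n + m) / 2 := by
    rw [zpow_sub₀ (by norm_num), two_zpow_neg_sub, zpow_one]
  have e2 : (2 : ℝ) ^ (-(n : ℤ) - m + 1) = 2 * (1 / 2) ^ (n + m) := by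
    rw [zpow_add₀ (by norm_num), two_zpow_neg_sub, zpow_one, mul_comm]
  refine ⟨G.card, fun i => z (G.equivFin.symm i), fun i j hij => ?_, hcard, fun i => ?_⟩
  · rw [two_zpow_neg_sub]
    refine Metric.closedBall_disjoint_closedBall ?_
    have := hsep _ (G.equivFin.symm i).2 _ (G.equivFin.symm j).2
      (fun h => hij (G.equivFin.symm.injective (Subtype.ext h)))
    linarith
  · obtain ⟨h1, h2, h3, h4, h5⟩ := hG _ (G.equivFin.symm i).2
    rw [two_zpow_neg_sub, e1, e2, two_zpow_neg, le_div_iff₀ hV, div_le_iff₀ hV, div_le_iff₀ h4]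
    exact ⟨Metric.closedBall_subset_closedBall' (by linarith), h2, h3, h4, h5⟩

lemma HasGoodBalls.mono {q b F F' : ℝ} {k n m : ℕ} {x : EuclideanSpace ℝ (Fin d)}
    (h : HasGoodBalls ν q k n m x b F) (hF : F ≤ F') : HasGoodBalls ν q k n m x b F' := by
  obtain ⟨N, y, h1, h2, h3⟩ := h
  exact ⟨N, y, h1, h2, fun i => ⟨(h3 i).1, (h3 i).2.1, (h3 i).2.2.1, (h3 i).2.2.2.1,
    (h3 i).2.2.2.2.trans hF⟩⟩

/-- Thresholds of the form `ε n + C_ε`, for every `ε > 0`, can be replaced by a single sublinear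
threshold. -/
lemma exists_sublinear_threshold (Q : ℕ → ℝ → Prop)
    (hQ : ∀ ε : ℝ, 0 < ε → ∃ C : ℝ, 0 ≤ C ∧ ∀ (n : ℕ) t, ε * n + C ≤ t → Q n t) {F : ℝ} (hF : 0 < F) :
    ∃ f : ℕ → ℝ, (∀ n, F ≤ f n) ∧ Tendsto (fun n : ℕ => f n / (n : ℝ)) atTop (𝓝 0) ∧
      ∀ n t, f n ≤ t → Q n t := by
  have hpos : ∀ j : ℕ, 0 < 1 / ((j : ℝ) + 1) := fun j => by positivity
  choose C hC0 hC using fun j : ℕ => hQ (1 / ((j : ℝ) + 1)) (hpos j)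
  let g : ℕ → ℝ := fun n => (Finset.range (n + 1)).inf' Finset.nonempty_range_add_one
    fun j => 1 / ((j : ℝ) + 1) * n + C j
  have hg0 : ∀ n, 0 ≤ g n := fun n => Finset.le_inf' _ _ fun j _ => by
    have := hC0 j; positivity
  refine ⟨fun n => g n + F, fun n => by linarith [hg0 n], ?_, fun n t hnt => ?_⟩
  · rw [Metric.tendsto_atTop]
    intro ε hε
    obtain ⟨j, hj⟩ := exists_nat_one_div_lt (show 0 < ε / 2 by positivity)
    obtain ⟨N, hN⟩ := exists_nat_gt ((C j + F) / (ε / 2))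
    refine ⟨max (N + 1) j, fun n hn => ?_⟩
    have hnj : j ≤ n := (le_max_right _ _).trans hn
    have hnN : (N : ℝ) + 1 ≤ n := by exact_mod_cast (le_max_left _ _).trans hn
    have hn0 : (0 : ℝ) < n := by
      have : (0 : ℝ) ≤ N := Nat.cast_nonneg N
      linarith
    have h1 : g n ≤ 1 / ((j : ℝ) + 1) * n + C j :=
      Finset.inf'_le (fun j : ℕ => 1 / ((j : ℝ) + 1) * (n : ℝ) + C j)
        (Finset.mem_range.2 (Nat.lt_succ_of_le hnj))
    have h2 : C j + F < ε / 2 * n := by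
      rw [div_lt_iff₀ (by positivity)] at hN
      nlinarith
    have h3 : 0 ≤ (g n + F) / (n : ℝ) := by have := hg0 n; positivity
    rw [Real.dist_eq, sub_zero, abs_of_nonneg h3, div_lt_iff₀ hn0]
    nlinarith
  · obtain ⟨j, -, hj⟩ := Finset.exists_mem_eq_inf' (Finset.nonempty_range_add_one (n := n))
      fun j : ℕ => 1 / ((j : ℝ) + 1) * (n : ℝ) + C j
    refine hC j n t (le_trans ?_ hnt)
    change _ ≤ g n + F
    have : g n = 1 / ((j : ℝ) + 1) * (n : ℝ) + C j := hj
    linarith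

/-- Markov's inequality for the `s`-th power. -/
lemma card_mul_rpow_le {ι : Type*} (I : Finset ι) (f : ι → ℝ) {s L V T β : ℝ} (hs : 0 ≤ s)
    (hV : 0 < V) (hβ : 0 ≤ β) (hI : ∀ i ∈ I, β * V < f i)
    (hsum : ∑ i ∈ I, f i ^ s ≤ L * (V ^ s * T)) : (I.card : ℝ) * β ^ s ≤ L * T := by
  have h2 : (I.card : ℝ) * (β * V) ^ s ≤ ∑ i ∈ I, f i ^ s := by
    rw [← nsmul_eq_mul]
    exact Finset.card_nsmul_le_sum _ _ _ fun i hi =>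
      Real.rpow_le_rpow (by positivity) (hI i hi).le hs
  rw [Real.mul_rpow hβ hV.le] at h2
  refine le_of_mul_le_mul_right ?_ (show 0 < V ^ s by positivity)
  linarith

lemma eventually_const_mul_pow_le_two_rpow {δ : ℝ} (hδ : 0 < δ) {A : ℝ} (hA : 0 < A) (k : ℕ) :
    ∀ᶠ m : ℕ in atTop, A * (m : ℝ) ^ k ≤ 2 ^ (δ * m) := by
  have h1 : (1 : ℝ) < 2 ^ δ := Real.one_lt_rpow (by norm_num) hδ
  have h2 := (isLittleO_pow_const_const_pow_of_one_lt (R := ℝ) k h1).def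
    (c := 1 / A) (by positivity)
  filter_upwards [h2] with m hm
  rw [Real.norm_of_nonneg (by positivity), Real.norm_of_nonneg (by positivity),
    ← Real.rpow_natCast, ← Real.rpow_natCast ((2 : ℝ) ^ δ), ← Real.rpow_mul (by norm_num),
    Real.rpow_natCast, div_mul_eq_mul_div, one_mul, le_div_iff₀ (by positivity)] at hm
  linarith

lemma measure_compl_eq_zero_of_support_subset {K : Set (EuclideanSpace ℝ (Fin d))}
    (hsK : ν.support ⊆ K) : ν Kᶜ = 0 :=
  measure_mono_null (compl_subset_compl.2 hsK) Measure.measure_compl_support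

variable [IsProbabilityMeasure ν]

/-- Since few pieces of the decomposition meet the ball of radius `2⁻ⁿ / 2` about `x`, one of them
carries a large part of its measure; this piece lies well inside the ball of radius `2⁻ⁿ`. -/
lemma HasDecomposition.exists_map {K : Set (EuclideanSpace ℝ (Fin d))} {n : ℕ} {Λ : ℝ}
    (h : HasDecomposition ν K n Λ) (hsK : ν.support ⊆ K) (x : EuclideanSpace ℝ (Fin d))
    (hpos : 0 < ν.real (Metric.closedBall x ((1 / 2) ^ n / 2))) (m e : ℕ) (hΛe : Λ ≤ 2 ^ e) :
    ∃ g : EuclideanSpace ℝ (Fin d) → EuclideanSpace ℝ (Fin d),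
      (∀ w ∈ K, dist (g w) x ≤ 5 / 8 * (1 / 2) ^ n) ∧
      (∀ w ∈ K, ∀ w' ∈ K, dist w w' ≤ Λ * 2 ^ n * dist (g w) (g w')) ∧
      ∀ w ∈ K, ν.real (Metric.closedBall x ((1 / 2) ^ n / 2)) *
        ν.real (Metric.closedBall w ((1 / 2) ^ (m + e))) ≤
          Λ * ν.real (Metric.closedBall (g w) ((1 / 2) ^ (n + m))) := by
  classical
  obtain ⟨F, P, hP, hdec, hlip, hcount⟩ := h
  set B := Metric.closedBall x ((1 / 2) ^ n / 2) with hB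
  have hn0 : (0 : ℝ) < (1 / 2) ^ n := by positivity
  let F' := F.filter fun s => ∃ y ∈ K, dist (s y) x ≤ (1 / 2) ^ n / 2
  have hF'card : (F'.card : ℝ) ≤ Λ := hcount x F' (Finset.filter_subset _ _) fun s hs => by
    obtain ⟨y, hy, hyx⟩ := (Finset.mem_filter.1 hs).2
    exact ⟨y, hy, by linarith⟩
  have h1 : ν.real B ≤ ∑ s ∈ F', P s := by
    rw [hdec B Metric.isClosed_closedBall]
    have h2 : ∑ s ∈ F, P s * ν.real (K ∩ s ⁻¹' B) = ∑ s ∈ F', P s * ν.real (K ∩ s ⁻¹' B) := by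
      symm
      refine Finset.sum_subset (Finset.filter_subset _ _) fun s hs hs' => ?_
      have : K ∩ s ⁻¹' B = ∅ := by
        rw [Set.eq_empty_iff_forall_notMem]
        rintro v ⟨hvK, hv⟩
        exact hs' (Finset.mem_filter.2 ⟨hs, v, hvK, hv⟩)
      rw [this, measureReal_empty, mul_zero]
    rw [h2]
    exact Finset.sum_le_sum fun s _ => mul_le_of_le_one_right (hP s) measureReal_le_one
  have hne : F'.Nonempty := by
    by_contra hemp
    rw [Finset.not_nonempty_iff_eq_empty.1 hemp, Finset.sum_empty] at h1
    linarith
  obtain ⟨g, hg, hmax⟩ := F'.exists_max_image P hne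
  have hgP : ν.real B ≤ Λ * P g := by
    refine h1.trans ((Finset.sum_le_card_nsmul _ _ _ hmax).trans ?_)
    rw [nsmul_eq_mul]
    exact mul_le_mul_of_nonneg_right hF'card (hP g)
  obtain ⟨hgF, y, hyK, hyx⟩ := Finset.mem_filter.1 hg
  have hΛ0 : 0 ≤ Λ := (Nat.cast_nonneg _).trans hF'card
  refine ⟨g, fun w hw => ?_, fun w hw w' hw' => (hlip g hgF w hw w' hw').1, fun w hw => ?_⟩
  · have := (hlip g hgF w hw y hyK).2.2
    have := dist_triangle (g w) (g y) x
    linarith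
  · have hsub : K ∩ Metric.closedBall w ((1 / 2) ^ (m + e)) ⊆
        K ∩ g ⁻¹' Metric.closedBall (g w) ((1 / 2) ^ (n + m)) := by
      rintro v ⟨hvK, hv⟩
      refine ⟨hvK, ?_⟩
      rw [Metric.mem_closedBall] at hv
      rw [mem_preimage, Metric.mem_closedBall]
      calc dist (g v) (g w) ≤ Λ * (1 / 2) ^ n * dist v w := (hlip g hgF v hvK w hw).2.1
        _ ≤ 2 ^ e * (1 / 2) ^ n * (1 / 2) ^ (m + e) := by gcongr
        _ = (1 / 2) ^ (n + m) := by
          rw [pow_add _ m e, pow_add _ n m]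
          have : (2 : ℝ) ^ e * (1 / 2) ^ e = 1 := by rw [← mul_pow]; norm_num
          linear_combination (1 / 2 : ℝ) ^ n * (1 / 2) ^ m * this
    have h3 : ν.real (Metric.closedBall w ((1 / 2) ^ (m + e))) ≤
        ν.real (K ∩ g ⁻¹' Metric.closedBall (g w) ((1 / 2) ^ (n + m))) := by
      refine le_trans (le_of_eq ?_) (measureReal_mono hsub (measure_ne_top _ _))
      rw [Measure.real, Measure.real, inter_comm,
        measure_inter_conull (measure_compl_eq_zero_of_support_subset hsK)]
    have h4 : P g * ν.real (K ∩ g ⁻¹' Metric.closedBall (g w) ((1 / 2) ^ (n + m))) ≤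
        ν.real (Metric.closedBall (g w) ((1 / 2) ^ (n + m))) := by
      rw [hdec (Metric.closedBall (g w) ((1 / 2) ^ (n + m))) Metric.isClosed_closedBall]
      exact Finset.single_le_sum (f := fun s =>
        P s * ν.real (K ∩ s ⁻¹' Metric.closedBall (g w) ((1 / 2) ^ (n + m))))
        (fun s _ => mul_nonneg (hP s) measureReal_nonneg) hgF
    calc _ ≤ Λ * P g * ν.real (K ∩ g ⁻¹' Metric.closedBall (g w) ((1 / 2) ^ (n + m))) := by
          gcongr
          exact mul_nonneg hΛ0 (hP g)
      _ = Λ * (P g * ν.real (K ∩ g ⁻¹' Metric.closedBall (g w) ((1 / 2) ^ (n + m)))) := by ring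
      _ ≤ _ := by gcongr

/-- The balls of a packing of `supp ν` at scale `2^{-m-e}` are transported into the ball of radius
`2⁻ⁿ` about `x`; after thinning out, each of them is replaced by a nearby doubling ball of radius
`2^{-n-m}`, at the cost of factors polynomial in the number `J` of radii that are tried. -/
lemma HasDecomposition.exists_doubling_family {K : Set (EuclideanSpace ℝ (Fin d))} {n : ℕ}
    {Λ : ℝ} (h : HasDecomposition ν K n Λ) (hsK : ν.support ⊆ K)
    (x : EuclideanSpace ℝ (Fin d))
    (hpos : 0 < ν.real (Metric.closedBall x ((1 / 2) ^ n / 2))) (m e J : ℕ) (hΛe : Λ ≤ 2 ^ e)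
    (hΛ : 0 < Λ) (hJ : 8 * (2 + 2 * (J : ℝ)) ≤ 2 ^ m) (W : Finset (EuclideanSpace ℝ (Fin d)))
    (hW : (W : Set (EuclideanSpace ℝ (Fin d))) ⊆ ν.support)
    (hWd : (W : Set (EuclideanSpace ℝ (Fin d))).PairwiseDisjoint
      fun x => Metric.closedBall x ((1 / 2) ^ (m + e)))
    (hWJ : ∀ w ∈ W, Λ * ν.real (Metric.closedBall x ((1 / 2) ^ n)) <
      2 ^ J * (ν.real (Metric.closedBall x ((1 / 2) ^ n / 2)) *
        ν.real (Metric.closedBall w ((1 / 2) ^ (m + e))))) :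
    ∃ W' ⊆ W, ∃ z : EuclideanSpace ℝ (Fin d) → EuclideanSpace ℝ (Fin d),
      (W.card : ℝ) ≤ (4 ^ e * (9 + 8 * (J : ℝ))) ^ d * W'.card ∧
      (∀ w ∈ W', ∀ w' ∈ W', w ≠ w' → 2 * (1 / 2) ^ (n + m) < dist (z w) (z w')) ∧
      ∀ w ∈ W', dist (z w) x + (1 / 2) ^ (n + m) ≤ 3 / 4 * (1 / 2) ^ n ∧
        ν.real (Metric.closedBall (z w) (2 * (1 / 2) ^ (n + m))) ≤
          4 * 9 ^ d * ν.real (Metric.closedBall (z w) ((1 / 2) ^ (n + m) / 2)) ∧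
        ν.real (Metric.closedBall x ((1 / 2) ^ n / 2)) *
          ν.real (Metric.closedBall w ((1 / 2) ^ (m + e))) ≤
            Λ * (2 * (5 + 8 * (J : ℝ)) ^ d *
              ν.real (Metric.closedBall (z w) ((1 / 2) ^ (n + m) / 2))) := by
  classical
  obtain ⟨g, hg1, hg2, hg3⟩ := h.exists_map hsK x hpos m e hΛe
  set r : ℝ := (1 / 2) ^ (n + m) with hr
  have hr0 : 0 < r := by positivity
  have hrJ : r * (2 + 2 * (J : ℝ)) ≤ (1 / 2) ^ n / 8 := by
    have h1 : (1 / 2 : ℝ) ^ m * 2 ^ m = 1 := by rw [← mul_pow]; norm_num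
    have h2 : (1 / 2 : ℝ) ^ m * (8 * (2 + 2 * (J : ℝ))) ≤ 1 :=
      (mul_le_mul_of_nonneg_left hJ (by positivity)).trans h1.le
    have h3 : (0 : ℝ) < (1 / 2) ^ n := by positivity
    rw [hr, pow_add]
    nlinarith
  have hchoose : ∀ w, ∃ z, w ∈ W → z ∈ Metric.closedBall (g w) (r + 2 * r * J) ∧
      ν.real (Metric.closedBall z (2 * r)) ≤ 4 * 9 ^ d * ν.real (Metric.closedBall z (r / 2)) ∧
      ν.real (Metric.closedBall (g w) r) ≤
        2 * (5 + 8 * (J : ℝ)) ^ d * ν.real (Metric.closedBall z (r / 2)) := by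
    intro w
    by_cases hw : w ∈ W
    · have hwK := hsK (hW hw)
      have h1 : ν.real (Metric.closedBall (g w) (r + 2 * r * J)) ≤
          ν.real (Metric.closedBall x ((1 / 2) ^ n)) := by
        refine measureReal_mono (Metric.closedBall_subset_closedBall' ?_) (measure_ne_top _ _)
        have := hg1 w hwK
        have h3 : (0 : ℝ) < (1 / 2) ^ n := by positivity
        nlinarith
      have h2 : Λ * ν.real (Metric.closedBall x ((1 / 2) ^ n)) <
          Λ * (2 ^ J * ν.real (Metric.closedBall (g w) r)) := by
        refine (hWJ w hw).trans_le ?_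
        calc _ ≤ 2 ^ J * (Λ * ν.real (Metric.closedBall (g w) r)) :=
              mul_le_mul_of_nonneg_left (hg3 w hwK) (by positivity)
          _ = _ := by ring
      obtain ⟨z, hz1, hz2, hz3⟩ := exists_doubling_ball ν (g w) hr0 J
        (h1.trans_lt (lt_of_mul_lt_mul_left h2 hΛ.le))
      rw [finrank_euclideanSpace_fin] at hz2 hz3
      exact ⟨z, fun _ => ⟨hz1, hz2, hz3⟩⟩
    · exact ⟨0, fun h => absurd h hw⟩
  choose z hz using hchoose
  have hρ0 : (0 : ℝ) < (1 / 2) ^ (m + e) := by positivity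
  have hmult : ∀ w ∈ W, ∀ t ⊆ W, (∀ j ∈ t, dist (g j) (g w) ≤ r * (4 + 4 * J)) →
      (t.card : ℝ) ≤ (4 ^ e * (9 + 8 * (J : ℝ))) ^ d := by
    intro w hw t ht htw
    have hwK := hsK (hW hw)
    have h4e : (1 : ℝ) ≤ 4 ^ e := one_le_pow₀ (by norm_num)
    have h1 := card_le_of_separated t (fun a => a) w hρ0
      (R := (1 / 2) ^ (m + e) * (4 ^ e * (4 + 4 * (J : ℝ)))) (by positivity) (fun j hj => ?_)
      fun i hi j hj hij => (lt_dist_of_pairwiseDisjoint hρ0 hWd i (ht hi) j (ht hj) hij).le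
    · rw [finrank_euclideanSpace_fin] at h1
      refine h1.trans (pow_le_pow_left₀ (by positivity) ?_ _)
      have : 2 * ((1 / 2) ^ (m + e) * (4 ^ e * (4 + 4 * (J : ℝ)))) / (1 / 2) ^ (m + e) =
          4 ^ e * (8 + 8 * (J : ℝ)) := by field_simp; ring
      rw [this]
      linarith
    · calc dist j w ≤ Λ * 2 ^ n * dist (g j) (g w) := hg2 j (hsK (hW (ht hj))) w hwK
        _ ≤ 2 ^ e * 2 ^ n * (r * (4 + 4 * (J : ℝ))) := by gcongr; exact htw j hj
        _ = (1 / 2) ^ (m + e) * (4 ^ e * (4 + 4 * (J : ℝ))) := by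
          have h4 : (4 : ℝ) ^ e = 2 ^ e * 2 ^ e := by rw [← mul_pow]; norm_num
          have e1 : (2 : ℝ) ^ e * (1 / 2) ^ e = 1 := by rw [← mul_pow]; norm_num
          have e2 : (2 : ℝ) ^ n * (1 / 2) ^ n = 1 := by rw [← mul_pow]; norm_num
          rw [hr, pow_add, pow_add, h4]
          linear_combination (2 ^ e * (1 / 2) ^ m * (4 + 4 * (J : ℝ))) * e2 -
            (2 ^ e * (1 / 2) ^ m * (4 + 4 * (J : ℝ))) * e1
  obtain ⟨W', hW'W, hW'un, hW'card⟩ := exists_unrelated_subset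
    (fun w w' => dist (g w') (g w) ≤ r * (4 + 4 * J)) (fun w w' h => by rwa [dist_comm])
    (fun w => by simp only [dist_self]; positivity) (fun _ => (1 : ℝ)) (fun _ => zero_le_one)
    (M := (4 ^ e * (9 + 8 * (J : ℝ))) ^ d) W hmult
  refine ⟨W', hW'W, z, by simpa using hW'card, fun w hw w' hw' hne => ?_, fun w hw => ?_⟩
  · have h1 := hW'un w hw w' hw' hne
    have h2 := (hz w (hW'W hw)).1
    have h3 := (hz w' (hW'W hw')).1
    rw [Metric.mem_closedBall] at h2 h3
    rw [not_le, dist_comm] at h1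
    have h4 := dist_triangle4 (g w) (z w) (z w') (g w')
    rw [dist_comm (g w) (z w)] at h4
    linarith
  · obtain ⟨hz1, hz2, hz3⟩ := hz w (hW'W hw)
    have hwK := hsK (hW (hW'W hw))
    refine ⟨?_, hz2, (hg3 w hwK).trans (by gcongr)⟩
    have h1 := hg1 w hwK
    have h2 := dist_triangle (z w) (g w) x
    rw [Metric.mem_closedBall] at hz1
    linarith

/-! ### The local box-counting principle -/

set_option maxHeartbeats 1000000 in
/-- The local box-counting principle for fixed `k`, with thresholds `ε n + C_ε`.  Transported typical
balls, made doubling, are numerous and not too light; those that are too heavy are outnumbered.  All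
exponents are within a multiple of `δ m` of their ideal values, where `δ` is small compared with
`1/k`. -/
lemma HasSubexpDecomposition.exists_threshold {K : Set (EuclideanSpace ℝ (Fin d))}
    (hdec : HasSubexpDecomposition ν K) (hfin : FiniteLqSpectrum ν) {q : ℝ} (hq : 0 < q)
    (hdiff : DifferentiableAt ℝ (lqSpectrum ν) q) {k : ℕ} (hk : 1 ≤ k) :
    ∃ a : ℝ, 0 < a ∧ ∀ ε : ℝ, 0 < ε → ∃ C : ℝ, 0 ≤ C ∧
      ∀ (n m : ℕ) (x : EuclideanSpace ℝ (Fin d)),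
        0 < ν.real (Metric.closedBall x ((1 / 2) ^ n / 2)) →
        ε * n + C + a * Real.log (ν.real (Metric.closedBall x ((1 / 2) ^ n)) /
          ν.real (Metric.closedBall x ((1 / 2) ^ n / 2))) ≤ (m : ℝ) →
        HasGoodBalls ν q k n m x (1 / k) (4 * 9 ^ d) := by
  classical
  have hb : Bornology.IsBounded ν.support := hdec.1.subset hdec.2.1
  have hsK := hdec.2.1
  have hα := hdiff.hasDerivAt
  set α := deriv (lqSpectrum ν) q with hαdef
  set τ := lqSpectrum ν q with hτ
  set κ : ℝ := 1 / (k : ℝ) with hκ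
  have hk0 : (1 : ℝ) ≤ k := by exact_mod_cast hk
  have hκ0 : 0 < κ := by positivity
  have hκ1 : κ ≤ 1 := by rw [hκ, div_le_one (by positivity)]; exact hk0
  obtain ⟨h, hh0, -, hh, -⟩ := exists_slope_bound hα hκ0 zero_lt_one
  set A : ℝ := |α * q - τ| + |α| + 2 * d + 8 with hA
  have hA8 : 8 ≤ A := by
    have := abs_nonneg (α * q - τ); have := abs_nonneg α
    have : (0 : ℝ) ≤ d := Nat.cast_nonneg d
    linarith
  set δ : ℝ := κ * min 1 q / A with hδ
  have hmin : 0 < min 1 q := lt_min one_pos hq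
  have hδ0 : 0 < δ := by positivity
  have hδA : δ * A = κ * min 1 q := by rw [hδ]; field_simp
  have hδA1 : δ * A ≤ κ := by
    rw [hδA]; exact mul_le_of_le_one_right hκ0.le (min_le_left _ _)
  have hδAq : δ * A ≤ κ * q := by rw [hδA]; gcongr; exact min_le_right _ _
  have hδ1 : δ ≤ 1 := by nlinarith
  refine ⟨1 / (δ * Real.log 2), by have := Real.log_pos one_lt_two; positivity, fun ε hε => ?_⟩
  obtain ⟨C₁, hC₁, hD⟩ := hdec.2.2 (δ * ε) (by positivity)
  obtain ⟨C₂, hC₂, hLq⟩ := hdec.sum_rpow_le (q := q + h) (by linarith) (ε := δ * ε)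
    (by positivity)
  set c : ℕ := ⌈2 * |α| + 6⌉₊ with hc
  have hcα : 2 * |α| + 6 ≤ c := Nat.le_ceil _
  have hlin := eventually_const_mul_pow_le_two_rpow one_pos
    (show 0 < 16 + 16 * (c : ℝ) by positivity) 1
  have hpoly := eventually_const_mul_pow_le_two_rpow hδ0
    (show 0 < 2 * (9 + 8 * (c : ℝ)) ^ d by positivity) d
  obtain ⟨m₀, hm₀⟩ := eventually_atTop.1
    ((hdec.eventually_exists_typical_balls hfin hq hα hδ0).and
    ((eventually_packSum_le hb hfin (q := q + h) (by linarith)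
      (show lqSpectrum ν (q + h) - δ < lqSpectrum ν (q + h) by linarith)).and
    (hpoly.and (hlin.and ((eventually_const_le_two_rpow hδ0 2).and (eventually_ge_atTop 1))))))
  set C : ℝ := m₀ + (Real.logb 2 C₁ + 1) / δ + Real.logb 2 C₂ / δ with hC
  have hl1 : 0 ≤ Real.logb 2 C₁ := Real.logb_nonneg one_lt_two hC₁
  have hl2 : 0 ≤ Real.logb 2 C₂ := Real.logb_nonneg one_lt_two hC₂
  refine ⟨C, by positivity, fun n m x hpos hm => ?_⟩
  set V := ν.real (Metric.closedBall x ((1 / 2) ^ n)) with hV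
  set H := ν.real (Metric.closedBall x ((1 / 2) ^ n / 2)) with hH
  have hHV : H ≤ V := by
    refine measureReal_mono (Metric.closedBall_subset_closedBall ?_) (measure_ne_top _ _)
    have : (0 : ℝ) < (1 / 2) ^ n := by positivity
    linarith
  have hV0 : 0 < V := hpos.trans_le hHV
  have hlog : 0 ≤ Real.log (V / H) := Real.log_nonneg ((one_le_div hpos).2 hHV)
  have hlog2 := Real.log_pos one_lt_two
  have hεn : 0 ≤ ε * n := by positivity
  have hal : 0 ≤ 1 / (δ * Real.log 2) * Real.log (V / H) := by positivity
  have hd1 : 0 ≤ (Real.logb 2 C₁ + 1) / δ := by positivity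
  have hd2 : 0 ≤ Real.logb 2 C₂ / δ := by positivity
  have hm0 : m₀ ≤ m := by
    have : (m₀ : ℝ) ≤ m := by linarith
    exact_mod_cast this
  obtain ⟨-, hΘ, hpoly, hlin, htwo, hm1⟩ := hm₀ m hm0
  have hm1' : (1 : ℝ) ≤ m := by exact_mod_cast hm1
  set L : ℝ := 2 ^ (δ * m) with hL
  have hL0 : 0 < L := by positivity
  -- the error terms are all at most `L = 2 ^ (δ m)`
  have hC1m : Real.logb 2 C₁ + 1 + δ * ε * n ≤ δ * m := by
    have : (Real.logb 2 C₁ + 1) / δ + ε * n ≤ m := by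
      have : (0 : ℝ) ≤ m₀ := Nat.cast_nonneg _
      linarith
    calc Real.logb 2 C₁ + 1 + δ * ε * n = δ * ((Real.logb 2 C₁ + 1) / δ + ε * n) := by
          field_simp
      _ ≤ δ * m := by gcongr
  have hC2m : Real.logb 2 C₂ + δ * ε * n ≤ δ * m := by
    have : Real.logb 2 C₂ / δ + ε * n ≤ m := by
      have : (0 : ℝ) ≤ m₀ := Nat.cast_nonneg _
      linarith
    calc Real.logb 2 C₂ + δ * ε * n = δ * (Real.logb 2 C₂ / δ + ε * n) := by field_simp
      _ ≤ δ * m := by gcongr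
  have hC2L : C₂ * 2 ^ (δ * ε * n) ≤ L := by
    rw [← Real.rpow_logb (b := 2) (x := C₂) (by norm_num) (by norm_num) (by linarith),
      ← Real.rpow_add (by norm_num)]
    exact Real.rpow_le_rpow_of_exponent_le (by norm_num) hC2m
  set Λ : ℝ := C₁ * 2 ^ (δ * ε * n) with hΛ
  have hΛ0 : 0 < Λ := by positivity
  have hΛlog : Λ = 2 ^ (Real.logb 2 C₁ + δ * ε * n) := by
    rw [Real.rpow_add (by norm_num), Real.rpow_logb (by norm_num) (by norm_num) (by linarith)]
  set e : ℕ := ⌈Real.logb 2 C₁ + δ * ε * n⌉₊ with he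
  have heδ : (e : ℝ) ≤ δ * m := by
    have := (Nat.ceil_lt_add_one (show 0 ≤ Real.logb 2 C₁ + δ * ε * n by positivity)).le
    linarith
  have hΛe : Λ ≤ 2 ^ e := by
    rw [hΛlog, ← Real.rpow_natCast]
    exact Real.rpow_le_rpow_of_exponent_le (by norm_num) (Nat.le_ceil _)
  have hΛL : Λ ≤ L := by
    refine hΛe.trans ?_
    rw [← Real.rpow_natCast]
    exact Real.rpow_le_rpow_of_exponent_le (by norm_num) heδ
  have hVH : V ≤ L * H := by
    rw [← div_le_iff₀ hpos, ← Real.log_le_log_iff (by positivity) hL0, hL,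
      Real.log_rpow (by norm_num)]
    have h1 : 1 / (δ * Real.log 2) * Real.log (V / H) ≤ m := by
      have : (0 : ℝ) ≤ m₀ := Nat.cast_nonneg _
      linarith
    rw [one_div, inv_mul_le_iff₀ (by positivity)] at h1
    linarith
  obtain ⟨W, hW, hWd, hWcard, hWν⟩ := (hm₀ (m + e) (hm0.trans (Nat.le_add_right m e))).1
  set M : ℝ := ((m + e : ℕ) : ℝ) with hM
  have hMe : M = m + e := by rw [hM]; push_cast; ring
  have he0 : (0 : ℝ) ≤ e := Nat.cast_nonneg e
  have hMα : M * (α + δ) ≤ m * α + δ * m * (|α| + 2) := by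
    have h1 : (e : ℝ) * α ≤ δ * m * |α| :=
      (mul_le_mul_of_nonneg_left (le_abs_self α) he0).trans (by gcongr)
    have h2 : (e : ℝ) * δ ≤ δ * m * 1 := by gcongr
    rw [hMe]
    linarith
  have hMβ : m * (α * q - τ) - δ * m * (|α * q - τ| + 2) ≤ M * (α * q - τ - δ) := by
    have h1 : -(δ * m * |α * q - τ|) ≤ (e : ℝ) * (α * q - τ) := by
      have : (e : ℝ) * (-|α * q - τ|) ≤ e * (α * q - τ) := by
        gcongr; exact neg_abs_le _
      have : (e : ℝ) * |α * q - τ| ≤ δ * m * |α * q - τ| := by gcongr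
      linarith
    have h2 : (e : ℝ) * δ ≤ δ * m * 1 := by gcongr
    rw [hMe]
    linarith
  set J : ℕ := c * m with hJ
  have hJ1 : (9 + 8 * (J : ℝ)) ≤ (9 + 8 * c) * m := by
    rw [hJ]; push_cast
    linarith
  have hJpoly : 2 * (9 + 8 * (J : ℝ)) ^ d ≤ L := by
    calc 2 * (9 + 8 * (J : ℝ)) ^ d ≤ 2 * ((9 + 8 * (c : ℝ)) * m) ^ d := by gcongr
      _ = 2 * (9 + 8 * (c : ℝ)) ^ d * (m : ℝ) ^ d := by rw [mul_pow]; ring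
      _ ≤ L := hpoly
  have hJlin : 8 * (2 + 2 * (J : ℝ)) ≤ 2 ^ m := by
    rw [one_mul, Real.rpow_natCast, pow_one] at hlin
    refine le_trans ?_ hlin
    rw [hJ]; push_cast
    linarith
  have hδm : 0 ≤ δ * m := by positivity
  have hWJ : ∀ w ∈ W, Λ * V < 2 ^ J * (H * ν.real (Metric.closedBall w ((1 / 2) ^ (m + e)))) := by
    intro w hw
    have h1 : L * L < 2 ^ J * 2 ^ (-(M * (α + δ))) := by
      rw [hL, ← Real.rpow_natCast, ← Real.rpow_add (by norm_num), ← Real.rpow_add (by norm_num)]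
      refine Real.rpow_lt_rpow_of_exponent_lt (by norm_num) ?_
      have h2 : δ * m * (|α| + 4) ≤ m * (|α| + 4) := by
        refine mul_le_mul_of_nonneg_right (mul_le_of_le_one_left (by positivity) hδ1) ?_
        positivity
      have h3 : (m : ℝ) * α ≤ m * |α| := by gcongr; exact le_abs_self α
      have h4 : m * (2 * |α| + 6) ≤ m * (c : ℝ) := by gcongr
      rw [hJ]; push_cast
      linarith
    calc Λ * V ≤ L * (L * H) := by gcongr
      _ = L * L * H := by ring
      _ < 2 ^ J * 2 ^ (-(M * (α + δ))) * H := by gcongr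
      _ = 2 ^ J * (H * 2 ^ (-(M * (α + δ)))) := by ring
      _ ≤ _ := by gcongr; exact hWν w hw
  obtain ⟨W', hW'W, z, hW'card, hsep, hgood⟩ := (hD n).exists_doubling_family hsK x hpos m e J hΛe
    hΛ0 hJlin W hW hWd hWJ
  set r : ℝ := (1 / 2) ^ (n + m) with hr
  have hr0 : 0 < r := by positivity
  -- the transported balls are not too light
  have hlower : ∀ w ∈ W', 2 ^ (-(m : ℝ) * (α + κ)) * V ≤
      ν.real (Metric.closedBall (z w) (r / 2)) := by
    intro w hw
    have h1 := (hgood w hw).2.2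
    have h2 : V * 2 ^ (-(M * (α + δ))) ≤
        L * L * L * ν.real (Metric.closedBall (z w) (r / 2)) := by
      calc V * 2 ^ (-(M * (α + δ))) ≤
            L * H * ν.real (Metric.closedBall w ((1 / 2) ^ (m + e))) := by
            gcongr; exact hWν w (hW'W hw)
        _ = L * (H * ν.real (Metric.closedBall w ((1 / 2) ^ (m + e)))) := by ring
        _ ≤ L * (Λ * (2 * (5 + 8 * (J : ℝ)) ^ d *
              ν.real (Metric.closedBall (z w) (r / 2)))) := by gcongr
        _ ≤ L * (L * (L * ν.real (Metric.closedBall (z w) (r / 2)))) := by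
            gcongr
            refine le_trans ?_ hJpoly
            gcongr
            norm_num
        _ = _ := by ring
    have h3 : L * L * L * 2 ^ (-(m : ℝ) * (α + κ)) ≤ 2 ^ (-(M * (α + δ))) := by
      rw [hL, ← Real.rpow_add (by norm_num), ← Real.rpow_add (by norm_num),
        ← Real.rpow_add (by norm_num)]
      refine Real.rpow_le_rpow_of_exponent_le (by norm_num) ?_
      have h4 : δ * (|α| + 5) ≤ κ := by
        refine le_trans ?_ hδA1
        gcongr
        have := abs_nonneg (α * q - τ)
        have : (0 : ℝ) ≤ d := Nat.cast_nonneg d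
        linarith
      have h5 : m * (δ * (|α| + 5)) ≤ m * κ := by gcongr
      linarith
    refine le_of_mul_le_mul_left ?_ (show 0 < L * L * L by positivity)
    calc L * L * L * (2 ^ (-(m : ℝ) * (α + κ)) * V)
        = V * (L * L * L * 2 ^ (-(m : ℝ) * (α + κ))) := by ring
      _ ≤ V * 2 ^ (-(M * (α + δ))) := by gcongr
      _ ≤ _ := h2
  -- few balls are too heavy, by the local `L^q` estimate for the exponent `q + h`
  set bad := W'.filter fun w => 2 ^ (-(m : ℝ) * (α - κ)) * V <
    ν.real (Metric.closedBall (z w) r) with hbad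
  have hbadcard : (bad.card : ℝ) ≤ 2 ^ (m * (3 * δ + α * q - τ - κ * q)) := by
    have h1 := hLq n m x _ bad z (fun w hw => (hgood w (Finset.mem_filter.1 hw).1).1)
      fun w hw w' hw' hne => by
        have := hsep w (Finset.mem_filter.1 hw).1 w' (Finset.mem_filter.1 hw').1 hne
        linarith
    have h2 := card_mul_rpow_le bad _ (show 0 ≤ q + h by linarith) hV0 (by positivity)
      (fun w hw => (Finset.mem_filter.1 hw).2) h1
    have hΘ0 := (packSum_pos hb (q := q + h) (r := (1 / 2) ^ m) (by linarith) (by positivity)).le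
    have h3 : (bad.card : ℝ) * 2 ^ (-(m : ℝ) * (α - κ) * (q + h)) ≤
        L * 2 ^ (-((lqSpectrum ν (q + h) - δ) * m)) := by
      rw [← Real.rpow_mul (by norm_num)] at h2
      refine h2.trans ?_
      gcongr
    have h4 : L * 2 ^ (-((lqSpectrum ν (q + h) - δ) * m)) ≤
        2 ^ (m * (3 * δ + α * q - τ - κ * q)) * 2 ^ (-(m : ℝ) * (α - κ) * (q + h)) := by
      rw [hL, ← Real.rpow_add (by norm_num), ← Real.rpow_add (by norm_num)]
      refine Real.rpow_le_rpow_of_exponent_le (by norm_num) ?_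
      have h5 : m * (τ + α * h - κ * h) ≤ m * lqSpectrum ν (q + h) := by gcongr
      linarith
    exact le_of_mul_le_mul_right (h3.trans h4) (by positivity)
  -- there are many transported balls
  have hW'lower : 2 ^ (m * (α * q - τ) - δ * m * (|α * q - τ| + 2 * d + 3)) ≤
      (W'.card : ℝ) := by
    have h1 : (4 ^ e * (9 + 8 * (J : ℝ))) ^ d ≤ 2 ^ (δ * m * (2 * d + 1)) := by
      have h4 : ((4 : ℝ) ^ e) ^ d ≤ 2 ^ (δ * m * (2 * d)) := by
        have : ((4 : ℝ) ^ e) ^ d = 2 ^ ((e : ℝ) * (2 * d)) := by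
          rw [show (4 : ℝ) = 2 ^ 2 by norm_num, ← pow_mul, ← pow_mul, ← Real.rpow_natCast]
          congr 1; push_cast; ring
        rw [this]
        refine Real.rpow_le_rpow_of_exponent_le (by norm_num) ?_
        gcongr
      have h5 : (9 + 8 * (J : ℝ)) ^ d ≤ L := by
        have : 0 ≤ (9 + 8 * (J : ℝ)) ^ d := by positivity
        linarith
      rw [mul_pow, mul_add, mul_one, Real.rpow_add (by norm_num)]
      gcongr
    have h2 : 2 ^ (m * (α * q - τ) - δ * m * (|α * q - τ| + 2 * d + 3)) *
        2 ^ (δ * m * (2 * d + 1)) ≤ (W.card : ℝ) := by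
      refine le_trans ?_ hWcard
      rw [← Real.rpow_add (by norm_num)]
      refine Real.rpow_le_rpow_of_exponent_le (by norm_num) ?_
      linarith
    refine le_of_mul_le_mul_left ?_ (show (0 : ℝ) < 2 ^ (δ * m * (2 * d + 1)) by positivity)
    calc _ ≤ (W.card : ℝ) := by rw [mul_comm]; exact h2
      _ ≤ (4 ^ e * (9 + 8 * (J : ℝ))) ^ d * W'.card := hW'card
      _ ≤ _ := by gcongr
  set G := W'.filter fun w => ¬ 2 ^ (-(m : ℝ) * (α - κ)) * V <
    ν.real (Metric.closedBall (z w) r) with hG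
  have hGcard : 2 ^ ((m : ℝ) * (α * q - τ - κ)) ≤ (G.card : ℝ) := by
    have h1 : (bad.card : ℝ) + G.card = W'.card := by
      exact_mod_cast Finset.card_filter_add_card_filter_not (s := W') _
    set Q : ℝ := 2 ^ (m * (α * q - τ) - δ * m * (|α * q - τ| + 2 * d + 4)) with hQ
    have h2 : 2 * Q ≤ (W'.card : ℝ) := by
      refine le_trans ?_ hW'lower
      calc 2 * Q ≤ L * Q := by gcongr
        _ = _ := by
          rw [hL, hQ, ← Real.rpow_add (by norm_num)]
          congr 1; ring
    have hα0 := abs_nonneg α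
    have h3 : (bad.card : ℝ) ≤ Q := by
      refine hbadcard.trans (Real.rpow_le_rpow_of_exponent_le (by norm_num) ?_)
      have h4 : m * (δ * (|α * q - τ| + 2 * d + 7)) ≤ m * (κ * q) := by
        refine mul_le_mul_of_nonneg_left (le_trans ?_ hδAq) (Nat.cast_nonneg m)
        gcongr
        linarith
      linarith
    have h5 : 2 ^ ((m : ℝ) * (α * q - τ - κ)) ≤ Q := by
      refine Real.rpow_le_rpow_of_exponent_le (by norm_num) ?_
      have h4 : m * (δ * (|α * q - τ| + 2 * d + 4)) ≤ m * κ := by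
        gcongr
        refine le_trans ?_ hδA1
        gcongr
        linarith
      linarith
    linarith
  refine hasGoodBalls_of_finset G z hV0
    (fun w hw w' hw' => hsep w (Finset.mem_filter.1 hw).1 w' (Finset.mem_filter.1 hw').1) hGcard
    fun w hw => ?_
  obtain ⟨hwW', hwbad⟩ := Finset.mem_filter.1 hw
  have hlow := hlower w hwW'
  refine ⟨?_, hlow.trans ?_, not_lt.1 hwbad, lt_of_lt_of_le (by positivity) hlow,
    (hgood w hwW').2.1⟩
  · have := (hgood w hwW').1
    have : (0 : ℝ) < (1 / 2) ^ n := by positivity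
    linarith
  · exact measureReal_mono (Metric.closedBall_subset_closedBall (by linarith)) (measure_ne_top _ _)

theorem HasSubexpDecomposition.localBoxCountingPrinciple {K : Set (EuclideanSpace ℝ (Fin d))}
    (hdec : HasSubexpDecomposition ν K) (hfin : FiniteLqSpectrum ν) {q : ℝ} (hq : 0 < q)
    (hdiff : DifferentiableAt ℝ (lqSpectrum ν) q) : LocalBoxCountingPrinciple ν q := by
  have key : ∀ k : ℕ, ∃ (a : ℝ) (f : ℕ → ℝ), 1 ≤ k →
      0 < a ∧ (∀ n, 0 < f n) ∧ Tendsto (fun n : ℕ => f n / (n : ℝ)) atTop (𝓝 0) ∧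
      ∀ (n : ℕ) (x : EuclideanSpace ℝ (Fin d)),
        0 < ν.real (Metric.closedBall x ((1 / 2) ^ n / 2)) → ∀ m : ℕ,
        f n + a * Real.log (ν.real (Metric.closedBall x ((1 / 2) ^ n)) /
          ν.real (Metric.closedBall x ((1 / 2) ^ n / 2))) ≤ (m : ℝ) →
        HasGoodBalls ν q k n m x (1 / k) (f (n + m)) := by
    intro k
    by_cases hk : 1 ≤ k
    · obtain ⟨a, ha, hthr⟩ := hdec.exists_threshold hfin hq hdiff hk
      obtain ⟨f, hfF, hf0, hf⟩ := exists_sublinear_threshold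
        (fun n t => ∀ (m : ℕ) (x : EuclideanSpace ℝ (Fin d)),
          0 < ν.real (Metric.closedBall x ((1 / 2) ^ n / 2)) →
          t + a * Real.log (ν.real (Metric.closedBall x ((1 / 2) ^ n)) /
            ν.real (Metric.closedBall x ((1 / 2) ^ n / 2))) ≤ (m : ℝ) →
          HasGoodBalls ν q k n m x (1 / k) (4 * 9 ^ d))
        (fun ε hε => by
          obtain ⟨C, hC0, hC⟩ := hthr ε hε
          exact ⟨C, hC0, fun n t ht m x hx hm => hC n m x hx (by linarith)⟩)
        (show (0 : ℝ) < 4 * 9 ^ d by positivity)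
      exact ⟨a, f, fun _ => ⟨ha, fun n => lt_of_lt_of_le (by positivity) (hfF n), hf0,
        fun n x hx m hm => (hf n (f n) le_rfl m x hx hm).mono (hfF _)⟩⟩
    · exact ⟨0, 0, fun h => absurd h hk⟩
  choose a f hf using key
  refine ⟨a, fun k => 1 / ((k : ℝ)), f, fun k hk => ⟨(hf k hk).1, ?_, (hf k hk).2.1⟩,
    tendsto_one_div_atTop_nhds_zero_nat, fun k hk => (hf k hk).2.2.1, fun k hk n x hx m hm => ?_⟩
  · have : (0 : ℝ) < k := by exact_mod_cast hk
    positivity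
  · rw [two_zpow_neg_sub_one] at hx hm
    rw [two_zpow_neg] at hm
    exact (hf k hk).2.2.2 n x hx m hm

end LocalBoxCounting

/-! ### Conformal maps distort distances uniformly -/

section Conformal

variable {d : ℕ} {T : EuclideanSpace ℝ (Fin d) → EuclideanSpace ℝ (Fin d)}
  {U X : Set (EuclideanSpace ℝ (Fin d))}

/-- Near each point a conformal `C¹` map is almost a similarity. -/
lemma IsC1ConformalOn.exists_near_similarity (hT : IsC1ConformalOn T U) (hU : IsOpen U)
    {z : EuclideanSpace ℝ (Fin d)} (hz : z ∈ U) {η : ℝ} (hη : 0 < η) :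
    ∃ L : ℝ, 0 < L ∧ ∀ᶠ p : EuclideanSpace ℝ (Fin d) × EuclideanSpace ℝ (Fin d) in 𝓝 (z, z),
      (1 - η) * L * dist p.1 p.2 ≤ dist (T p.1) (T p.2) ∧
        dist (T p.1) (T p.2) ≤ (1 + η) * L * dist p.1 p.2 := by
  rcases subsingleton_or_nontrivial (EuclideanSpace ℝ (Fin d)) with hsub | hnon
  · refine ⟨1, one_pos, Eventually.of_forall fun p => ?_⟩
    rw [Subsingleton.elim p.1 p.2]
    simp
  · have hL : 0 < ‖fderiv ℝ T z‖ := by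
      obtain ⟨y, hy⟩ := exists_ne (0 : EuclideanSpace ℝ (Fin d))
      have h1 := hT.2 z hz y hy
      refine lt_of_le_of_ne (norm_nonneg _) fun h => h1.2 ?_
      rw [h1.1, ← h, zero_mul]
    have hsim : ∀ y, ‖fderiv ℝ T z y‖ = ‖fderiv ℝ T z‖ * ‖y‖ := by
      intro y
      by_cases hy : y = 0
      · simp [hy]
      · exact (hT.2 z hz y hy).1
    have hstrict : HasStrictFDerivAt T (fderiv ℝ T z) z :=
      (hT.1.contDiffAt (hU.mem_nhds hz)).hasStrictFDerivAt one_ne_zero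
    refine ⟨‖fderiv ℝ T z‖, hL, ?_⟩
    filter_upwards [hstrict.isLittleO.def (show 0 < η * ‖fderiv ℝ T z‖ by positivity)] with p hp
    have h1 := abs_norm_sub_norm_le (T p.1 - T p.2) (fderiv ℝ T z (p.1 - p.2))
    rw [hsim] at h1
    have h2 := abs_le.1 (h1.trans hp)
    rw [dist_eq_norm, dist_eq_norm]
    constructor <;> linarith [h2.1, h2.2]

lemma continuousOn_of_isContractingOn (h : IsContractingOn T U) : ContinuousOn T U := by
  obtain ⟨c, hc0, -, hc⟩ := h
  refine LipschitzOnWith.continuousOn (K := c.toNNReal)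
    (LipschitzOnWith.of_dist_le_mul fun x hx y hy => ?_)
  rw [dist_eq_norm, dist_eq_norm, Real.coe_toNNReal c hc0.le]
  exact hc x hx y hy

/-- On a compact set an injective conformal `C¹` map is bi-Lipschitz. -/
lemma IsC1ConformalOn.exists_antilipschitz (hT : IsC1ConformalOn T U) (hU : IsOpen U)
    (hinj : InjOn T U) (hcont : ContinuousOn T U) (hX : IsCompact X) (hXU : X ⊆ U) :
    ∃ ρ : ℝ, 0 < ρ ∧ ∀ x ∈ X, ∀ y ∈ X, ρ * dist x y ≤ dist (T x) (T y) := by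
  have key : ∃ ρ : ℝ, 0 < ρ ∧ ∀ p ∈ X ×ˢ X, ρ * dist p.1 p.2 ≤ dist (T p.1) (T p.2) := by
    refine (hX.prod hX).induction_on (p := fun s => ∃ ρ : ℝ, 0 < ρ ∧
      ∀ p ∈ s, ρ * dist p.1 p.2 ≤ dist (T p.1) (T p.2)) ⟨1, one_pos, by simp⟩ ?_ ?_ ?_
    · rintro s t hst ⟨ρ, hρ, h⟩
      exact ⟨ρ, hρ, fun p hp => h p (hst hp)⟩
    · rintro s t ⟨ρ, hρ, h⟩ ⟨ρ', hρ', h'⟩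
      refine ⟨min ρ ρ', lt_min hρ hρ', fun p hp => ?_⟩
      rcases hp with hp | hp
      · exact (mul_le_mul_of_nonneg_right (min_le_left _ _) dist_nonneg).trans (h p hp)
      · exact (mul_le_mul_of_nonneg_right (min_le_right _ _) dist_nonneg).trans (h' p hp)
    · rintro ⟨a, b⟩ ⟨ha, hb⟩
      simp only at ha hb
      by_cases hab : a = b
      · subst hab
        obtain ⟨L, hL, hnear⟩ := hT.exists_near_similarity hU (hXU ha) (η := 1 / 2) (by norm_num)
        refine ⟨_, mem_nhdsWithin_of_mem_nhds hnear, (1 - 1 / 2) * L, by linarith, fun p hp => hp.1⟩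
      · have h0 : 0 < dist (T a) (T b) :=
          dist_pos.2 fun h => hab (hinj (hXU ha) (hXU hb) h)
        have hc1 : Tendsto (fun p : EuclideanSpace ℝ (Fin d) × EuclideanSpace ℝ (Fin d) =>
            dist (T p.1) (T p.2)) (𝓝 (a, b)) (𝓝 (dist (T a) (T b))) := by
          have ha' := (hcont.continuousAt (hU.mem_nhds (hXU ha))).tendsto
          have hb' := (hcont.continuousAt (hU.mem_nhds (hXU hb))).tendsto
          rw [nhds_prod_eq]
          exact (ha'.comp tendsto_fst).dist (hb'.comp tendsto_snd)
        have hc2 : Tendsto (fun p : EuclideanSpace ℝ (Fin d) × EuclideanSpace ℝ (Fin d) =>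
            dist p.1 p.2) (𝓝 (a, b)) (𝓝 (dist a b)) := continuous_dist.tendsto (a, b)
        have h1 := hc1.eventually_const_lt (show dist (T a) (T b) / 2 < _ by linarith)
        have h2 := hc2.eventually_lt_const (show _ < dist a b + 1 by linarith)
        refine ⟨_, mem_nhdsWithin_of_mem_nhds (h1.and h2),
          dist (T a) (T b) / 2 / (dist a b + 1), by positivity, fun p hp => ?_⟩
        rw [div_mul_eq_mul_div, div_le_iff₀ (by positivity)]
        exact mul_le_mul hp.1.le hp.2.le dist_nonneg dist_nonneg
  obtain ⟨ρ, hρ, h⟩ := key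
  exact ⟨ρ, hρ, fun x hx y hy => h (x, y) ⟨hx, hy⟩⟩

/-- At small scales, a conformal `C¹` map multiplies all distances near a point of a compact set by
almost the same factor, uniformly over the compact set. -/
lemma IsC1ConformalOn.exists_uniform_distortion (hT : IsC1ConformalOn T U) (hU : IsOpen U)
    (hX : IsCompact X) (hXU : X ⊆ U) {ε : ℝ} (hε : 0 < ε) :
    ∃ δ : ℝ, 0 < δ ∧ ∀ x ∈ X, ∀ y x' y', dist y x < δ → dist x' x < δ → dist y' x < δ →
      dist (T x) (T y) * dist x' y' ≤ (1 + ε) * (dist (T x') (T y') * dist x y) := by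
  set η := ε / (2 + ε) with hη
  have hη0 : 0 < η := by positivity
  have hη1 : (1 + ε) * (1 - η) = 1 + η := by rw [hη]; field_simp; ring
  have hη2 : 0 < 1 - η := by
    have : η < 1 := by rw [hη, div_lt_one (by positivity)]; linarith
    linarith
  have hloc : ∀ z : X, ∃ (L δ : ℝ), 0 < L ∧ 0 < δ ∧ ∀ x ∈ Metric.ball z.1 δ,
      ∀ y ∈ Metric.ball z.1 δ, (1 - η) * L * dist x y ≤ dist (T x) (T y) ∧
        dist (T x) (T y) ≤ (1 + η) * L * dist x y := by
    intro z
    obtain ⟨L, hL, hnear⟩ := hT.exists_near_similarity hU (hXU z.2) hη0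
    obtain ⟨δ, hδ, hball⟩ := Metric.eventually_nhds_iff_ball.1 hnear
    refine ⟨L, δ, hL, hδ, fun x hx y hy => hball (x, y) ?_⟩
    rw [← ball_prod_same]
    exact ⟨hx, hy⟩
  choose L δ hL hδ hball using hloc
  obtain ⟨δ₀, hδ₀, hleb⟩ := lebesgue_number_lemma_of_metric hX
    (c := fun z : X => Metric.ball z.1 (δ z)) (fun z => Metric.isOpen_ball)
    fun x hx => mem_iUnion.2 ⟨⟨x, hx⟩, Metric.mem_ball_self (hδ ⟨x, hx⟩)⟩
  refine ⟨δ₀, hδ₀, fun x hx y x' y' hy hx' hy' => ?_⟩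
  obtain ⟨z, hz⟩ := hleb x hx
  have h1 := (hball z x (hz (Metric.mem_ball_self hδ₀)) y (hz hy)).2
  have h2 := (hball z x' (hz hx') y' (hz hy')).1
  calc dist (T x) (T y) * dist x' y' ≤ (1 + η) * L z * dist x y * dist x' y' := by gcongr
    _ = (1 + ε) * ((1 - η) * L z * dist x' y' * dist x y) := by rw [← hη1]; ring
    _ ≤ _ := by gcongr

end Conformal

/-! ### Bounded distortion up to subexponential factors -/

/-- The metric consequences of the `C¹`-conformal IFS hypothesis: the maps act on the compact set
`X`, contract distances by a factor between `ρ` and `c`, and are uniformly almost similarities at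
small scales. -/
structure MetricIFS {d ℓ : ℕ}
    (S : Fin ℓ → EuclideanSpace ℝ (Fin d) → EuclideanSpace ℝ (Fin d))
    (X : Set (EuclideanSpace ℝ (Fin d))) (c ρ : ℝ) : Prop where
  isCompact : IsCompact X
  mapsTo : ∀ i, MapsTo (S i) X X
  c_pos : 0 < c
  c_lt_one : c < 1
  ρ_pos : 0 < ρ
  dist_le : ∀ i, ∀ x ∈ X, ∀ y ∈ X, dist (S i x) (S i y) ≤ c * dist x y
  le_dist : ∀ i, ∀ x ∈ X, ∀ y ∈ X, ρ * dist x y ≤ dist (S i x) (S i y)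
  distortion : ∀ ε : ℝ, 0 < ε → ∃ δ : ℝ, 0 < δ ∧ ∀ i, ∀ x ∈ X, ∀ y ∈ X, ∀ x' ∈ X, ∀ y' ∈ X,
    dist y x < δ → dist x' x < δ → dist y' x < δ →
      dist (S i x) (S i y) * dist x' y' ≤ (1 + ε) * (dist (S i x') (S i y') * dist x y)

section Words

variable {d ℓ : ℕ} {S : Fin ℓ → EuclideanSpace ℝ (Fin d) → EuclideanSpace ℝ (Fin d)}
  {X K : Set (EuclideanSpace ℝ (Fin d))} {c ρ : ℝ}

lemma exists_pos_le_of_forall {ι : Type*} [Finite ι] {f : ι → ℝ} (hf : ∀ i, 0 < f i) :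
    ∃ δ : ℝ, 0 < δ ∧ ∀ i, δ ≤ f i := by
  have h : ∀ᶠ δ : ℝ in 𝓝[>] 0, ∀ i, δ ≤ f i :=
    eventually_all.2 fun i => by
      filter_upwards [Ioo_mem_nhdsGT (hf i)] with δ hδ using hδ.2.le
  obtain ⟨δ, hδ, h0⟩ := (h.and self_mem_nhdsWithin).exists
  exact ⟨δ, h0, hδ⟩

lemma IsC1ConformalIFS.exists_metricIFS (hS : IsC1ConformalIFS S X) :
    ∃ c ρ : ℝ, MetricIFS S X c ρ := by
  obtain ⟨hX, hmaps, U, hU, hXU, T, hT⟩ := hS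
  choose c hc0 hc1 hc using fun i => (hT i).2.2.2.1
  choose ρ hρ0 hρ using fun i => (hT i).2.2.2.2.exists_antilipschitz hU (hT i).2.2.1
    (continuousOn_of_isContractingOn (hT i).2.2.2.1) hX hXU
  obtain ⟨ρ', hρ'0, hρ'⟩ := exists_pos_le_of_forall hρ0
  obtain ⟨c', hc'0, hc'⟩ := exists_pos_le_of_forall (f := fun i => 1 - c i)
    fun i => by linarith [hc1 i]
  obtain ⟨c₁, hc₁0, hc₁⟩ : ∃ c₁ : ℝ, (0 < c₁ ∧ c₁ < 1) ∧ ∀ i, c i ≤ c₁ := by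
    refine ⟨max (1 / 2) (1 - c'), ⟨lt_max_of_lt_left (by norm_num), ?_⟩, fun i => ?_⟩
    · exact max_lt (by norm_num) (by linarith)
    · exact le_max_of_le_right (by linarith [hc' i])
  refine ⟨c₁, ρ', hX, hmaps, hc₁0.1, hc₁0.2, hρ'0, fun i x hx y hy => ?_, fun i x hx y hy => ?_,
    fun ε hε => ?_⟩
  · rw [← (hT i).1 hx, ← (hT i).1 hy]
    have := hc i x (hXU hx) y (hXU hy)
    rw [← dist_eq_norm, ← dist_eq_norm] at this
    exact this.trans (mul_le_mul_of_nonneg_right (hc₁ i) dist_nonneg)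
  · rw [← (hT i).1 hx, ← (hT i).1 hy]
    exact (mul_le_mul_of_nonneg_right (hρ' i) dist_nonneg).trans (hρ i x hx y hy)
  · choose δ hδ0 hδ using fun i => (hT i).2.2.2.2.exists_uniform_distortion hU hX hXU hε
    obtain ⟨δ', hδ'0, hδ'⟩ := exists_pos_le_of_forall hδ0
    refine ⟨δ', hδ'0, fun i x hx y hy x' hx' y' hy' h1 h2 h3 => ?_⟩
    rw [← (hT i).1 hx, ← (hT i).1 hy, ← (hT i).1 hx', ← (hT i).1 hy']
    exact hδ i x hx y x' y' (h1.trans_le (hδ' i)) (h2.trans_le (hδ' i)) (h3.trans_le (hδ' i))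

lemma wordMap_append (u : List (Fin ℓ)) (i : Fin ℓ) :
    wordMap S (u ++ [i]) = wordMap S u ∘ S i := by
  induction u with
  | nil => rfl
  | cons j u ih => simp only [List.cons_append, wordMap, ih, Function.comp_assoc]

lemma mapsTo_wordMap {A : Set (EuclideanSpace ℝ (Fin d))} (hS : ∀ i, MapsTo (S i) A A)
    (u : List (Fin ℓ)) : MapsTo (wordMap S u) A A := by
  induction u with
  | nil => exact mapsTo_id A
  | cons i u ih => exact (hS i).comp ih

lemma MetricIFS.continuousOn (hS : MetricIFS S X c ρ) (i : Fin ℓ) : ContinuousOn (S i) X := by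
  refine LipschitzOnWith.continuousOn (K := c.toNNReal)
    (LipschitzOnWith.of_dist_le_mul fun x hx y hy => ?_)
  rw [Real.coe_toNNReal c hS.c_pos.le]
  exact hS.dist_le i x hx y hy

lemma MetricIFS.continuousOn_wordMap (hS : MetricIFS S X c ρ) (u : List (Fin ℓ)) :
    ContinuousOn (wordMap S u) X := by
  induction u with
  | nil => exact continuousOn_id
  | cons i u ih => exact (hS.continuousOn i).comp ih (mapsTo_wordMap hS.mapsTo u)

lemma MetricIFS.dist_wordMap_le (hS : MetricIFS S X c ρ) (u : List (Fin ℓ)) :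
    ∀ x ∈ X, ∀ y ∈ X, dist (wordMap S u x) (wordMap S u y) ≤ c ^ u.length * dist x y := by
  induction u with
  | nil => intro x _ y _; simp [wordMap]
  | cons i u ih =>
    intro x hx y hy
    have hu := mapsTo_wordMap hS.mapsTo u
    calc dist (S i (wordMap S u x)) (S i (wordMap S u y))
        ≤ c * dist (wordMap S u x) (wordMap S u y) := hS.dist_le i _ (hu hx) _ (hu hy)
      _ ≤ c * (c ^ u.length * dist x y) :=
        mul_le_mul_of_nonneg_left (ih x hx y hy) hS.c_pos.le
      _ = c ^ (i :: u).length * dist x y := by rw [List.length_cons, pow_succ]; ring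

lemma MetricIFS.exists_dist_le (hS : MetricIFS S X c ρ) :
    ∃ D : ℝ, 1 ≤ D ∧ ∀ x ∈ X, ∀ y ∈ X, dist x y ≤ D :=
  ⟨max 1 (Metric.diam X), le_max_left _ _, fun _ hx _ hy =>
    (Metric.dist_le_diam_of_mem hS.isCompact.isBounded hx hy).trans (le_max_right _ _)⟩

/-- Bounded distortion: the ratios by which `S_u` changes distances on `X` agree up to a factor
subexponential in the length of `u`.  All but the first few letters to be applied act on sets so
small that each changes the quotient of two ratios by a factor at most `2^ε`. -/
lemma MetricIFS.exists_distortion_bound (hS : MetricIFS S X c ρ) {ε : ℝ} (hε : 0 < ε) :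
    ∃ C : ℝ, 1 ≤ C ∧ ∀ u : List (Fin ℓ), ∀ x ∈ X, ∀ y ∈ X, ∀ x' ∈ X, ∀ y' ∈ X,
      dist (wordMap S u x) (wordMap S u y) * dist x' y' ≤
        C * 2 ^ (ε * u.length) * (dist (wordMap S u x') (wordMap S u y') * dist x y) := by
  have h2 : (1 : ℝ) < 2 ^ ε := Real.one_lt_rpow (by norm_num) hε
  obtain ⟨δ, hδ, hdist⟩ := hS.distortion (2 ^ ε - 1) (by linarith)
  obtain ⟨D, hD1, hD⟩ := hS.exists_dist_le
  obtain ⟨N, hN⟩ := exists_pow_lt_of_lt_one (show 0 < δ / D by positivity) hS.c_lt_one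
  rw [lt_div_iff₀ (by linarith)] at hN
  set b : ℝ := max 1 ρ⁻¹ with hb
  have hb1 : 1 ≤ b := le_max_left _ _
  have hbρ : ρ⁻¹ ≤ b := le_max_right _ _
  have key : ∀ u : List (Fin ℓ), ∀ x ∈ X, ∀ y ∈ X, ∀ x' ∈ X, ∀ y' ∈ X,
      dist (wordMap S u x) (wordMap S u y) * dist x' y' ≤
        b ^ (min u.length N) * (2 ^ ε) ^ u.length *
          (dist (wordMap S u x') (wordMap S u y') * dist x y) := by
    intro u
    induction u with
    | nil => intro x _ y _ x' _ y' _; simp [wordMap, mul_comm]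
    | cons i u ih =>
      intro x hx y hy x' hx' y' hy'
      have hu := mapsTo_wordMap hS.mapsTo u
      have hIH := ih x hx y hy x' hx' y' hy'
      have hstep : dist (S i (wordMap S u x)) (S i (wordMap S u y)) *
          dist (wordMap S u x') (wordMap S u y') ≤
          b ^ (min (u.length + 1) N - min u.length N) * 2 ^ ε *
            (dist (S i (wordMap S u x')) (S i (wordMap S u y')) *
              dist (wordMap S u x) (wordMap S u y)) := by
        rcases lt_or_ge u.length N with hlt | hge
        · have e1 : min (u.length + 1) N - min u.length N = 1 := by omega
          rw [e1, pow_one]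
          have h3 := hS.dist_le i _ (hu hx) _ (hu hy)
          have h4 := hS.le_dist i _ (hu hx') _ (hu hy')
          rw [← le_inv_mul_iff₀ hS.ρ_pos] at h4
          have h5 : dist (S i (wordMap S u x)) (S i (wordMap S u y)) ≤
              1 * dist (wordMap S u x) (wordMap S u y) :=
            h3.trans (mul_le_mul_of_nonneg_right hS.c_lt_one.le dist_nonneg)
          calc _ ≤ 1 * dist (wordMap S u x) (wordMap S u y) *
                (ρ⁻¹ * dist (S i (wordMap S u x')) (S i (wordMap S u y'))) := by gcongr
            _ = ρ⁻¹ * 1 * (dist (S i (wordMap S u x')) (S i (wordMap S u y')) *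
                dist (wordMap S u x) (wordMap S u y)) := by ring
            _ ≤ _ := by gcongr
        · have e1 : min (u.length + 1) N - min u.length N = 0 := by omega
          have hsmall : ∀ v ∈ X, dist (wordMap S u v) (wordMap S u x) < δ := fun v hv =>
            calc dist (wordMap S u v) (wordMap S u x) ≤ c ^ u.length * dist v x :=
                  hS.dist_wordMap_le u v hv x hx
              _ ≤ c ^ N * D := mul_le_mul (pow_le_pow_of_le_one hS.c_pos.le hS.c_lt_one.le hge)
                  (hD v hv x hx) dist_nonneg (pow_nonneg hS.c_pos.le _)
              _ < δ := hN
          have h3 := hdist i _ (hu hx) _ (hu hy) _ (hu hx') _ (hu hy') (hsmall y hy)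
            (hsmall x' hx') (hsmall y' hy')
          rw [e1, pow_zero, one_mul]
          linarith
      have hpow : b ^ (min (u.length + 1) N) * (2 ^ ε) ^ (u.length + 1) =
          (b ^ (min (u.length + 1) N - min u.length N) * 2 ^ ε) *
            (b ^ (min u.length N) * (2 ^ ε) ^ u.length) := by
        have : b ^ (min (u.length + 1) N) =
            b ^ (min (u.length + 1) N - min u.length N) * b ^ (min u.length N) := by
          rw [← pow_add]; congr 1; omega
        rw [this, pow_succ]; ring
      change dist (S i (wordMap S u x)) (S i (wordMap S u y)) * dist x' y' ≤
        b ^ (min (u.length + 1) N) * (2 ^ ε) ^ (u.length + 1) *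
          (dist (S i (wordMap S u x')) (S i (wordMap S u y')) * dist x y)
      rw [hpow]
      set Q := dist (S i (wordMap S u x)) (S i (wordMap S u y))
      set Q' := dist (S i (wordMap S u x')) (S i (wordMap S u y'))
      set P := dist (wordMap S u x) (wordMap S u y) with hP
      set P' := dist (wordMap S u x') (wordMap S u y') with hP'
      set B := b ^ (min u.length N) * (2 ^ ε) ^ u.length
      set f := b ^ (min (u.length + 1) N - min u.length N) * (2 : ℝ) ^ ε
      have hB : 0 ≤ B := by positivity
      have hf : 0 ≤ f := by positivity
      have hQP : Q ≤ c * P := hS.dist_le i _ (hu hx) _ (hu hy)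
      have hQ0 : 0 ≤ Q := dist_nonneg
      -- the case of coinciding points, in which cancellation is not possible
      by_cases hz : P = 0 ∨ dist x' y' = 0
      · have : Q * dist x' y' = 0 := by
          rcases hz with hz | hz
          · rw [hz, mul_zero] at hQP
            rw [le_antisymm hQP hQ0, zero_mul]
          · rw [hz, mul_zero]
        rw [this]
        positivity
      · rw [not_or] at hz
        have hP0 : 0 < P := lt_of_le_of_ne dist_nonneg (Ne.symm hz.1)
        have hE0 : 0 < dist x' y' := lt_of_le_of_ne dist_nonneg (Ne.symm hz.2)
        have hP'0 : 0 < P' := by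
          refine lt_of_le_of_ne dist_nonneg fun h => ?_
          rw [← h, zero_mul, mul_zero] at hIH
          exact absurd hIH (not_le.2 (by positivity))
        refine le_of_mul_le_mul_right ?_ (mul_pos hP0 hP'0)
        calc Q * dist x' y' * (P * P') = (Q * P') * (P * dist x' y') := by ring
          _ ≤ (f * (Q' * P)) * (B * (P' * dist x y)) := by gcongr
          _ = _ := by ring
  refine ⟨b ^ N, one_le_pow₀ hb1, fun u x hx y hy x' hx' y' hy' => ?_⟩
  refine (key u x hx y hy x' hx' y' hy').trans ?_
  rw [Real.rpow_mul (by norm_num), Real.rpow_natCast]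
  gcongr
  exact min_le_right _ _

end Words

/-! ### Self-conformal measures -/

section Measure

variable {d ℓ : ℕ} {S : Fin ℓ → EuclideanSpace ℝ (Fin d) → EuclideanSpace ℝ (Fin d)}
  {X K : Set (EuclideanSpace ℝ (Fin d))} {c ρ : ℝ} {p : Fin ℓ → ℝ≥0}
  {ν : Measure (EuclideanSpace ℝ (Fin d))}

lemma IsAttractor.mapsTo (hK : IsAttractor S X K) (i : Fin ℓ) : MapsTo (S i) K K := by
  intro x hx
  rw [hK.2.2.2]
  exact mem_iUnion.2 ⟨i, mem_image_of_mem _ hx⟩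

lemma IsSelfConformalMeasure.measure_eq (hν : IsSelfConformalMeasure S X p ν)
    (hS : MetricIFS S X c ρ) {B : Set (EuclideanSpace ℝ (Fin d))} (hB : MeasurableSet B) :
    ν B = ∑ i, (p i : ℝ≥0∞) * ν (S i ⁻¹' B) := by
  have hres : ν.restrict X = ν := Measure.restrict_eq_self_of_ae_mem hν.2.1
  have hmeas : ∀ i, AEMeasurable (S i) ν := fun i => by
    have := (hS.continuousOn i).aemeasurable (μ := ν) hS.isCompact.isClosed.measurableSet
    rwa [hres] at this
  conv_lhs => rw [hν.2.2]
  rw [Measure.finsetSum_apply]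
  refine Finset.sum_congr rfl fun i _ => ?_
  rw [Measure.smul_apply, Measure.map_apply_of_aemeasurable (hmeas i) hB, ENNReal.smul_def,
    smul_eq_mul]

/-- A self-conformal measure is carried by the attractor: it is carried by all the images of `X`
under words of length `n`, which lie in neighbourhoods of `K` shrinking to `K`. -/
lemma IsSelfConformalMeasure.measure_compl_attractor (hν : IsSelfConformalMeasure S X p ν)
    (hS : MetricIFS S X c ρ) (hK : IsAttractor S X K) : ν Kᶜ = 0 := by
  obtain ⟨D, hD1, hD⟩ := hS.exists_dist_le
  obtain ⟨k₀, hk₀⟩ := hK.1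
  have hX : ∀ᵐ x ∂ν, x ∈ X := hν.2.1
  have key : ∀ n : ℕ, ∀ᵐ x ∂ν, Metric.infDist x K ≤ c ^ n * D := by
    intro n
    induction n with
    | zero =>
      filter_upwards [hX] with x hx
      rw [pow_zero, one_mul]
      exact (Metric.infDist_le_dist_of_mem hk₀).trans (hD x hx k₀ (hK.2.2.1 hk₀))
    | succ n ih =>
      have hmeas : MeasurableSet {x | Metric.infDist x K ≤ c ^ (n + 1) * D} :=
        (isClosed_le (Metric.continuous_infDist_pt K) continuous_const).measurableSet
      rw [ae_iff, ← compl_ofPred, hν.measure_eq hS hmeas.compl]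
      refine Finset.sum_eq_zero fun i _ => ?_
      have : ν (S i ⁻¹' {x | Metric.infDist x K ≤ c ^ (n + 1) * D}ᶜ) = 0 := by
        rw [measure_eq_zero_iff_ae_notMem]
        filter_upwards [hX, ih] with x hx hxn
        obtain ⟨k, hk, hxk⟩ := hK.2.1.exists_infDist_eq_dist hK.1 x
        rw [mem_preimage, mem_compl_iff, not_not]
        rw [hxk] at hxn
        calc Metric.infDist (S i x) K ≤ dist (S i x) (S i k) :=
              Metric.infDist_le_dist_of_mem (hK.mapsTo i hk)
          _ ≤ c * dist x k := hS.dist_le i x hx k (hK.2.2.1 hk)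
          _ ≤ c * (c ^ n * D) := mul_le_mul_of_nonneg_left hxn hS.c_pos.le
          _ = c ^ (n + 1) * D := by rw [pow_succ]; ring
      rw [this, mul_zero]
  have hall : ∀ᵐ x ∂ν, x ∈ K := by
    filter_upwards [ae_all_iff.2 key] with x hx
    have h0 : Tendsto (fun n : ℕ => c ^ n * D) atTop (𝓝 0) := by
      simpa using (tendsto_pow_atTop_nhds_zero_of_lt_one hS.c_pos.le hS.c_lt_one).mul_const D
    have h1 : Metric.infDist x K ≤ 0 := ge_of_tendsto' h0 hx
    rw [hK.2.1.isClosed.mem_iff_infDist_zero hK.1]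
    exact le_antisymm h1 Metric.infDist_nonneg
  exact hall

lemma IsSelfConformalMeasure.measureReal_eq (hν : IsSelfConformalMeasure S X p ν)
    (hS : MetricIFS S X c ρ) (hK : IsAttractor S X K) {B : Set (EuclideanSpace ℝ (Fin d))}
    (hB : IsClosed B) : ν.real B = ∑ i, (p i : ℝ) * ν.real (K ∩ S i ⁻¹' B) := by
  have := hν.1
  have hKc := hν.measure_compl_attractor hS hK
  have h1 : ∀ i, ν (K ∩ S i ⁻¹' B) = ν (S i ⁻¹' B) := fun i => by
    rw [inter_comm, measure_inter_conull hKc]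
  rw [Measure.real, hν.measure_eq hS hB.measurableSet, ENNReal.toReal_sum]
  · refine Finset.sum_congr rfl fun i _ => ?_
    rw [ENNReal.toReal_mul, ENNReal.coe_toReal, Measure.real, h1]
  · exact fun i _ => ENNReal.mul_ne_top ENNReal.coe_ne_top (measure_ne_top _ _)

lemma IsSelfConformalMeasure.support_subset (hν : IsSelfConformalMeasure S X p ν)
    (hS : MetricIFS S X c ρ) (hK : IsAttractor S X K) : ν.support ⊆ K :=
  Measure.support_subset_of_isClosed hK.2.1.isClosed (hν.measure_compl_attractor hS hK)

/-- Each point of the support is the image of a point of the support under one of the maps of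
positive probability. -/
lemma IsSelfConformalMeasure.exists_mem_support (hν : IsSelfConformalMeasure S X p ν)
    (hS : MetricIFS S X c ρ) (hK : IsAttractor S X K)
    {x : EuclideanSpace ℝ (Fin d)} (hx : x ∈ ν.support) :
    ∃ i, 0 < p i ∧ ∃ y ∈ ν.support, S i y = x := by
  have := hν.1
  have hsK := hν.support_subset hS hK
  have hcpt : IsCompact ν.support := hK.2.1.of_isClosed_subset Measure.isClosed_support hsK
  have hclosed : IsClosed (⋃ i ∈ {i | 0 < p i}, S i '' ν.support) :=
    (Set.toFinite _).isClosed_biUnion fun i _ => (hcpt.image_of_continuousOn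
      ((hS.continuousOn i).mono (hsK.trans hK.2.2.1))).isClosed
  have hfull : ν (⋃ i ∈ {i | 0 < p i}, S i '' ν.support)ᶜ = 0 := by
    rw [hν.measure_eq hS hclosed.measurableSet.compl]
    refine Finset.sum_eq_zero fun i _ => ?_
    by_cases hi : 0 < p i
    · rw [measure_mono_null (fun y hy => ?_) Measure.measure_compl_support, mul_zero]
      intro hys
      exact hy (mem_iUnion₂.2 ⟨i, hi, mem_image_of_mem _ hys⟩)
    · rw [nonpos_iff_eq_zero.1 (not_lt.1 hi), ENNReal.coe_zero, zero_mul]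
  obtain ⟨i, hi, y, hy, hyx⟩ := mem_iUnion₂.1 (Measure.support_subset_of_isClosed hclosed hfull hx)
  exact ⟨i, hi, y, hy, hyx⟩

/-- The measure of balls centred in the support decays at most polynomially. -/
lemma IsSelfConformalMeasure.exists_le_measureReal_closedBall
    (hν : IsSelfConformalMeasure S X p ν) (hS : MetricIFS S X c ρ) (hK : IsAttractor S X K) :
    ∃ (A c₀ : ℝ), 0 < c₀ ∧ ∀ x ∈ ν.support, ∀ r : ℝ, 0 < r → r < 1 →
      c₀ * r ^ A ≤ ν.real (Metric.closedBall x r) := by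
  have := hν.1
  have hsK := hν.support_subset hS hK
  have hKc := hν.measure_compl_attractor hS hK
  obtain ⟨D, hD1, hD⟩ := hS.exists_dist_le
  obtain ⟨π, hπ0, hπ⟩ := exists_pos_le_of_forall (ι := {i // 0 < p i}) (f := fun i => (p i.1 : ℝ))
    fun i => i.2
  have key : ∀ n : ℕ, ∀ x ∈ ν.support, π ^ n ≤ ν.real (Metric.closedBall x (c ^ n * D)) := by
    intro n
    induction n with
    | zero =>
      intro x hx
      have hsub : K ⊆ Metric.closedBall x (c ^ 0 * D) := fun y hy => by
        rw [pow_zero, one_mul]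
        exact hD y (hK.2.2.1 hy) x (hK.2.2.1 (hsK hx))
      have h1 : ν (Metric.closedBall x (c ^ 0 * D)) = 1 :=
        (prob_compl_eq_zero_iff measurableSet_closedBall).1
          (measure_mono_null (compl_subset_compl.2 hsub) hKc)
      rw [pow_zero, Measure.real, h1, ENNReal.toReal_one]
    | succ n ih =>
      intro x hx
      obtain ⟨i, hi, y, hy, rfl⟩ := hν.exists_mem_support hS hK hx
      have h1 : ν.real (Metric.closedBall y (c ^ n * D)) ≤
          ν.real (K ∩ S i ⁻¹' Metric.closedBall (S i y) (c ^ (n + 1) * D)) := by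
        rw [Measure.real, ← measure_inter_conull (s := Metric.closedBall y (c ^ n * D)) hKc,
          inter_comm]
        refine measureReal_mono (fun v hv => ⟨hv.1, ?_⟩) (measure_ne_top _ _)
        have h2 := hS.dist_le i v (hK.2.2.1 hv.1) y (hK.2.2.1 (hsK hy))
        have h3 : dist v y ≤ c ^ n * D := hv.2
        rw [mem_preimage, Metric.mem_closedBall, pow_succ]
        calc dist (S i v) (S i y) ≤ c * dist v y := h2
          _ ≤ c * (c ^ n * D) := mul_le_mul_of_nonneg_left h3 hS.c_pos.le
          _ = _ := by ring
      rw [hν.measureReal_eq hS hK Metric.isClosed_closedBall]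
      calc π ^ (n + 1) = π * π ^ n := by rw [pow_succ]; ring
        _ ≤ p i * ν.real (K ∩ S i ⁻¹' Metric.closedBall (S i y) (c ^ (n + 1) * D)) :=
          mul_le_mul (hπ ⟨i, hi⟩) ((ih y hy).trans h1) (by positivity) (p i).2
        _ ≤ _ := Finset.single_le_sum (f := fun j => (p j : ℝ) *
            ν.real (K ∩ S j ⁻¹' Metric.closedBall (S i y) (c ^ (n + 1) * D)))
            (fun j _ => mul_nonneg (p j).2 measureReal_nonneg) (Finset.mem_univ i)
  have hπ1 : π ≤ 1 := by
    obtain ⟨x, hx⟩ := support_nonempty ν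
    have h1 := key 1 x hx
    rw [pow_one] at h1
    exact h1.trans measureReal_le_one
  have hlogc : Real.log c < 0 := Real.log_neg hS.c_pos hS.c_lt_one
  have hA : 0 ≤ Real.log π / Real.log c :=
    div_nonneg_of_nonpos (Real.log_nonpos hπ0.le hπ1) hlogc.le
  have hcA : c ^ (Real.log π / Real.log c) = π := by
    rw [Real.rpow_def_of_pos hS.c_pos, mul_div_cancel₀ _ hlogc.ne, Real.exp_log hπ0]
  refine ⟨Real.log π / Real.log c, π * (D⁻¹) ^ (Real.log π / Real.log c),
    mul_pos hπ0 (Real.rpow_pos_of_pos (by positivity) _), fun x hx r hr hr1 => ?_⟩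
  have hD0 : 0 < D := by linarith
  obtain ⟨n, hn1, hn2⟩ := exists_nat_pow_near_of_lt_one (x := r / D) (y := c) (by positivity)
    (by rw [div_le_one hD0]; linarith) hS.c_pos hS.c_lt_one
  rw [lt_div_iff₀ hD0] at hn1
  calc π * D⁻¹ ^ (Real.log π / Real.log c) * r ^ (Real.log π / Real.log c)
      = π * (r / D) ^ (Real.log π / Real.log c) := by
        rw [mul_assoc, ← Real.mul_rpow (by positivity) hr.le, inv_mul_eq_div]
    _ ≤ π * (c ^ n) ^ (Real.log π / Real.log c) := by gcongr
    _ = π ^ (n + 1) := by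
        rw [← Real.rpow_natCast, ← Real.rpow_mul hS.c_pos.le, mul_comm (n : ℝ),
          Real.rpow_mul hS.c_pos.le, hcA, Real.rpow_natCast, pow_succ]
        ring
    _ ≤ ν.real (Metric.closedBall x (c ^ (n + 1) * D)) := key (n + 1) x hx
    _ ≤ _ := measureReal_mono (Metric.closedBall_subset_closedBall hn1.le) (measure_ne_top _ _)

end Measure

/-! ### Finiteness of the `L^q` spectrum -/

section Finite

variable {d : ℕ} {ν : Measure (EuclideanSpace ℝ (Fin d))} [IsProbabilityMeasure ν]

/-- If the measures of balls centred in the bounded support decay at most polynomially, then the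
`L^q` spectrum is finite, for negative `q` as well. -/
lemma finiteLqSpectrum_of_polynomial_decay (hb : Bornology.IsBounded ν.support) {A c₀ : ℝ}
    (hc₀ : 0 < c₀)
    (hdecay : ∀ x ∈ ν.support, ∀ r : ℝ, 0 < r → r < 1 →
      c₀ * r ^ A ≤ ν.real (Metric.closedBall x r)) : FiniteLqSpectrum ν := by
  intro q
  obtain ⟨R₀, hR₀⟩ := hb.subset_closedBall 0
  set R := |R₀| with hR
  have hR0 : 0 ≤ R := abs_nonneg R₀
  set Q : ℝ := |q| * (|Real.log c₀| + A) + d * (Real.log (1 + 2 * R) + 1) with hQ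
  -- the terms of a packing sum, and their number, are between powers of the radius
  have hpack : ∀ r : ℝ, 0 < r → r < Real.exp (-1) →
      packingSum ν q r ≠ 0 ∧ packingSum ν q r ≠ ⊤ ∧
        -Q ≤ Real.log (packSum ν q r) / Real.log r ∧
        Real.log (packSum ν q r) / Real.log r ≤ Q := by
    intro r hr hre
    have hr1 : r < 1 := hre.trans (by rw [Real.exp_lt_one_iff]; norm_num)
    have hlog : Real.log r < -1 := by rwa [Real.log_lt_iff_lt_exp hr]
    have hlogR : 0 ≤ Real.log (1 + 2 * R) := Real.log_nonneg (by linarith)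
    have hterm : ∀ x ∈ ν.support, |q * Real.log (ν.real (Metric.closedBall x r))| ≤
        |q| * (|Real.log c₀| + A) * (-Real.log r) := by
      intro x hx
      have hpos := measureReal_closedBall_pos hx hr
      have h1 : Real.log (ν.real (Metric.closedBall x r)) ≤ 0 :=
        Real.log_nonpos hpos.le measureReal_le_one
      have h2 := Real.log_le_log (by positivity) (hdecay x hx r hr hr1)
      rw [Real.log_mul hc₀.ne' (Real.rpow_pos_of_pos hr A).ne', Real.log_rpow hr] at h2
      rw [abs_mul, abs_of_nonpos h1, mul_assoc]
      refine mul_le_mul_of_nonneg_left ?_ (abs_nonneg q)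
      have h3 := neg_abs_le (Real.log c₀)
      have h4 : |Real.log c₀| * 1 ≤ |Real.log c₀| * (-Real.log r) :=
        mul_le_mul_of_nonneg_left (by linarith) (abs_nonneg _)
      linarith
    set E := |q| * (|Real.log c₀| + A) * (-Real.log r) with hE
    have hE' : ∀ x ∈ ν.support, Real.exp (-E) ≤ ν.real (Metric.closedBall x r) ^ q ∧
        ν.real (Metric.closedBall x r) ^ q ≤ Real.exp E := by
      intro x hx
      rw [Real.rpow_def_of_pos (measureReal_closedBall_pos hx hr), mul_comm, Real.exp_le_exp,
        Real.exp_le_exp]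
      exact abs_le.1 (hterm x hx)
    set N : ℝ := (1 + 2 * R / r) ^ d with hN
    have hN0 : 0 < N := by positivity
    have hupper : packingSum ν q r ≤ ENNReal.ofReal (N * Real.exp E) := by
      refine iSup₂_le fun s hs => ?_
      rw [sum_ennreal_eq_ofReal hr s hs.1]
      refine ENNReal.ofReal_le_ofReal ?_
      have hcard := card_le_of_separated s (fun a => a) 0 hr hR0
        (fun i hi => (Metric.mem_closedBall.1 (hR₀ (hs.1 hi))).trans (le_abs_self R₀))
        fun i hi j hj hij => (lt_dist_of_pairwiseDisjoint hr hs.2 i hi j hj hij).le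
      rw [finrank_euclideanSpace_fin] at hcard
      refine (Finset.sum_le_card_nsmul _ _ _ fun x hx => (hE' x (hs.1 hx)).2).trans ?_
      rw [nsmul_eq_mul]
      gcongr
    have hlower : ENNReal.ofReal (Real.exp (-E)) ≤ packingSum ν q r := by
      obtain ⟨x, hx⟩ := support_nonempty ν
      have h1 : ∑ y ∈ ({x} : Finset (EuclideanSpace ℝ (Fin d))),
          ν (Metric.closedBall y r) ^ q ≤ packingSum ν q r :=
        le_iSup₂_of_le {x} ⟨by simpa using hx, by simp⟩ le_rfl
      refine le_trans ?_ h1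
      rw [sum_ennreal_eq_ofReal hr {x} (by simpa using hx), Finset.sum_singleton]
      exact ENNReal.ofReal_le_ofReal (hE' x hx).1
    have htop : packingSum ν q r ≠ ⊤ := ne_top_of_le_ne_top ENNReal.ofReal_ne_top hupper
    have hzero : packingSum ν q r ≠ 0 := fun h => by
      rw [h, nonpos_iff_eq_zero, ENNReal.ofReal_eq_zero] at hlower
      exact absurd hlower (not_le.2 (Real.exp_pos _))
    have hl1 : Real.exp (-E) ≤ packSum ν q r :=
      (ENNReal.ofReal_le_iff_le_toReal htop).1 hlower
    have hu1 : packSum ν q r ≤ N * Real.exp E :=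
      ENNReal.toReal_le_of_le_ofReal (by positivity) hupper
    have hΘ : 0 < packSum ν q r := (Real.exp_pos _).trans_le hl1
    have hl2 : -E ≤ Real.log (packSum ν q r) := (Real.le_log_iff_exp_le hΘ).2 hl1
    have hu2 : Real.log (packSum ν q r) ≤ d * Real.log (1 + 2 * R / r) + E := by
      have := Real.log_le_log hΘ hu1
      rwa [Real.log_mul hN0.ne' (Real.exp_pos _).ne', Real.log_exp, hN, Real.log_pow] at this
    have hlogN : Real.log (1 + 2 * R / r) ≤ (Real.log (1 + 2 * R) + 1) * (-Real.log r) := by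
      have h1 : 1 + 2 * R / r ≤ (1 + 2 * R) / r := by
        rw [add_div]
        have : 1 ≤ 1 / r := by rw [le_div_iff₀ hr]; linarith
        linarith
      have h2 := Real.log_le_log (by positivity) h1
      rw [Real.log_div (by positivity) hr.ne'] at h2
      nlinarith
    have hbound : d * Real.log (1 + 2 * R / r) + E ≤ Q * (-Real.log r) := by
      have : (d : ℝ) * Real.log (1 + 2 * R / r) ≤
          d * ((Real.log (1 + 2 * R) + 1) * (-Real.log r)) := by gcongr
      rw [hQ, hE]
      linarith
    have hbound' : E ≤ Q * (-Real.log r) := by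
      have : 0 ≤ (d : ℝ) * Real.log (1 + 2 * R / r) := by
        have : 0 ≤ Real.log (1 + 2 * R / r) :=
          Real.log_nonneg (le_add_of_nonneg_right (by positivity))
        positivity
      linarith
    refine ⟨hzero, htop, ?_, ?_⟩
    · rw [le_div_iff_of_neg (by linarith)]
      linarith
    · rw [div_le_iff_of_neg (by linarith)]
      linarith
  have hev : ∀ᶠ r : ℝ in 𝓝[>] 0, ((-Q : ℝ) : EReal) ≤
      ENNReal.log (packingSum ν q r) / ((Real.log r : ℝ) : EReal) ∧
      ENNReal.log (packingSum ν q r) / ((Real.log r : ℝ) : EReal) ≤ ((Q : ℝ) : EReal) := by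
    filter_upwards [Ioo_mem_nhdsGT (Real.exp_pos (-1))] with r hr
    obtain ⟨h0, h1, h2, h3⟩ := hpack r hr.1 hr.2
    rw [log_packingSum_div_log h0 h1]
    exact ⟨EReal.coe_le_coe_iff.2 h2, EReal.coe_le_coe_iff.2 h3⟩
  constructor
  · exact ne_bot_of_le_ne_bot (EReal.coe_ne_bot (-Q))
      (le_liminf_of_le (by isBoundedDefault) (hev.mono fun r hr => hr.1))
  · exact ne_top_of_le_ne_top (EReal.coe_ne_top Q)
      (liminf_le_of_frequently_le (hev.mono fun r hr => hr.2).frequently (by isBoundedDefault))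

end Finite

/-! ### Decomposition over the words of a given scale -/

section Decomposition

variable {d ℓ : ℕ} {S : Fin ℓ → EuclideanSpace ℝ (Fin d) → EuclideanSpace ℝ (Fin d)}
  {X K : Set (EuclideanSpace ℝ (Fin d))} {c ρ : ℝ} {p : Fin ℓ → ℝ≥0}
  {ν : Measure (EuclideanSpace ℝ (Fin d))}

lemma MetricIFS.isBounded_image (hS : MetricIFS S X c ρ) (hKX : K ⊆ X) (u : List (Fin ℓ)) :
    Bornology.IsBounded (wordMap S u '' K) :=
  hS.isCompact.isBounded.subset
    ((image_mono hKX).trans (mapsTo_wordMap hS.mapsTo u).image_subset)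

lemma MetricIFS.diam_image_le (hS : MetricIFS S X c ρ) (hKX : K ⊆ X) {D : ℝ} (hD0 : 0 ≤ D)
    (hD : ∀ x ∈ X, ∀ y ∈ X, dist x y ≤ D) (u : List (Fin ℓ)) :
    Metric.diam (wordMap S u '' K) ≤ c ^ u.length * D := by
  have hc := hS.c_pos.le
  refine Metric.diam_le_of_forall_dist_le (by positivity) ?_
  rintro _ ⟨x, hx, rfl⟩ _ ⟨y, hy, rfl⟩
  exact (hS.dist_wordMap_le u x (hKX hx) y (hKX hy)).trans
    (mul_le_mul_of_nonneg_left (hD x (hKX hx) y (hKX hy)) (by positivity))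

lemma IsSelfConformalMeasure.measureReal_preimage_eq (hν : IsSelfConformalMeasure S X p ν)
    (hS : MetricIFS S X c ρ) (hK : IsAttractor S X K) (u : List (Fin ℓ))
    {B : Set (EuclideanSpace ℝ (Fin d))} (hB : IsClosed B) :
    ν.real (K ∩ wordMap S u ⁻¹' B) =
      ∑ i, (p i : ℝ) * ν.real (K ∩ wordMap S (u ++ [i]) ⁻¹' B) := by
  have hclosed : IsClosed (K ∩ wordMap S u ⁻¹' B) :=
    ((hS.continuousOn_wordMap u).mono hK.2.2.1).preimage_isClosed_of_isClosed hK.2.1.isClosed hB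
  rw [hν.measureReal_eq hS hK hclosed]
  refine Finset.sum_congr rfl fun i _ => ?_
  congr 2
  ext x
  simp only [mem_inter_iff, mem_preimage, wordMap_append, Function.comp_apply]
  exact ⟨fun h => ⟨h.1, h.2.2⟩, fun h => ⟨h.1, hK.mapsTo i h.1, h.2⟩⟩

/-- Splitting words until `S_u(K)` is small: after `L` rounds, every word either has length `L` and a
large image, or belongs to `W_N`. -/
lemma IsSelfConformalMeasure.exists_partial_decomposition (hν : IsSelfConformalMeasure S X p ν)
    (hS : MetricIFS S X c ρ) (hK : IsAttractor S X K) (hp : ∑ i, p i = 1) {N : ℕ}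
    (hN : (2 : ℝ) ^ (-(N : ℤ)) < Metric.diam K) (L : ℕ) :
    ∃ (ι : Type) (_ : Fintype ι) (u : ι → List (Fin ℓ)) (a : ι → ℝ), (∀ j, 0 ≤ a j) ∧
      (∀ B, IsClosed B → ν.real B = ∑ j, a j * ν.real (K ∩ wordMap S (u j) ⁻¹' B)) ∧
      ∀ j, ((2 : ℝ) ^ (-(N : ℤ)) < Metric.diam (wordMap S (u j) '' K) ∧ (u j).length = L) ∨
        u j ∈ cutWords S K N := by
  classical
  have := hν.1
  have hKc := hν.measure_compl_attractor hS hK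
  have hpR : ∑ i, (p i : ℝ) = 1 := by exact_mod_cast hp
  induction L with
  | zero =>
    refine ⟨Unit, inferInstance, fun _ => [], fun _ => 1, fun _ => zero_le_one, fun B _ => ?_,
      fun _ => Or.inl ⟨by simpa [wordMap] using hN, rfl⟩⟩
    simp only [wordMap, preimage_id, Finset.univ_unique, Finset.sum_singleton, one_mul]
    rw [Measure.real, Measure.real, inter_comm, measure_inter_conull hKc]
  | succ L ih =>
    obtain ⟨ι, hι, u, a, ha, hdec, hu⟩ := ih
    refine ⟨ι × Fin ℓ, inferInstance,
      fun j => if u j.1 ∈ cutWords S K N then u j.1 else u j.1 ++ [j.2], fun j => a j.1 * p j.2,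
      fun j => mul_nonneg (ha j.1) (p j.2).2, fun B hB => ?_, fun j => ?_⟩
    · rw [hdec B hB, Fintype.sum_prod_type]
      refine Finset.sum_congr rfl fun j _ => ?_
      by_cases hj : u j ∈ cutWords S K N
      · simp only [hj, if_true]
        rw [← Finset.sum_mul, ← Finset.mul_sum, hpR, mul_one]
      · simp only [hj, if_false]
        rw [hν.measureReal_preimage_eq hS hK (u j) hB, Finset.mul_sum]
        exact Finset.sum_congr rfl fun i _ => by ring
    · by_cases hj : u j.1 ∈ cutWords S K N
      · simp only [hj, if_true]
        exact Or.inr trivial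
      · simp only [hj, if_false]
        obtain ⟨h1, h2⟩ := (hu j.1).resolve_right hj
        rcases le_or_gt (Metric.diam (wordMap S (u j.1 ++ [j.2]) '' K)) ((2 : ℝ) ^ (-(N : ℤ)))
          with hle | hlt
        · refine Or.inr ⟨by simp, hle, ?_⟩
          rwa [List.dropLast_concat]
        · exact Or.inl ⟨hlt, by simp [h2]⟩

lemma IsSelfConformalMeasure.exists_cutWords_decomposition (hν : IsSelfConformalMeasure S X p ν)
    (hS : MetricIFS S X c ρ) (hK : IsAttractor S X K) (hp : ∑ i, p i = 1) {N : ℕ}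
    (hN : (2 : ℝ) ^ (-(N : ℤ)) < Metric.diam K) :
    ∃ (ι : Type) (_ : Fintype ι) (u : ι → List (Fin ℓ)) (a : ι → ℝ), (∀ j, 0 ≤ a j) ∧
      (∀ B, IsClosed B → ν.real B = ∑ j, a j * ν.real (K ∩ wordMap S (u j) ⁻¹' B)) ∧
      ∀ j, u j ∈ cutWords S K N := by
  obtain ⟨D, hD1, hD⟩ := hS.exists_dist_le
  obtain ⟨L, hL⟩ := exists_pow_lt_of_lt_one (show 0 < (2 : ℝ) ^ (-(N : ℤ)) / D by positivity)
    hS.c_lt_one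
  rw [lt_div_iff₀ (by linarith)] at hL
  obtain ⟨ι, hι, u, a, ha, hdec, hu⟩ := hν.exists_partial_decomposition hS hK hp hN L
  refine ⟨ι, hι, u, a, ha, hdec, fun j => (hu j).resolve_left fun h => ?_⟩
  have := hS.diam_image_le hK.2.2.1 (by linarith) hD (u j)
  rw [h.2] at this
  linarith [h.1]

/-- The words of `W_N` have length `O(N)`. -/
lemma MetricIFS.exists_length_le (hS : MetricIFS S X c ρ) (hKX : K ⊆ X) :
    ∃ A : ℝ, 0 < A ∧ ∀ N : ℕ, ∀ u ∈ cutWords S K N, (u.length : ℝ) ≤ A * (N + 1) := by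
  obtain ⟨D, hD1, hD⟩ := hS.exists_dist_le
  have hlogc : Real.log c < 0 := Real.log_neg hS.c_pos hS.c_lt_one
  have hlogD : 0 ≤ Real.log D := Real.log_nonneg hD1
  have hlog2 := Real.log_pos one_lt_two
  refine ⟨1 + (Real.log 2 + Real.log D) / (-Real.log c), ?_, fun N u hu => ?_⟩
  · have : 0 < -Real.log c := by linarith
    positivity
  · obtain ⟨hne, -, h2⟩ := hu
    have h3 := h2.trans_le (hS.diam_image_le hKX (by linarith) hD u.dropLast)
    have h4 := Real.log_lt_log (by positivity) h3
    have hlen : (u.dropLast.length : ℝ) = u.length - 1 := by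
      rw [List.length_dropLast, Nat.cast_sub (List.length_pos_iff.2 hne), Nat.cast_one]
    rw [Real.log_mul (pow_pos hS.c_pos _).ne' (by linarith), Real.log_pow, Real.log_zpow, hlen]
      at h4
    push_cast at h4
    have hN : (0 : ℝ) ≤ N := Nat.cast_nonneg N
    have h5 : ((u.length : ℝ) - 1) * (-Real.log c) ≤ (Real.log 2 + Real.log D) * (N + 1) := by
      nlinarith
    have hc0 : 0 < -Real.log c := by linarith
    rw [← le_div_iff₀ hc0, mul_div_right_comm] at h5
    linarith

/-- For a word of `W_N` the map `S_u` acts on `K`, up to subexponential factors, as a similarity of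
ratio `2⁻ᴺ`. -/
lemma MetricIFS.exists_cutWords_bilipschitz (hS : MetricIFS S X c ρ) (hK : IsAttractor S X K)
    (hdiam : 0 < Metric.diam K) {ε : ℝ} (hε : 0 < ε) :
    ∃ C : ℝ, 1 ≤ C ∧ ∀ N : ℕ, ∀ u ∈ cutWords S K N, ∀ x ∈ K, ∀ y ∈ K,
      dist x y ≤ C * 2 ^ (ε * N) * 2 ^ N * dist (wordMap S u x) (wordMap S u y) ∧
      dist (wordMap S u x) (wordMap S u y) ≤ C * 2 ^ (ε * N) * (1 / 2) ^ N * dist x y := by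
  have hKX := hK.2.2.1
  obtain ⟨A, hA0, hA⟩ := hS.exists_length_le hKX
  obtain ⟨D, hD1, hD⟩ := hS.exists_dist_le
  obtain ⟨C, hC1, hC⟩ := hS.exists_distortion_bound (show 0 < ε / A by positivity)
  have hρ := hS.ρ_pos
  obtain ⟨x₁, hx₁, y₁, hy₁, hxy₁⟩ : ∃ x ∈ K, ∃ y ∈ K, 0 < dist x y := by
    by_contra! hcon
    exact absurd (Metric.diam_le_of_forall_dist_le le_rfl hcon) (not_le.2 hdiam)
  set κ := dist x₁ y₁ with hκ
  have hrate : ∀ N : ℕ, ∀ l : ℕ, (l : ℝ) ≤ A * (N + 1) →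
      C * 2 ^ (ε / A * l) ≤ C * 2 ^ ε * 2 ^ (ε * N) := by
    intro N l hl
    rw [mul_assoc, ← Real.rpow_add (by norm_num)]
    refine mul_le_mul_of_nonneg_left ?_ (by linarith)
    refine Real.rpow_le_rpow_of_exponent_le (by norm_num) ?_
    calc ε / A * l ≤ ε / A * (A * (N + 1)) := by gcongr
      _ = ε + ε * N := by field_simp; ring
  have h2ε : (1 : ℝ) ≤ 2 ^ ε := Real.one_le_rpow (by norm_num) hε.le
  set C' := C * 2 ^ ε with hC'
  have hC'1 : 1 ≤ C' := one_le_mul_of_one_le_of_one_le hC1 h2ε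
  refine ⟨C' * (D / ρ) + C' / κ + 1, ?_, fun N u hu x hx y hy => ?_⟩
  · have : 0 ≤ C' * (D / ρ) + C' / κ := by positivity
    linarith
  have hulen := hA N u hu
  obtain ⟨hne, hu1, hu2⟩ := hu
  have hN2 : (2 : ℝ) ^ N * (1 / 2) ^ N = 1 := by rw [← mul_pow]; norm_num
  rw [two_zpow_neg] at hu1 hu2
  set F : ℝ := 2 ^ (ε * N) with hF
  have hF0 : 0 < F := by positivity
  constructor
  · obtain ⟨w, i, rfl⟩ : ∃ w i, u = w ++ [i] := ⟨u.dropLast, u.getLast hne,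
      (List.dropLast_append_getLast hne).symm⟩
    rw [List.dropLast_concat] at hu2
    obtain ⟨x₀, hx₀, y₀, hy₀, hxy₀⟩ : ∃ x ∈ K, ∃ y ∈ K,
        (1 / 2) ^ N < dist (wordMap S w x) (wordMap S w y) := by
      by_contra! hcon
      refine absurd (Metric.diam_le_of_forall_dist_le (by positivity) ?_) (not_le.2 hu2)
      rintro _ ⟨x, hx, rfl⟩ _ ⟨y, hy, rfl⟩
      exact hcon x hx y hy
    have hwlen : (w.length : ℝ) ≤ A * (N + 1) := by
      rw [List.length_append] at hulen
      push_cast at hulen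
      have : (0 : ℝ) ≤ ([i] : List (Fin ℓ)).length := Nat.cast_nonneg _
      linarith
    have h1 := hC w x₀ (hKX hx₀) y₀ (hKX hy₀) (S i x) (hKX (hK.mapsTo i hx)) (S i y)
      (hKX (hK.mapsTo i hy))
    have h2 := hS.le_dist i x (hKX hx) y (hKX hy)
    have h3 := hD x₀ (hKX hx₀) y₀ (hKX hy₀)
    rw [wordMap_append, Function.comp_apply, Function.comp_apply]
    set q := dist (wordMap S w (S i x)) (wordMap S w (S i y)) with hq
    have hq0 : 0 ≤ q := dist_nonneg
    have h4 : (1 / 2) ^ N * (ρ * dist x y) ≤ C' * F * (q * D) := by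
      calc (1 / 2) ^ N * (ρ * dist x y)
          ≤ dist (wordMap S w x₀) (wordMap S w y₀) * dist (S i x) (S i y) := by gcongr
        _ ≤ C * 2 ^ (ε / A * w.length) * (q * dist x₀ y₀) := h1
        _ ≤ C' * F * (q * D) :=
          mul_le_mul (hrate N _ hwlen) (by gcongr) (by positivity) (by positivity)
    have h5 : dist x y ≤ C' * (D / ρ) * (F * 2 ^ N * q) := by
      have h6 : dist x y = 2 ^ N / ρ * ((1 / 2) ^ N * (ρ * dist x y)) := by
        rw [show (2 : ℝ) ^ N / ρ * ((1 / 2) ^ N * (ρ * dist x y)) =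
          (2 ^ N * (1 / 2) ^ N) * dist x y * (ρ / ρ) by ring, hN2, div_self hρ.ne']
        ring
      rw [h6]
      calc 2 ^ N / ρ * ((1 / 2) ^ N * (ρ * dist x y)) ≤ 2 ^ N / ρ * (C' * F * (q * D)) := by gcongr
        _ = _ := by ring
    have h7 : 0 ≤ (C' / κ + 1) * (F * 2 ^ N * q) := by positivity
    linarith
  · have h1 := hC u x (hKX hx) y (hKX hy) x₁ (hKX hx₁) y₁ (hKX hy₁)
    have h2 : dist (wordMap S u x₁) (wordMap S u y₁) ≤ (1 / 2) ^ N :=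
      (Metric.dist_le_diam_of_mem (hS.isBounded_image hKX u) (mem_image_of_mem _ hx₁)
        (mem_image_of_mem _ hy₁)).trans hu1
    have h3 : dist (wordMap S u x) (wordMap S u y) * κ ≤ C' * F * ((1 / 2) ^ N * dist x y) := by
      exact h1.trans (mul_le_mul (hrate N _ hulen) (by gcongr) (by positivity) (by positivity))
    rw [← le_div_iff₀ hxy₁] at h3
    have h4 : 0 ≤ (C' * (D / ρ) + 1) * (F * (1 / 2) ^ N * dist x y) := by positivity
    have h5 : C' * F * ((1 / 2) ^ N * dist x y) / κ = C' / κ * (F * (1 / 2) ^ N * dist x y) := by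
      ring
    linarith

/-- The dyadic cubes of side `2^{-n-k}` that meet a ball of radius `2⁻ⁿ` are among boundedly many,
for fixed `k`. -/
lemma exists_dyadicCubes_cover (x : EuclideanSpace ℝ (Fin d)) (n k : ℕ) :
    ∃ V : Finset (Fin d → ℤ), V.card = (2 * 2 ^ k + 2) ^ d ∧
      ∀ y, dist y x ≤ (1 / 2) ^ n → ∃ v ∈ V, y ∈ dyadicCube (n + k) v := by
  classical
  refine ⟨Fintype.piFinset fun j => Finset.Icc (⌊x j * 2 ^ (n + k)⌋ - 2 ^ k)
    (⌊x j * 2 ^ (n + k)⌋ + 2 ^ k + 1), ?_, fun y hy => ?_⟩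
  · rw [Fintype.card_piFinset]
    have : ∀ j : Fin d, (Finset.Icc (⌊x j * 2 ^ (n + k)⌋ - 2 ^ k)
        (⌊x j * 2 ^ (n + k)⌋ + 2 ^ k + 1)).card = 2 * 2 ^ k + 2 := by
      intro j
      rw [Int.card_Icc]
      have : ⌊x j * 2 ^ (n + k)⌋ + 2 ^ k + 1 + 1 - (⌊x j * 2 ^ (n + k)⌋ - 2 ^ k) =
          ((2 * 2 ^ k + 2 : ℕ) : ℤ) := by push_cast; ring
      rw [this, Int.toNat_natCast]
    simp [this]
  · have h2 : (1 / 2 : ℝ) ^ n * 2 ^ (n + k) = 2 ^ k := by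
      rw [pow_add, ← mul_assoc, ← mul_pow]; norm_num
    have hpos : (0 : ℝ) < 2 ^ (n + k) := by positivity
    have hcoord : ∀ j, |y j * 2 ^ (n + k) - x j * 2 ^ (n + k)| ≤ 2 ^ k := by
      intro j
      have h1 : |y j - x j| ≤ (1 / 2) ^ n := by
        have := PiLp.norm_apply_le (y - x) j
        rw [dist_eq_norm] at hy
        exact (by simpa using this : |y j - x j| ≤ ‖y - x‖).trans hy
      rw [← sub_mul, abs_mul, abs_of_pos hpos, ← h2]
      gcongr
    refine ⟨fun j => ⌊y j * 2 ^ (n + k)⌋, Fintype.mem_piFinset.2 fun j => ?_, fun j => ?_⟩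
    · have h1 := abs_le.1 (hcoord j)
      have h3 := Int.floor_le (x j * 2 ^ (n + k))
      have h4 := Int.lt_floor_add_one (x j * 2 ^ (n + k))
      rw [Finset.mem_Icc]
      constructor
      · rw [Int.le_floor]
        push_cast
        linarith [h1.1]
      · refine Int.floor_le_iff.2 ?_
        push_cast
        linarith [h1.2]
    · have h5 : (2 : ℝ) ^ (-((n + k : ℕ) : ℤ)) = (2 ^ (n + k))⁻¹ := by
        rw [zpow_neg, zpow_natCast]
      rw [h5, ← div_eq_mul_inv, ← div_eq_mul_inv, div_le_iff₀ hpos, lt_div_iff₀ hpos]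
      exact ⟨Int.floor_le _, Int.lt_floor_add_one _⟩

lemma exists_subexp_bound {t : ℕ → ℕ} (ht : ∀ n, 0 < t n)
    (hlim : Tendsto (fun n : ℕ => Real.log (t n) / (n : ℝ)) atTop (𝓝 0)) {ε : ℝ} (hε : 0 < ε) :
    ∃ C : ℝ, 1 ≤ C ∧ ∀ n, (t n : ℝ) ≤ C * 2 ^ (ε * n) := by
  have hlog2 := Real.log_pos one_lt_two
  obtain ⟨n₁, hn₁⟩ := eventually_atTop.1
    ((hlim.eventually_lt_const (show 0 < ε * Real.log 2 by positivity)).and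
      (eventually_ge_atTop 1))
  have hsum : 0 ≤ ∑ i ∈ Finset.range n₁, (t i : ℝ) := Finset.sum_nonneg fun i _ => Nat.cast_nonneg _
  refine ⟨1 + ∑ i ∈ Finset.range n₁, (t i : ℝ), by linarith, fun n => ?_⟩
  have h1 : (1 : ℝ) ≤ 2 ^ (ε * n) := Real.one_le_rpow (by norm_num) (by positivity)
  have hnn : 0 ≤ (∑ i ∈ Finset.range n₁, (t i : ℝ)) * 2 ^ (ε * n) := by positivity
  rcases lt_or_ge n n₁ with hlt | hge
  · have h2 : (t n : ℝ) ≤ ∑ i ∈ Finset.range n₁, (t i : ℝ) :=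
      Finset.single_le_sum (f := fun i => (t i : ℝ)) (fun i _ => Nat.cast_nonneg _)
        (Finset.mem_range.2 hlt)
    nlinarith
  · obtain ⟨h2, h3⟩ := hn₁ n hge
    have hn0 : (0 : ℝ) < n := by exact_mod_cast h3
    have ht0 : (0 : ℝ) < t n := by exact_mod_cast ht n
    rw [div_lt_iff₀ hn0] at h2
    have h4 : (t n : ℝ) ≤ 2 ^ (ε * n) := by
      rw [← Real.log_le_log_iff ht0 (by positivity), Real.log_rpow (by norm_num)]
      linarith
    linarith

/-- The decomposition over the words of `W_N`, words with the same map being merged. -/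
lemma IsSelfConformalMeasure.hasDecomposition (hν : IsSelfConformalMeasure S X p ν)
    (hS : MetricIFS S X c ρ) (hK : IsAttractor S X K) (hp : ∑ i, p i = 1) {n k t : ℕ} {Λ : ℝ}
    (hk : 3 ≤ k) (hN : (2 : ℝ) ^ (-((n + k : ℕ) : ℤ)) < Metric.diam K)
    (hcount : ∀ v : Fin d → ℤ,
      ((fun u => X.domRestrict (wordMap S u)) ''
        {u | u ∈ cutWords S K (n + k) ∧
          (wordMap S u '' K ∩ dyadicCube (n + k) v).Nonempty}).encard ≤ (t : ℕ∞))
    (hlip : ∀ u ∈ cutWords S K (n + k), ∀ x ∈ K, ∀ y ∈ K,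
      dist x y ≤ Λ * 2 ^ n * dist (wordMap S u x) (wordMap S u y) ∧
      dist (wordMap S u x) (wordMap S u y) ≤ Λ * (1 / 2) ^ n * dist x y)
    (ht : (t : ℝ) * ((2 * 2 ^ k + 2) ^ d : ℕ) ≤ Λ) : HasDecomposition ν K n Λ := by
  classical
  have hKX := hK.2.2.1
  obtain ⟨ι, hι, u, a, ha, hdec, hu⟩ := hν.exists_cutWords_decomposition hS hK hp hN
  -- extension by `0` outside `X`, so that maps agreeing on `X` become equal
  let g : ι → EuclideanSpace ℝ (Fin d) → EuclideanSpace ℝ (Fin d) :=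
    fun j => X.indicator (wordMap S (u j))
  have hg : ∀ j, ∀ x ∈ K, g j x = wordMap S (u j) x := fun j x hx => indicator_of_mem (hKX hx) _
  refine ⟨Finset.univ.image g, fun s => ∑ j with g j = s, a j,
    fun s => Finset.sum_nonneg fun j _ => ha j, fun B hB => ?_, fun s hs x hx y hy => ?_,
    fun x F' hF' hmeet => ?_⟩
  · rw [hdec B hB, ← Finset.sum_fiberwise_of_maps_to (s := Finset.univ) (t := Finset.univ.image g)
      (g := g) (fun j hj => Finset.mem_image_of_mem g hj)]
    refine Finset.sum_congr rfl fun s _ => ?_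
    rw [Finset.sum_mul]
    refine Finset.sum_congr rfl fun j hj => ?_
    have hjs : g j = s := (Finset.mem_filter.1 hj).2
    congr 2
    ext x
    simp only [mem_inter_iff, mem_preimage, ← hjs]
    exact and_congr_right fun hx => by rw [hg j x hx]
  · obtain ⟨j, -, rfl⟩ := Finset.mem_image.1 hs
    rw [hg j x hx, hg j y hy]
    refine ⟨(hlip _ (hu j) x hx y hy).1, (hlip _ (hu j) x hx y hy).2, ?_⟩
    have h1 := Metric.dist_le_diam_of_mem (hS.isBounded_image hKX (u j))
      (mem_image_of_mem (wordMap S (u j)) hx) (mem_image_of_mem (wordMap S (u j)) hy)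
    have h2 := (hu j).2.1
    rw [two_zpow_neg, pow_add] at h2
    have h3 : (1 / 2 : ℝ) ^ k ≤ (1 / 2) ^ 3 :=
      pow_le_pow_of_le_one (by norm_num) (by norm_num) hk
    have h4 : (0 : ℝ) < (1 / 2) ^ n := by positivity
    nlinarith
  · obtain ⟨V, hVcard, hV⟩ := exists_dyadicCubes_cover x n k
    have hchoose : ∀ s, ∃ v, s ∈ F' → v ∈ V ∧ ∃ j, g j = s ∧
        (wordMap S (u j) '' K ∩ dyadicCube (n + k) v).Nonempty := by
      intro s
      by_cases hs : s ∈ F'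
      · obtain ⟨y, hy, hyx⟩ := hmeet s hs
        obtain ⟨v, hvV, hv⟩ := hV _ hyx
        obtain ⟨j, -, hj⟩ := Finset.mem_image.1 (hF' hs)
        refine ⟨v, fun _ => ⟨hvV, j, hj, s y, ⟨y, hy, ?_⟩, hv⟩⟩
        rw [← hj, hg j y hy]
      · exact ⟨0, fun h => absurd h hs⟩
    choose v hv using hchoose
    have hfib : ∀ w ∈ V, (F'.filter fun s => v s = w).card ≤ t := by
      intro w _
      have hinj : InjOn (fun s : EuclideanSpace ℝ (Fin d) → EuclideanSpace ℝ (Fin d) =>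
          X.domRestrict s) (F'.filter fun s => v s = w) := by
        intro s hs s' hs' hss'
        obtain ⟨j, -, rfl⟩ := Finset.mem_image.1 (hF' (Finset.mem_filter.1 hs).1)
        obtain ⟨j', -, rfl⟩ := Finset.mem_image.1 (hF' (Finset.mem_filter.1 hs').1)
        funext y
        by_cases hy : y ∈ X
        · exact congrFun hss' ⟨y, hy⟩
        · simp only [g, indicator_of_notMem hy]
      have hsub : (fun s : EuclideanSpace ℝ (Fin d) → EuclideanSpace ℝ (Fin d) =>
          X.domRestrict s) '' (F'.filter fun s => v s = w) ⊆
          (fun u => X.domRestrict (wordMap S u)) ''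
            {u | u ∈ cutWords S K (n + k) ∧
              (wordMap S u '' K ∩ dyadicCube (n + k) w).Nonempty} := by
        rintro _ ⟨s, hs, rfl⟩
        obtain ⟨hsF, hsw⟩ := Finset.mem_filter.1 hs
        obtain ⟨-, j, rfl, hne⟩ := hv s hsF
        rw [hsw] at hne
        refine ⟨u j, ⟨hu j, hne⟩, ?_⟩
        funext y
        exact (indicator_of_mem y.2 _).symm
      have h1 := (encard_le_encard hsub).trans (hcount w)
      rw [hinj.encard_image, encard_coe_eq_coe_finsetCard] at h1
      exact_mod_cast h1
    have h2 := Finset.card_le_mul_card_image_of_maps_to (s := F') (t := V) (f := v)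
      (fun s hs => (hv s hs).1) t hfib
    rw [hVcard] at h2
    exact le_trans (by exact_mod_cast h2) ht

/-- Under the asymptotically weak separation condition a self-conformal measure decomposes at all
scales with subexponential errors.  If the attractor is a point, the identity map alone gives a
decomposition. -/
theorem IsSelfConformalMeasure.hasSubexpDecomposition (hν : IsSelfConformalMeasure S X p ν)
    (hS : MetricIFS S X c ρ) (hK : IsAttractor S X K) (hp : ∑ i, p i = 1) (hA : AWSC S X K) :
    HasSubexpDecomposition ν K := by
  classical
  have hKX := hK.2.2.1
  have hKc := hν.measure_compl_attractor hS hK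
  refine ⟨hK.2.1.isBounded, hν.support_subset hS hK, fun ε hε => ?_⟩
  rcases (Metric.diam_nonneg (s := K)).eq_or_lt with hdiam | hdiam
  · have hsub : ∀ x ∈ K, ∀ y ∈ K, dist x y = 0 := fun x hx y hy =>
      le_antisymm ((Metric.dist_le_diam_of_mem hK.2.1.isBounded hx hy).trans hdiam.ge) dist_nonneg
    refine ⟨1, le_rfl, fun n => ⟨{id}, fun _ => 1, fun _ => zero_le_one, fun B _ => ?_,
      fun s hs x hx y hy => ?_, fun x F' hF' _ => ?_⟩⟩
    · rw [Finset.sum_singleton, one_mul, preimage_id, Measure.real, Measure.real, inter_comm,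
        measure_inter_conull hKc]
    · rw [Finset.mem_singleton.1 hs, id, id, hsub x hx y hy]
      exact ⟨by simp, by simp, by positivity⟩
    · have h1 : (F'.card : ℝ) ≤ 1 := by
        exact_mod_cast (Finset.card_le_card hF').trans (Finset.card_singleton _).le
      rw [one_mul]
      exact h1.trans (Real.one_le_rpow (by norm_num) (by positivity))
  · obtain ⟨t, ht0, htlim, ht⟩ := hA
    obtain ⟨k₀, hk₀⟩ := exists_pow_lt_of_lt_one hdiam (show (1 / 2 : ℝ) < 1 by norm_num)
    obtain ⟨C₁, hC₁, hlip⟩ := hS.exists_cutWords_bilipschitz hK hdiam hε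
    obtain ⟨C₂, hC₂, hsub⟩ := exists_subexp_bound ht0 htlim hε
    set k := max k₀ 3 with hk
    set G : ℝ := (((2 * 2 ^ k + 2) ^ d : ℕ) : ℝ) with hG
    have hG0 : 0 ≤ G := Nat.cast_nonneg _
    have hF1 : (1 : ℝ) ≤ 2 ^ (ε * k) := Real.one_le_rpow (by norm_num) (by positivity)
    have h2k : (1 : ℝ) ≤ 2 ^ k := one_le_pow₀ (by norm_num)
    refine ⟨C₁ * 2 ^ (ε * k) * 2 ^ k + C₂ * 2 ^ (ε * k) * G, ?_, fun n => ?_⟩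
    · have := one_le_mul_of_one_le_of_one_le (one_le_mul_of_one_le_of_one_le hC₁ hF1) h2k
      have : 0 ≤ C₂ * 2 ^ (ε * k) * G := by positivity
      linarith
    have hFn : (0 : ℝ) < 2 ^ (ε * n) := by positivity
    have hsplit : (2 : ℝ) ^ (ε * ((n + k : ℕ) : ℝ)) = 2 ^ (ε * k) * 2 ^ (ε * n) := by
      rw [← Real.rpow_add (by norm_num)]
      congr 1; push_cast; ring
    have hN : (2 : ℝ) ^ (-((n + k : ℕ) : ℤ)) < Metric.diam K := by
      rw [two_zpow_neg]
      refine lt_of_le_of_lt (pow_le_pow_of_le_one (by norm_num) (by norm_num) ?_) hk₀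
      exact (le_max_left k₀ 3).trans (Nat.le_add_left k n)
    have hΛ1 : C₁ * (2 ^ (ε * k) * 2 ^ (ε * n)) * 2 ^ k ≤
        (C₁ * 2 ^ (ε * k) * 2 ^ k + C₂ * 2 ^ (ε * k) * G) * 2 ^ (ε * n) := by
      have : 0 ≤ C₂ * 2 ^ (ε * k) * G * 2 ^ (ε * n) := by positivity
      linarith
    refine hν.hasDecomposition hS hK hp (le_max_right k₀ 3) hN
      (ht (n + k) (by have := le_max_right k₀ 3; omega)) (fun u hu x hx y hy => ?_) ?_
    · obtain ⟨h1, h2⟩ := hlip (n + k) u hu x hx y hy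
      rw [hsplit] at h1 h2
      constructor
      · refine h1.trans (mul_le_mul_of_nonneg_right ?_ dist_nonneg)
        calc C₁ * (2 ^ (ε * k) * 2 ^ (ε * n)) * 2 ^ (n + k)
            = C₁ * (2 ^ (ε * k) * 2 ^ (ε * n)) * 2 ^ k * 2 ^ n := by rw [pow_add]; ring
          _ ≤ _ := by gcongr
      · refine h2.trans (mul_le_mul_of_nonneg_right ?_ dist_nonneg)
        have h3 : (1 / 2 : ℝ) ^ (n + k) ≤ (1 / 2) ^ n :=
          pow_le_pow_of_le_one (by norm_num) (by norm_num) (Nat.le_add_right n k)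
        have h4 : C₁ * (2 ^ (ε * k) * 2 ^ (ε * n)) ≤
            C₁ * (2 ^ (ε * k) * 2 ^ (ε * n)) * 2 ^ k :=
          le_mul_of_one_le_right (by positivity) h2k
        exact mul_le_mul (h4.trans hΛ1) h3 (by positivity) (by positivity)
    · have h1 := hsub (n + k)
      rw [hsplit] at h1
      calc (t (n + k) : ℝ) * G ≤ C₂ * (2 ^ (ε * k) * 2 ^ (ε * n)) * G := by gcongr
        _ ≤ _ := by
          have : 0 ≤ C₁ * 2 ^ (ε * k) * 2 ^ k * 2 ^ (ε * n) := by positivity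
          linarith

end Decomposition

end SelfConformal

theorem theorem3p1 {d ℓ : ℕ}
    (S : Fin ℓ → EuclideanSpace ℝ (Fin d) → EuclideanSpace ℝ (Fin d))
    (X K : Set (EuclideanSpace ℝ (Fin d)))
    (hS : SelfConformal.IsC1ConformalIFS S X)
    (hK : SelfConformal.IsAttractor S X K)
    (hAWSC : SelfConformal.AWSC S X K)
    (p : Fin ℓ → NNReal) (hp : ∑ i, p i = 1)
    (ν : MeasureTheory.Measure (EuclideanSpace ℝ (Fin d)))
    (hν : SelfConformal.IsSelfConformalMeasure S X p ν) :
    SelfConformal.HasAsymptoticallyGoodMultifractalStructure ν (Set.Ioi 0) ∧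
      ∀ q ∈ SelfConformal.diffSet ν ∩ Set.Ioi 0,
        SelfConformal.LocalBoxCountingPrinciple ν q := by
  have := hν.1
  obtain ⟨c, ρ, hS'⟩ := hS.exists_metricIFS
  have hdec := hν.hasSubexpDecomposition hS' hK hp hAWSC
  obtain ⟨A, c₀, hc₀, hdecay⟩ := hν.exists_le_measureReal_closedBall hS' hK
  have hfin := SelfConformal.finiteLqSpectrum_of_polynomial_decay (hdec.1.subset hdec.2.1) hc₀
    hdecay
  have hloc : ∀ q ∈ SelfConformal.diffSet ν ∩ Set.Ioi 0,
      SelfConformal.LocalBoxCountingPrinciple ν q :=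
    fun q hq => hdec.localBoxCountingPrinciple hfin hq.2 hq.1
  exact ⟨⟨hfin, _, subset_rfl, subset_closure, hloc⟩, hloc⟩
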